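/- Let $k$ be a field and let $Sm/k$ be the category of smooth separated schemes of finite type over $k$. All products are over $k$. **The categories $\mathcal A(U,X)$.** For $U,X\in Sm/k$ let $\mathrm{Supp}(U\times X/X)$ be the set of finite (possibly empty) unions of closed irreducible subsets of $U\times X$ which are finite over $U$ and surjective over a connected component of $U$. Let $\mathrm{SubSch}(U\times X/X)$ be the set of closed subschemes $A_m=(A,\mathcal O_{U\times X}/I_A^m)$ with $A\in\mathrm{Supp}(U\times X/X)$, $I_A$ the ideal sheaf of the closed set $A$, and $m\ge 0$ ($A_0=\emptyset$). For $Z\in\mathrm{SubSch}(U\times X/X)$ write $p_U:Z\to U$ for the projection. Objects of $\mathcal A(U,X)$ are equivalence classes of triples $(n,Z,\phi)$ with $n\ge 0$, $Z\in\mathrm{SubSch}(U\times X/X)$ and $\phi:p_{U,*}\mathcal O_Z\to M_n(\mathcal O_U)$ a non-unital homomorphism of sheaves of $\mathcal O_U$-algebras; $(n,Z,\phi)$ and $(n',Z',\phi')$ are equivalent if $n=n'$ and $\phi,\phi'$ become equal on $p_{U,*}\mathcal O_{Z''}$ for some $Z''\in\mathrm{SubSch}(U\times X/X)$ containing $Z$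 and $Z'$. Put $p(\phi)=\phi(1)$ and $P(\phi)=\operatorname{im}p(\phi)\subseteq\mathcal O_U^n$, a $p_{U,*}\mathcal O_Z$-module through $\phi$. Morphisms are $\operatorname{Hom}_{p_{U,*}\mathcal O_Z}(P(\phi),P(\phi'))$, where $Z$ is a common support of the two objects. **The pairings.** For $V,U,X\in Sm/k$, the pairing $\circ:\mathcal A(V,U)\times\mathcal A(U,X)\to\mathcal A(V,X)$ sends the classes of $(n_1,Z_1,\phi_1)$ and $(n_2,Z_2,\phi_2)$ to the class of $(n_2n_1,Z_2\circ Z_1,\phi_2\circ\phi_1)$. Here $Z_2\circ Z_1=C_m$, where $C=p_{VX}\bigl((V\times Z_2^{red})\cap(Z_1^{red}\times X)\bigr)$ and $m$ is so large that $Z_1\times_UZ_2\to V\times X$ factors through a morphism $\pi:Z_1\times_UZ_2\to C_m$; and $\phi_2\circ\phi_1$ is the composite $$p_{V,*}\mathcal O_{Z_2\circ Z_1}\xrightarrow{\ \pi^*\ }q_{V,*}\mathcal O_{Z_1\times_UZ_2}\xrightarrow{\ p_{V,*}(\phi_{2,Z_1})\ }M_{n_2}(p_{V,*}\mathcal O_{Z_1})\xrightarrow{\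 M_{n_2}(\phi_1)\ }M_{n_2}(M_{n_1}(\mathcal O_V))\cong M_{n_2n_1}(\mathcal O_V),$$ where $q_V:Z_1\times_UZ_2\to V$ is the projection, $\phi_{2,Z_1}$ is the base change of $\phi_2$ along the projection $r:Z_1\to U$ (given on affine opens by $a\otimes b\mapsto a\cdot r^*(\phi_2(b))$), and the last isomorphism inserts the $(n_1,n_1)$-matrices as blocks into the $(n_2,n_2)$-matrix. With $P(\phi_{2,Z_1})=\operatorname{im}\phi_{2,Z_1}(1)\subseteq\mathcal O_{Z_1}^{n_2}$, let $$\sigma_{12}:p_{V,*}P(\phi_{2,Z_1})\otimes_{p_{V,*}\mathcal O_{Z_1}}P(\phi_1)\to P(\phi_2\circ\phi_1),\qquad m_2\otimes m_1\mapsto p(\phi_2\circ\phi_1)\bigl((\phi_1(m_{2,j})\,m_1)_{1\le j\le n_2}\bigr),$$ using $(\mathcal O_V^{n_1})^{n_2}\cong\mathcal O_V^{n_2n_1}$, $e_{i,j}\mapsto e_{i+(j-1)n_1}$. On morphisms $\alpha_1:\Phi_1\to\Phi_1'$, $\alpha_2:\Phi_2\to\Phi_2'$ (with $\Phi_1,\Phi_1'$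 represented on a common support $Z_1$) the pairing is the morphism $\alpha_2\odot\alpha_1$ with $(\alpha_2\odot\alpha_1)\circ\sigma_{12}=\sigma_{12}'\circ(r^*\alpha_2\otimes\alpha_1)$. Finally $\mathrm{id}_X\in\mathcal A(X,X)$ is the class of $(1,\Delta_X,\mathrm{id}:\mathcal O_X\to\mathcal O_X)$. **Proposition.** (1) For all $V,U,X\in Sm/k$ the above rules are well defined and determine a unique functor $\circ:\mathcal A(V,U)\times\mathcal A(U,X)\to\mathcal A(V,X)$. (2) For all $U,V,W,X\in Sm/k$ the diagram of functors $$\mathcal A(W,V)\times(\mathcal A(V,U)\times\mathcal A(U,X))\cong(\mathcal A(W,V)\times\mathcal A(V,U))\times\mathcal A(U,X)\xrightarrow{\circ\times\mathrm{id}}\mathcal A(W,U)\times\mathcal A(U,X)\xrightarrow{\circ}\mathcal A(W,X),$$ $$\mathcal A(W,V)\times(\mathcal A(V,U)\times\mathcal A(U,X))\xrightarrow{\mathrm{id}\times\circ}\mathcal A(W,V)\times\mathcal A(V,X)\xrightarrow{\circ}\mathcal A(W,X)$$ is strictly commutative: the two composite functors are equal, on objects and on morphisms. (3) The categories $\mathcal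 A(U,X)$ are additive, the pairings are bilinear, and $\{\mathrm{id}_U\}\times\mathcal A(U,X)\xrightarrow{\circ}\mathcal A(U,X)$ and $\mathcal A(U,X)\times\{\mathrm{id}_X\}\xrightarrow{\circ}\mathcal A(U,X)$ are the identity functors. Thus the pairings and the objects $\mathrm{id}_X$ make $\mathcal A$ a category on $Sm/k$ enriched in additive categories. -/

import Mathlib

open CategoryTheory CategoryTheory.Limits AlgebraicGeometry TopologicalSpace

universe u v w

noncomputable section

namespace KMotive

open Scheme (IdealSheafData)
open scoped CategoryTheory.Prod

/-- An object of `Sm/k`: a smooth separated scheme of finite type over the field `k`. -/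
structure Sm (k : Type u) [Field k] where
  scheme : Scheme.{u}
  hom : scheme ⟶ Spec (CommRingCat.of k)
  smooth : Smooth hom
  separated : IsSeparated hom
  locallyOfFiniteType : LocallyOfFiniteType hom
  quasiCompact : QuasiCompact hom

/-! ### Sheaf homomorphisms `p_* 𝒪_Z → M_n(𝒪_U)` -/

section MatHom

variable {Z Z' Z'' U : Scheme.{u}}

/-- For a `U`-morphism `g : Z' ⟶ Z` (with structure maps `p'`, `p`), the pullback of functions
`p_* 𝒪_Z → p'_* 𝒪_{Z'}` on sections over `W`. -/
def pullSec {p : Z ⟶ U} {p' : Z' ⟶ U} (g : Z' ⟶ Z) (w : g ≫ p = p') (W : U.Opens) :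
    Γ(Z, p ⁻¹ᵁ W) →+* Γ(Z', p' ⁻¹ᵁ W) :=
  (g.appLE (p ⁻¹ᵁ W) (p' ⁻¹ᵁ W) (by rw [← w]; rfl)).hom

/-- A non-unital homomorphism `p_* 𝒪_Z → M_n(𝒪_U)` of sheaves of `𝒪_U`-algebras. -/
@[ext]
structure MatHom (p : Z ⟶ U) (n : ℕ) where
  app (W : U.Opens) : Γ(Z, p ⁻¹ᵁ W) →ₙ+* Matrix (Fin n) (Fin n) Γ(U, W)
  map_smul (W : U.Opens) (a : Γ(U, W)) (f : Γ(Z, p ⁻¹ᵁ W)) :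
    app W ((p.app W).hom a * f) = a • app W f
  naturality {W W' : U.Opens} (h : W' ≤ W) (f : Γ(Z, p ⁻¹ᵁ W)) :
    app W' ((Z.presheaf.map (homOfLE ((Opens.map p.base).map (homOfLE h)).le).op).hom f) =
      (app W f).map (U.presheaf.map (homOfLE h).op).hom

end MatHom

section Correspondences

variable {k : Type u} [Field k]

/-! ### Supports -/

/-- The product `U × X` over `k`. -/
abbrev prodScheme (U X : Sm k) : Scheme.{u} := pullback U.hom X.hom

/-- The projection `U × X ⟶ U`. -/
abbrev prodFst (U X : Sm k) : prodScheme U X ⟶ U.scheme := pullback.fst U.hom X.hom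

/-- The projection `U × X ⟶ X`. -/
abbrev prodSnd (U X : Sm k) : prodScheme U X ⟶ X.scheme := pullback.snd U.hom X.hom

/-- The structure map `p_U : Z ⟶ U` of the closed subscheme `Z ⊆ U × X` with ideal sheaf `I`. -/
abbrev src {U X : Sm k} (I : IdealSheafData (prodScheme U X)) : I.subscheme ⟶ U.scheme :=
  I.subschemeι ≫ prodFst U X

/-- The map `Z ⟶ X` of the closed subscheme `Z ⊆ U × X` with ideal sheaf `I`. -/
abbrev tgt {U X : Sm k} (I : IdealSheafData (prodScheme U X)) : I.subscheme ⟶ X.scheme :=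
  I.subschemeι ≫ prodSnd U X

/-- `A` is irreducible, finite over `U` (with its reduced structure), and surjective over a
component of `U`. As `U` is smooth, its irreducible components are its connected components; for
irreducible `U` the last condition says that `A ⟶ U` is surjective. -/
structure IsElementary {U X : Sm k} (A : Closeds (prodScheme U X)) : Prop where
  irreducible : IsIrreducible (A : Set (prodScheme U X))
  finite : IsFinite (src (IdealSheafData.vanishingIdeal A))
  surjective : (prodFst U X) '' (A : Set (prodScheme U X)) ∈ irreducibleComponents U.scheme

/-- `A ∈ Supp(U × X / X)`: `A` is a finite (possibly empty) union of elementary closed subsets. -/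
def IsSupp {U X : Sm k} (A : Closeds (prodScheme U X)) : Prop :=
  ∃ S : Set (Closeds (prodScheme U X)), S.Finite ∧ (∀ B ∈ S, IsElementary B) ∧
    (A : Set (prodScheme U X)) = ⋃ B ∈ S, (B : Set (prodScheme U X))

/-- `I` is the ideal sheaf of a member of `SubSch(U × X / X)`, that is, `I = I_A ^ m` with
`A ∈ Supp(U × X / X)`. For `m = 0` this is the unit ideal (the empty subscheme). -/
def IsSubSch {U X : Sm k} (I : IdealSheafData (prodScheme U X)) : Prop :=
  ∃ A : Closeds (prodScheme U X), IsSupp A ∧ ∃ m : ℕ, I = IdealSheafData.vanishingIdeal A ^ m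

lemma IsSupp.sup {U X : Sm k} {A B : Closeds (prodScheme U X)} (hA : IsSupp A) (hB : IsSupp B) :
    IsSupp (A ⊔ B) := by
  obtain ⟨S, hS, hS', hAS⟩ := hA
  obtain ⟨T, hT, hT', hBT⟩ := hB
  refine ⟨S ∪ T, hS.union hT, fun C hC => hC.elim (hS' C) (hT' C), ?_⟩
  rw [Closeds.coe_sup, hAS, hBT, Set.biUnion_union]

/-- Any two members of `SubSch(U × X / X)` are contained in a third one. -/
lemma IsSubSch.exists_le {U X : Sm k} {I J : IdealSheafData (prodScheme U X)}
    (hI : IsSubSch I) (hJ : IsSubSch J) : ∃ L, IsSubSch L ∧ L ≤ I ∧ L ≤ J := by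
  obtain ⟨A, hA, m, rfl⟩ := hI
  obtain ⟨B, hB, m', rfl⟩ := hJ
  have key : ∀ (C D : Closeds (prodScheme U X)) (a b : ℕ), C ≤ D → a ≤ b →
      IdealSheafData.vanishingIdeal D ^ b ≤ IdealSheafData.vanishingIdeal C ^ a := by
    intro C D a b hCD hab W
    exact (Ideal.pow_le_pow_right hab).trans
      (Ideal.pow_right_mono (IdealSheafData.vanishingIdeal_antimono hCD W) a)
  exact ⟨_, ⟨A ⊔ B, hA.sup hB, max m m', rfl⟩,
    key _ _ _ _ le_sup_left (le_max_left _ _), key _ _ _ _ le_sup_right (le_max_right _ _)⟩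

/-! ### Objects of `𝒜(U, X)` -/

/-- A triple `(n, Z, φ : p_{U,*} 𝒪_Z → M_n(𝒪_U))` with given `n`; `Z ∈ SubSch(U × X / X)` is
recorded through its ideal sheaf. -/
structure Triple (U X : Sm k) (n : ℕ) where
  ideal : IdealSheafData (prodScheme U X)
  isSubSch : IsSubSch ideal
  hom : MatHom (src ideal) n

/-- Restriction of functions `p_{U,*} 𝒪_{Z''} → p_{U,*} 𝒪_Z` along a closed embedding
`Z ⊆ Z''` of closed subschemes of `U × X` (so `J ≤ I` for the ideal sheaves). -/
def can {U X : Sm k} {I J : IdealSheafData (prodScheme U X)} (h : J ≤ I) (W : U.scheme.Opens) :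
    Γ(J.subscheme, src J ⁻¹ᵁ W) →+* Γ(I.subscheme, src I ⁻¹ᵁ W) :=
  pullSec (IdealSheafData.inclusion h) (by simp [src]) W

lemma can_can {U X : Sm k} {I J L : IdealSheafData (prodScheme U X)} (h : J ≤ I) (h' : L ≤ J)
    (W : U.scheme.Opens) (f : Γ(L.subscheme, src L ⁻¹ᵁ W)) :
    can h W (can h' W f) = can (h'.trans h) W f := by
  simp only [can, pullSec, ← CommRingCat.comp_apply, Scheme.Hom.appLE_comp_appLE,
    IdealSheafData.inclusion_comp]

/-- Two triples (with the same `n`) are equivalent if their homomorphisms agree after restriction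
to a common larger `Z'' ∈ SubSch(U × X / X)`. -/
def Triple.Equivalent {U X : Sm k} {n : ℕ} (t t' : Triple U X n) : Prop :=
  ∃ (J : IdealSheafData (prodScheme U X)) (_ : IsSubSch J) (h : J ≤ t.ideal) (h' : J ≤ t'.ideal),
    ∀ (W : U.scheme.Opens) (f : Γ(J.subscheme, src J ⁻¹ᵁ W)),
      t.hom.app W (can h W f) = t'.hom.app W (can h' W f)

instance Triple.setoid (U X : Sm k) (n : ℕ) : Setoid (Triple U X n) where
  r := Triple.Equivalent
  iseqv :=
    { refl := fun t => ⟨t.ideal, t.isSubSch, le_rfl, le_rfl, fun _ _ => rfl⟩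
      symm := fun ⟨J, hJ, h, h', e⟩ => ⟨J, hJ, h', h, fun W f => (e W f).symm⟩
      trans := by
        rintro t₁ t₂ t₃ ⟨J, hJ, h₁, h₂, e⟩ ⟨K, hK, h₂', h₃, e'⟩
        obtain ⟨L, hL, hLJ, hLK⟩ := hJ.exists_le hK
        refine ⟨L, hL, hLJ.trans h₁, hLK.trans h₃, fun W f => ?_⟩
        rw [← can_can h₁ hLJ, e, can_can, ← can_can h₃ hLK, ← e', can_can] }

/-- The objects of `𝒜(U, X)`: equivalence classes of triples `(n, Z, φ)`. -/
structure Corr (U X : Sm k) where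
  n : ℕ
  cls : Quotient (Triple.setoid U X n)

/-- The class of a triple. -/
def Triple.toCorr {U X : Sm k} {n : ℕ} (t : Triple U X n) : Corr U X := ⟨n, Quotient.mk _ t⟩

namespace Corr

variable {U X : Sm k}

/-- The idempotent `p(φ) = φ(1)`, on sections over `W`. -/
def idem (Φ : Corr U X) (W : U.scheme.Opens) : Matrix (Fin Φ.n) (Fin Φ.n) Γ(U.scheme, W) :=
  Quotient.lift (fun t : Triple U X Φ.n => t.hom.app W 1)
    (by
      rintro t t' ⟨J, _, h, h', e⟩
      have := e W 1
      rwa [map_one (can h W), map_one (can h' W)] at this) Φ.cls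

/-- The sheaf `P(φ) = im p(φ) ⊆ 𝒪_U^n`, on sections over `W`. -/
def P (Φ : Corr U X) (W : U.scheme.Opens) : Submodule Γ(U.scheme, W) (Fin Φ.n → Γ(U.scheme, W)) :=
  LinearMap.range (Φ.idem W).mulVecLin

/-- The restriction `𝒪_U(W)^n → 𝒪_U(W')^n`. -/
def resVec {U : Scheme.{u}} {n : ℕ} {W W' : U.Opens} (h : W' ≤ W) (x : Fin n → Γ(U, W)) :
    Fin n → Γ(U, W') :=
  fun i => (U.presheaf.map (homOfLE h).op).hom (x i)

lemma resVec_add {U : Scheme.{u}} {n : ℕ} {W W' : U.Opens} (h : W' ≤ W) (x y : Fin n → Γ(U, W)) :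
    resVec h (x + y) = resVec h x + resVec h y := by
  ext i; simp [resVec]

lemma resVec_neg {U : Scheme.{u}} {n : ℕ} {W W' : U.Opens} (h : W' ≤ W) (x : Fin n → Γ(U, W)) :
    resVec h (-x) = -resVec h x := by
  ext i; simp [resVec]

/-- Families of linear maps `P(φ)(W) → P(φ')(W)`, `W ⊆ U` open. -/
abbrev Family (Φ Ψ : Corr U X) := ∀ W : U.scheme.Opens, Φ.P W →ₗ[Γ(U.scheme, W)] Ψ.P W

/-- A family is a morphism of presheaves on `U`. -/
def IsNatural {Φ Ψ : Corr U X} (α : Family Φ Ψ) : Prop :=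
  ∀ (W W' : U.scheme.Opens) (h : W' ≤ W) (x : Φ.P W) (y : Φ.P W'),
    (y : Fin Φ.n → Γ(U.scheme, W')) = resVec h x →
    (α W' y : Fin Ψ.n → Γ(U.scheme, W')) = resVec h (α W x)

/-- A family is linear over `p_{U,*} 𝒪_Z`, where the closed subscheme `Z` (with ideal sheaf `J`)
contains the supports of the triples `t`, `t'` and acts on `P(φ)`, `P(φ')` through them. -/
def IsLinearOver {Φ Ψ : Corr U X} (t : Triple U X Φ.n) (t' : Triple U X Ψ.n)
    (J : IdealSheafData (prodScheme U X)) (h : J ≤ t.ideal) (h' : J ≤ t'.ideal)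
    (α : Family Φ Ψ) : Prop :=
  ∀ (W : U.scheme.Opens) (f : Γ(J.subscheme, src J ⁻¹ᵁ W)) (x y : Φ.P W),
    (y : Fin Φ.n → Γ(U.scheme, W)) = (t.hom.app W (can h W f)).mulVec x →
    (α W y : Fin Ψ.n → Γ(U.scheme, W)) = (t'.hom.app W (can h' W f)).mulVec (α W x)

/-- A family is linear over `p_{U,*} 𝒪_Z`, where `Z` is a common support of the two objects. -/
def IsActionLinear {Φ Ψ : Corr U X} (α : Family Φ Ψ) : Prop :=
  ∃ (t : Triple U X Φ.n) (t' : Triple U X Ψ.n) (J : IdealSheafData (prodScheme U X))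
    (h : J ≤ t.ideal) (h' : J ≤ t'.ideal),
    Quotient.mk _ t = Φ.cls ∧ Quotient.mk _ t' = Ψ.cls ∧ IsSubSch J ∧ IsLinearOver t t' J h h' α

lemma IsLinearOver.mono {Φ Ψ : Corr U X} {t : Triple U X Φ.n} {t' : Triple U X Ψ.n}
    {J L : IdealSheafData (prodScheme U X)} {h : J ≤ t.ideal} {h' : J ≤ t'.ideal} {α : Family Φ Ψ}
    (H : IsLinearOver t t' J h h' α) (hL : L ≤ J) :
    IsLinearOver t t' L (hL.trans h) (hL.trans h') α := by
  intro W f x y hy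
  rw [← can_can h hL] at hy
  rw [← can_can h' hL]
  exact H W _ x y hy

/-- Change of representatives, after enlarging `Z`. -/
lemma IsLinearOver.change {Φ Ψ : Corr U X} {t s : Triple U X Φ.n} {t' s' : Triple U X Ψ.n}
    {J : IdealSheafData (prodScheme U X)} {h : J ≤ t.ideal} {h' : J ≤ t'.ideal} {α : Family Φ Ψ}
    (H : IsLinearOver t t' J h h' α) (hJ : IsSubSch J)
    (hs : (Quotient.mk _ t : Quotient (Triple.setoid U X Φ.n)) = Quotient.mk _ s)
    (hs' : (Quotient.mk _ t' : Quotient (Triple.setoid U X Ψ.n)) = Quotient.mk _ s') :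
    ∃ (L : IdealSheafData (prodScheme U X)) (g : L ≤ s.ideal) (g' : L ≤ s'.ideal),
      IsSubSch L ∧ IsLinearOver s s' L g g' α := by
  obtain ⟨M, hM, m₁, m₂, em⟩ := Quotient.exact hs
  obtain ⟨N, hN, n₁, n₂, en⟩ := Quotient.exact hs'
  obtain ⟨L₁, hL₁, l₁, l₂⟩ := hM.exists_le hN
  obtain ⟨L, hL, l₃, l₄⟩ := hL₁.exists_le hJ
  refine ⟨L, (l₃.trans l₁).trans m₂, (l₃.trans l₂).trans n₂, hL, fun W f x y hy => ?_⟩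
  rw [← can_can m₂ (l₃.trans l₁), ← em, can_can] at hy
  rw [← can_can n₂ (l₃.trans l₂), ← en, can_can]
  exact H.mono l₄ W f x y hy

/-- The group `Hom_{𝒜(U,X)}(Φ, Φ') = Hom_{p_{U,*} 𝒪_Z}(P(φ), P(φ'))` of morphisms of sheaves of
modules. -/
def homs (Φ Ψ : Corr U X) : AddSubgroup (Family Φ Ψ) where
  carrier := {α | IsNatural α ∧ IsActionLinear α}
  zero_mem' := by
    obtain ⟨t, ht⟩ := Quotient.exists_rep Φ.cls
    obtain ⟨t', ht'⟩ := Quotient.exists_rep Ψ.cls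
    obtain ⟨L, hL, h, h'⟩ := t.isSubSch.exists_le t'.isSubSch
    refine ⟨fun W W' h x y _ => ?_, t, t', L, h, h', ht, ht', hL, fun W f x y _ => ?_⟩
    · ext i; simp [resVec]
    · simp
  add_mem' := by
    rintro α β ⟨hα, t, t', J, h, h', ht, ht', hJ, H⟩ ⟨hβ, s, s', K, g, g', hs, hs', hK, G⟩
    refine ⟨fun W W' h x y e => ?_, ?_⟩
    · have e₁ := hα W W' h x y e
      have e₂ := hβ W W' h x y e
      simp only [Pi.add_apply, LinearMap.add_apply, Submodule.coe_add, resVec_add, e₁, e₂]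
    · obtain ⟨M, m, m', hM, G'⟩ := G.change hK (hs.trans ht.symm) (hs'.trans ht'.symm)
      obtain ⟨L, hL, l, l'⟩ := hJ.exists_le hM
      refine ⟨t, t', L, l.trans h, l.trans h', ht, ht', hL, fun W f x y e => ?_⟩
      have e₁ := H.mono l W f x y e
      have e₂ := G'.mono l' W f x y e
      simp only [Pi.add_apply, LinearMap.add_apply, Submodule.coe_add, e₁, e₂, Matrix.mulVec_add]
  neg_mem' := by
    rintro α ⟨hα, t, t', J, h, h', ht, ht', hJ, H⟩
    refine ⟨fun W W' h x y e => ?_, t, t', J, h, h', ht, ht', hJ, fun W f x y e => ?_⟩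
    · have e₁ := hα W W' h x y e
      simp only [Pi.neg_apply, LinearMap.neg_apply, NegMemClass.coe_neg, resVec_neg, e₁]
    · have e₁ := H W f x y e
      simp only [Pi.neg_apply, LinearMap.neg_apply, NegMemClass.coe_neg, e₁, Matrix.mulVec_neg]

lemma id_mem_homs (Φ : Corr U X) : (fun _ => LinearMap.id : Family Φ Φ) ∈ homs Φ Φ := by
  obtain ⟨t, ht⟩ := Quotient.exists_rep Φ.cls
  exact ⟨fun _ _ _ _ _ e => e, t, t, t.ideal, le_rfl, le_rfl, ht, ht, t.isSubSch,
    fun _ _ _ _ e => e⟩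

lemma comp_mem_homs {Φ Ψ Θ : Corr U X} {α : Family Φ Ψ} {β : Family Ψ Θ}
    (hα : α ∈ homs Φ Ψ) (hβ : β ∈ homs Ψ Θ) :
    (fun W => (β W).comp (α W) : Family Φ Θ) ∈ homs Φ Θ := by
  obtain ⟨hα, t, t', J, h, h', ht, ht', hJ, H⟩ := hα
  obtain ⟨hβ, s, s', K, g, g', hs, hs', hK, G⟩ := hβ
  refine ⟨fun W W' h x y e => hβ _ _ _ _ _ (hα _ _ _ _ _ e), ?_⟩
  obtain ⟨M, m, m', hM, G'⟩ := G.change hK (hs.trans ht'.symm) rfl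
  obtain ⟨L, hL, l, l'⟩ := hJ.exists_le hM
  exact ⟨t, s', L, l.trans h, l'.trans m', ht, hs', hL, fun W f x y e =>
    G'.mono l' W f _ _ (H.mono l W f x y e)⟩

/-- The category `𝒜(U, X)`. -/
instance category (U X : Sm k) : Category (Corr U X) where
  Hom Φ Ψ := homs Φ Ψ
  id Φ := ⟨_, id_mem_homs Φ⟩
  comp α β := ⟨_, comp_mem_homs α.2 β.2⟩

instance preadditive (U X : Sm k) : Preadditive (Corr U X) where
  homGroup Φ Ψ := inferInstanceAs (AddCommGroup (homs Φ Ψ))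
  add_comp _ _ _ α β γ := Subtype.ext <| funext fun W => LinearMap.comp_add (α.1 W) (β.1 W) (γ.1 W)
  comp_add _ _ _ α β γ := Subtype.ext <| funext fun W => LinearMap.add_comp (α.1 W) (γ.1 W) (β.1 W)

/-- The map `P(φ)(W) → P(φ')(W)` given by a morphism. -/
def Hom.app {Φ Ψ : Corr U X} (α : Φ ⟶ Ψ) (W : U.scheme.Opens) :
    Φ.P W →ₗ[Γ(U.scheme, W)] Ψ.P W :=
  Subtype.val α W

/-- The element `p(φ) v` of `P(φ)(W)`. -/
def proj (Φ : Corr U X) (W : U.scheme.Opens) (v : Fin Φ.n → Γ(U.scheme, W)) : Φ.P W :=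
  ⟨(Φ.idem W).mulVec v, v, rfl⟩

/-- The matrix over `Γ(U, 𝒪_U)` of a morphism `α : P(φ) → P(φ')`, more precisely of
`𝒪_U^n → P(φ) → P(φ') ⊆ 𝒪_U^{n'}`: its `j`-th column is `α(p(φ) e_j)`. -/
def Hom.matrix {Φ Ψ : Corr U X} (α : Φ ⟶ Ψ) : Matrix (Fin Ψ.n) (Fin Φ.n) Γ(U.scheme, ⊤) :=
  Matrix.of fun i j => (Hom.app α ⊤ (Φ.proj ⊤ (Pi.single j 1)) : Fin Ψ.n → Γ(U.scheme, ⊤)) i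

end Corr

/-! ### The pairing `𝒜(V, U) × 𝒜(U, X) → 𝒜(V, X)` -/

section Pairing

variable {V U X : Sm k}

/-- `V × U × X`, in the form `(V × U) ×_U (U × X)`. -/
abbrev prod₃ (V U X : Sm k) : Scheme.{u} := pullback (prodSnd V U) (prodFst U X)

/-- The projection `V × U × X ⟶ V × X`. -/
def p₁₃ (V U X : Sm k) : prod₃ V U X ⟶ prodScheme V X :=
  pullback.lift (pullback.fst (prodSnd V U) (prodFst U X) ≫ prodFst V U)
    (pullback.snd (prodSnd V U) (prodFst U X) ≫ prodSnd U X)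
    (by simp only [Category.assoc, ← pullback.condition (f := U.hom) (g := X.hom),
          pullback.condition (f := V.hom) (g := U.hom), pullback.condition_assoc])

/-- `B ∘ A = p_{VX}((V × B) ∩ (A × X))`. -/
def circ (B : Closeds (prodScheme U X)) (A : Closeds (prodScheme V U)) : Set (prodScheme V X) :=
  p₁₃ V U X '' ((pullback.snd (prodSnd V U) (prodFst U X)) ⁻¹' (B : Set (prodScheme U X)) ∩
    (pullback.fst (prodSnd V U) (prodFst U X)) ⁻¹' (A : Set (prodScheme V U)))

/-- `Z₁ ×_U Z₂` for closed subschemes `Z₁ ⊆ V × U`, `Z₂ ⊆ U × X`. -/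
abbrev fib (I₁ : IdealSheafData (prodScheme V U)) (I₂ : IdealSheafData (prodScheme U X)) : Scheme.{u} :=
  pullback (tgt I₁) (src I₂)

/-- The projection `Z₁ ×_U Z₂ ⟶ Z₁`. -/
abbrev fibFst (I₁ : IdealSheafData (prodScheme V U)) (I₂ : IdealSheafData (prodScheme U X)) :
    fib I₁ I₂ ⟶ I₁.subscheme := pullback.fst (tgt I₁) (src I₂)

/-- The projection `Z₁ ×_U Z₂ ⟶ Z₂`. -/
abbrev fibSnd (I₁ : IdealSheafData (prodScheme V U)) (I₂ : IdealSheafData (prodScheme U X)) :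
    fib I₁ I₂ ⟶ I₂.subscheme := pullback.snd (tgt I₁) (src I₂)

lemma fib_le (I₁ : IdealSheafData (prodScheme V U)) (I₂ : IdealSheafData (prodScheme U X))
    {U' : U.scheme.Opens} {Z' : I₁.subscheme.Opens} (h : Z' ≤ tgt I₁ ⁻¹ᵁ U') :
    fibFst I₁ I₂ ⁻¹ᵁ Z' ≤ fibSnd I₁ I₂ ⁻¹ᵁ (src I₂ ⁻¹ᵁ U') := by
  rw [← Scheme.Hom.comp_preimage, ← pullback.condition, Scheme.Hom.comp_preimage]
  exact Scheme.Hom.preimage_mono _ h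

/-- `ψ` is the base change `φ_{2,Z₁} : p_{Z₁,*} 𝒪_{Z₁ ×_U Z₂} → M_{n₂}(𝒪_{Z₁})` of `φ₂`: for
affine opens `U' ⊆ U` and `Z₁' ⊆ Z₁` with `r(Z₁') ⊆ U'` (where `r : Z₁ ⟶ U`) it is given by
`a ⊗ b ↦ a · r^*(φ₂(b))`. -/
def IsBaseChange (I₁ : IdealSheafData (prodScheme V U)) {n₂ : ℕ} (t₂ : Triple U X n₂)
    (ψ : MatHom (fibFst I₁ t₂.ideal) n₂) : Prop :=
  ∀ (U' : U.scheme.Opens) (Z' : I₁.subscheme.Opens) (_ : IsAffineOpen U') (_ : IsAffineOpen Z')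
    (h : Z' ≤ tgt I₁ ⁻¹ᵁ U') (a : Γ(I₁.subscheme, Z'))
    (b : Γ(t₂.ideal.subscheme, src t₂.ideal ⁻¹ᵁ U')),
    ψ.app Z' (((fibFst I₁ t₂.ideal).app Z').hom a *
        ((fibSnd I₁ t₂.ideal).appLE _ _ (fib_le I₁ t₂.ideal h)).hom b) =
      a • (t₂.hom.app U' b).map ((tgt I₁).appLE U' Z' h).hom

/-- The isomorphism `L : M_{n₂}(M_{n₁}(R)) ≃ M_{n₂ n₁}(R)`, inserting the `(n₁, n₁)`-matrices as
blocks into the `(n₂, n₂)`-matrix: row (and column) `i` of block `j` becomes row `i + n₁ j`. -/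
def blockMatrix {R : Type v} {n₂ n₁ : ℕ}
    (M : Matrix (Fin n₂) (Fin n₂) (Matrix (Fin n₁) (Fin n₁) R)) :
    Matrix (Fin (n₂ * n₁)) (Fin (n₂ * n₁)) R :=
  Matrix.reindex finProdFinEquiv finProdFinEquiv (Matrix.comp _ _ _ _ R M)

/-- `t₃` is a composite of `t₁ = (n₁, Z₁, φ₁)` and `t₂ = (n₂, Z₂, φ₂)`, that is, a triple
`(n₂ n₁, Z₂ ∘ Z₁, φ₂ ∘ φ₁)`: the ideal of `Z₂ ∘ Z₁` is a power of the ideal of the closed set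
`Z₂^red ∘ Z₁^red`, the morphism `Z₁ ×_U Z₂ ⟶ V × X` factors as
`π : Z₁ ×_U Z₂ ⟶ Z₂ ∘ Z₁` through it, and `(φ₂ ∘ φ₁)(f) = L(M_{n₂}(φ₁)(φ_{2,Z₁}(π^* f)))`. -/
def IsComposite {n₁ n₂ : ℕ} (t₁ : Triple V U n₁) (t₂ : Triple U X n₂)
    (t₃ : Triple V X (n₂ * n₁)) : Prop :=
  (∃ (C : Closeds (prodScheme V X)) (m : ℕ),
    (C : Set (prodScheme V X)) = circ t₂.ideal.support t₁.ideal.support ∧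
    t₃.ideal = IdealSheafData.vanishingIdeal C ^ m) ∧
  ∃ (π : fib t₁.ideal t₂.ideal ⟶ t₃.ideal.subscheme)
    (hV : π ≫ src t₃.ideal = fibFst t₁.ideal t₂.ideal ≫ src t₁.ideal)
    (_ : π ≫ tgt t₃.ideal = fibSnd t₁.ideal t₂.ideal ≫ tgt t₂.ideal)
    (ψ : MatHom (fibFst t₁.ideal t₂.ideal) n₂),
    IsBaseChange t₁.ideal t₂ ψ ∧
    ∀ (W : V.scheme.Opens) (f : Γ(t₃.ideal.subscheme, src t₃.ideal ⁻¹ᵁ W)),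
      t₃.hom.app W f =
        blockMatrix ((ψ.app (src t₁.ideal ⁻¹ᵁ W) (pullSec π hV W f)).map (t₁.hom.app W))

/-- Pullback of functions along `r : Z₁ ⟶ U`, from global functions on `U` to functions on `Z₁`
over `W ⊆ V`. -/
def rPull (I : IdealSheafData (prodScheme V U)) (W : V.scheme.Opens) :
    Γ(U.scheme, ⊤) →+* Γ(I.subscheme, src I ⁻¹ᵁ W) :=
  ((tgt I).appLE ⊤ (src I ⁻¹ᵁ W) le_top).hom

/-- Sections over `W ⊆ V` of `p_{V,*} P(φ_{2,Z₁})`, the image of the idempotent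
`p(φ_{2,Z₁}) = r^* p(φ₂)` in `p_{V,*} 𝒪_{Z₁}^{n₂}`. -/
def pulledP (I : IdealSheafData (prodScheme V U)) (Φ₂ : Corr U X) (W : V.scheme.Opens) :
    Submodule Γ(I.subscheme, src I ⁻¹ᵁ W) (Fin Φ₂.n → Γ(I.subscheme, src I ⁻¹ᵁ W)) :=
  LinearMap.range ((Φ₂.idem ⊤).map (rPull I W)).mulVecLin

/-- The map `P(φ_{2,Z₁}) → P(φ'_{2,Z₁})` induced by `α₂ : P(φ₂) → P(φ₂')`. -/
def pulledHom (I : IdealSheafData (prodScheme V U)) {Φ₂ Φ₂' : Corr U X} (α₂ : Φ₂ ⟶ Φ₂')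
    (W : V.scheme.Opens) (m₂ : Fin Φ₂.n → Γ(I.subscheme, src I ⁻¹ᵁ W)) :
    Fin Φ₂'.n → Γ(I.subscheme, src I ⁻¹ᵁ W) :=
  ((Corr.Hom.matrix α₂).map (rPull I W)).mulVec m₂

/-- The map `σ₁₂ : p_{V,*} P(φ_{2,Z₁}) ⊗ P(φ₁) → P(φ₂ ∘ φ₁)` evaluated at `m₂ ⊗ m₁`. Here
`(m₂, m₁) ↦ (φ₁(m₂_j) m₁)_j` is a vector in `(𝒪_V^{n₁})^{n₂}`, it is moved to `𝒪_V^{n₂ n₁}` by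
`e_{i,j} ↦ e_{i + n₁ j}`, and `p(φ₂ ∘ φ₁)` is applied. -/
def sigma {Φ₁ : Corr V U} {Φ₂ : Corr U X} (Φ₁₂ : Corr V X) (hn : Φ₁₂.n = Φ₂.n * Φ₁.n)
    (t₁ : Triple V U Φ₁.n) (W : V.scheme.Opens)
    (m₂ : Fin Φ₂.n → Γ(t₁.ideal.subscheme, src t₁.ideal ⁻¹ᵁ W)) (m₁ : Φ₁.P W) : Φ₁₂.P W :=
  Φ₁₂.proj W fun l =>
    let ji := finProdFinEquiv.symm (Fin.cast hn l)
    (t₁.hom.app W (m₂ ji.1)).mulVec m₁ ji.2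

/-- `F` is the pairing `𝒜(V, U) × 𝒜(U, X) ⥤ 𝒜(V, X)`. On objects it sends the classes of
`(n₁, Z₁, φ₁)` and `(n₂, Z₂, φ₂)` to the class of `(n₂ n₁, Z₂ ∘ Z₁, φ₂ ∘ φ₁)`, which exists. On
morphisms `α₁ : Φ₁ ⟶ Φ₁'`, `α₂ : Φ₂ ⟶ Φ₂'` it is `σ₁₂' ∘ (α₂ ⊗ α₁) ∘ σ₁₂⁻¹`, that is, the morphism
`α₂ ⊙ α₁` with `(α₂ ⊙ α₁)(σ₁₂(m₂ ⊗ m₁)) = σ₁₂'(α₂(m₂) ⊗ α₁(m₁))`, where `Φ₁` and `Φ₁'` are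
represented with a common support `Z₁` (with ideal sheaf `J`). -/
structure IsPairing (F : Corr V U × Corr U X ⥤ Corr V X) : Prop where
  exists_composite : ∀ {n₁ n₂ : ℕ} (t₁ : Triple V U n₁) (t₂ : Triple U X n₂),
    ∃ t₃ : Triple V X (n₂ * n₁), IsComposite t₁ t₂ t₃
  obj_eq : ∀ {n₁ n₂ : ℕ} (t₁ : Triple V U n₁) (t₂ : Triple U X n₂) (t₃ : Triple V X (n₂ * n₁)),
    IsComposite t₁ t₂ t₃ → F.obj (t₁.toCorr, t₂.toCorr) = t₃.toCorr
  n_eq : ∀ (Φ₁ : Corr V U) (Φ₂ : Corr U X), (F.obj (Φ₁, Φ₂)).n = Φ₂.n * Φ₁.n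
  map_sigma : ∀ {Φ₁ Φ₁' : Corr V U} {Φ₂ Φ₂' : Corr U X} (α₁ : Φ₁ ⟶ Φ₁') (α₂ : Φ₂ ⟶ Φ₂')
    (J : IdealSheafData (prodScheme V U)) (hJ : IsSubSch J)
    (φ₁ : MatHom (src J) Φ₁.n) (φ₁' : MatHom (src J) Φ₁'.n),
    Quotient.mk _ ⟨J, hJ, φ₁⟩ = Φ₁.cls → Quotient.mk _ ⟨J, hJ, φ₁'⟩ = Φ₁'.cls →
    ∀ (W : V.scheme.Opens), ∀ m₂ ∈ pulledP J Φ₂ W, ∀ m₁ : Φ₁.P W,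
      Corr.Hom.app (F.map (X := (Φ₁, Φ₂)) (Y := (Φ₁', Φ₂')) (α₁ ×ₘ α₂)) W
          (sigma (F.obj (Φ₁, Φ₂)) (n_eq Φ₁ Φ₂) ⟨J, hJ, φ₁⟩ W m₂ m₁) =
        sigma (F.obj (Φ₁', Φ₂')) (n_eq Φ₁' Φ₂') ⟨J, hJ, φ₁'⟩ W
          (pulledHom J α₂ W m₂) (Corr.Hom.app α₁ W m₁)

/-- `Φ` is the object `id_X = (1, Δ_X, id : 𝒪_X → 𝒪_X)` of `𝒜(X, X)`. The closed subscheme is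
`Δ_X` since it is identified by `δ` with `X`, with both projections to `X` being the identity. -/
def IsIdentity (Φ : Corr X X) : Prop :=
  ∃ (t : Triple X X 1) (δ : X.scheme ⟶ t.ideal.subscheme) (hδ : δ ≫ src t.ideal = 𝟙 X.scheme),
    IsIso δ ∧ δ ≫ tgt t.ideal = 𝟙 X.scheme ∧
    (∀ (W : X.scheme.Opens) (f : Γ(t.ideal.subscheme, src t.ideal ⁻¹ᵁ W)),
      t.hom.app W f = Matrix.of fun _ _ => pullSec δ hδ W f) ∧
    Φ = t.toCorr

end Pairing
end Correspondences

/-! ### Categories enriched in additive categories -/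

/-- The structure of a (strict) category enriched in additive categories, with objects `C` and
prescribed categories of morphisms `H a b`: all `H a b` are additive, composition consists of
bilinear functors, is strictly associative (equality of functors), and strictly unital. -/
structure AdditiveEnrichment (C : Type u) (H : C → C → Type v)
    [∀ a b, Category.{w} (H a b)] [∀ a b, Preadditive (H a b)] where
  comp (a b c : C) : H a b × H b c ⥤ H a c
  id (a : C) : H a a
  hasFiniteBiproducts (a b : C) : HasFiniteBiproducts (H a b)
  additive_left (a b c : C) (Φ : H b c) : (Prod.sectL (H a b) Φ ⋙ comp a b c).Additive
  additive_right (a b c : C) (Φ : H a b) : (Prod.sectR Φ (H b c) ⋙ comp a b c).Additive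
  assoc (a b c d : C) :
    prod.inverseAssociator (H a b) (H b c) (H c d) ⋙
        (comp a b c).prod (𝟭 (H c d)) ⋙ comp a c d =
      (𝟭 (H a b)).prod (comp b c d) ⋙ comp a b d
  id_comp (a b : C) : Prod.sectR (id a) (H a b) ⋙ comp a a b = 𝟭 (H a b)
  comp_id (a b : C) : Prod.sectL (H a b) (id b) ⋙ comp a b b = 𝟭 (H a b)

end KMotive

end

/-! A sheaf of algebras pushed forward along a finite morphism is known from its values on affine
opens, and on an affine chart the fibre product `Z₁ ×_U Z₂` is the spectrum of a tensor product. So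
a homomorphism `φ₂ : p_* 𝒪_{Z₂} → M_n(𝒪_U)` has a unique base change along any `r : Z₁ → U`, and an
identity of matrices which holds for `φ₂` persists after base change.

That `Z₂ ∘ Z₁` is again an admissible support rests on going down. A finite surjective morphism
from an irreducible scheme to a connected smooth one is universally generalizing: locally the
target is étale over an affine space, and polynomial rings over a field stay normal after adjoining
variables, which gives going down after every base change. Hence every component of the fibre
product `Z₁ ×_U Z₂` is finite and surjective over a component of `V`, and so is its image in
`V × X`.

Objects may be represented by homomorphisms `q_* 𝒪_Y → M_n(𝒪_U)` for arbitrary `Y → U × X` which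
factor through an admissible thickening, and morphisms by matrices of functions on `U` which
intertwine two such homomorphisms. In these terms composition is the block matrix with `(i, j)`
block `Φ₁(N i j) * M`. Associativity, the units and bilinearity become identities between block
matrices, except for the associativity of the objects, which is the transitivity of base change. -/

noncomputable section

namespace KMotive

open Scheme (IdealSheafData)
open scoped CategoryTheory.Prod

/-! ### Functions on open subschemes -/

section Functions

variable {X Y Z : Scheme.{u}}

/-- Restriction of functions to a smaller open subset. -/
def res {W W' : X.Opens} (h : W' ≤ W) : Γ(X, W) →+* Γ(X, W') :=
  (X.presheaf.map (homOfLE h).op).hom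

/-- Pullback of functions along a morphism, to any open subset of the preimage. -/
def pull (a : Y ⟶ X) {W : X.Opens} {W' : Y.Opens} (h : W' ≤ a ⁻¹ᵁ W) : Γ(X, W) →+* Γ(Y, W') :=
  (a.appLE W W' h).hom

lemma res_res {W W' W'' : X.Opens} (h : W' ≤ W) (h' : W'' ≤ W') (x : Γ(X, W)) :
    res h' (res h x) = res (h'.trans h) x := by
  simp only [res, ← CommRingCat.comp_apply, ← Functor.map_comp]
  rfl

@[simp]
lemma res_self {W : X.Opens} (h : W ≤ W) (x : Γ(X, W)) : res h x = x := by
  simp [res]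

lemma pull_pull (a : Y ⟶ X) (b : Z ⟶ Y) {W : X.Opens} {W' : Y.Opens} {W'' : Z.Opens}
    (h : W' ≤ a ⁻¹ᵁ W) (h' : W'' ≤ b ⁻¹ᵁ W') (x : Γ(X, W)) :
    pull b h' (pull a h x) = pull (b ≫ a) (h'.trans (b.preimage_mono h)) x := by
  simp only [pull, ← CommRingCat.comp_apply, Scheme.Hom.appLE_comp_appLE]

lemma res_pull (a : Y ⟶ X) {W : X.Opens} {W' W'' : Y.Opens} (h : W' ≤ a ⁻¹ᵁ W) (h' : W'' ≤ W')
    (x : Γ(X, W)) : res h' (pull a h x) = pull a (h'.trans h) x := by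
  simp only [pull, res, ← CommRingCat.comp_apply, Scheme.Hom.appLE_map]

lemma pull_res (a : Y ⟶ X) {V W : X.Opens} {W' : Y.Opens} (h : W' ≤ a ⁻¹ᵁ W) (h' : W ≤ V)
    (x : Γ(X, V)) : pull a h (res h' x) = pull a (h.trans (a.preimage_mono h')) x := by
  simp only [pull, res, ← CommRingCat.comp_apply, Scheme.Hom.map_appLE]

lemma pull_congr {a b : Y ⟶ X} (e : a = b) {W : X.Opens} {W' : Y.Opens} (h : W' ≤ a ⁻¹ᵁ W)
    (x : Γ(X, W)) : pull a h x = pull b (e ▸ h) x := by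
  subst e
  rfl

lemma pull_id {W W' : X.Opens} (h : W' ≤ (𝟙 X) ⁻¹ᵁ W) (x : Γ(X, W)) :
    pull (𝟙 X) h x = res (show W' ≤ W from h) x := by
  simp only [pull, res, Scheme.Hom.appLE]
  congr 2

lemma app_eq_pull (a : Y ⟶ X) (W : X.Opens) (x : Γ(X, W)) :
    (a.app W).hom x = pull a le_rfl x := by
  rw [pull, Scheme.Hom.app_eq_appLE]

lemma matrix_eq_of_locally_eq {α β : Type*} {W : X.Opens} {f g : Matrix α β Γ(X, W)}
    (H : ∀ x ∈ W, ∃ (V : X.Opens) (h : V ≤ W), x ∈ V ∧ f.map (res h) = g.map (res h)) : f = g := by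
  ext a b
  refine X.IsSheaf.section_ext fun x hx => ?_
  obtain ⟨V, h, hxV, e⟩ := H x hx
  exact ⟨V, h, hxV, congr_fun₂ e a b⟩

lemma exists_matrix_gluing {ι : Type*} {α β : Type*} {W : X.Opens} {V : ι → X.Opens}
    (hV : ∀ i, V i ≤ W) (hW : ∀ x ∈ W, ∃ i, x ∈ V i) (s : ∀ i, Matrix α β Γ(X, V i))
    (H : ∀ i j, (s i).map (res (inf_le_left : V i ⊓ V j ≤ V i)) =
      (s j).map (res (inf_le_right : V i ⊓ V j ≤ V j))) :
    ∃ t : Matrix α β Γ(X, W), ∀ i, t.map (res (hV i)) = s i := by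
  have glue_entry (a : α) (b : β) : ∃ t : Γ(X, W), ∀ i, res (hV i) t = s i a b :=
    (X.sheaf.existsUnique_gluing' V W (fun i => homOfLE (hV i)) (fun x hx => by simpa using hW x hx)
      (fun i => s i a b) fun i j => congr_fun₂ (H i j) a b).exists
  choose t ht using glue_entry
  exact ⟨Matrix.of t, fun i => by ext a b; exact ht a b i⟩

end Functions

/-! ### Block matrices -/

section Block

variable {R S : Type*} {a b c d e m : ℕ}

/-- The matrix with the given rectangular blocks; the variant of `blockMatrix` needed for morphisms
between objects of different ranks. -/
def blockRect (M : Matrix (Fin a) (Fin b) (Matrix (Fin c) (Fin d) R)) :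
    Matrix (Fin (a * c)) (Fin (b * d)) R :=
  Matrix.reindex finProdFinEquiv finProdFinEquiv (Matrix.comp _ _ _ _ R M)

/-- The vector with the given blocks. -/
def blockVec (v : Fin a → Fin c → R) : Fin (a * c) → R :=
  fun i => v (finProdFinEquiv.symm i).1 (finProdFinEquiv.symm i).2

lemma blockMatrix_eq_blockRect (M : Matrix (Fin a) (Fin a) (Matrix (Fin c) (Fin c) R)) :
    blockMatrix M = blockRect M := rfl

@[simp]
lemma blockRect_apply (M : Matrix (Fin a) (Fin b) (Matrix (Fin c) (Fin d) R)) (i : Fin a)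
    (j : Fin b) (k : Fin c) (l : Fin d) :
    blockRect M (finProdFinEquiv (i, k)) (finProdFinEquiv (j, l)) = M i j k l := by
  simp [blockRect, -finProdFinEquiv_symm_apply]

lemma matrix_ext_blocks {M N : Matrix (Fin (a * c)) (Fin (b * d)) R}
    (H : ∀ i j k l, M (finProdFinEquiv (i, k)) (finProdFinEquiv (j, l)) =
      N (finProdFinEquiv (i, k)) (finProdFinEquiv (j, l))) : M = N := by
  ext x y
  obtain ⟨⟨i, k⟩, rfl⟩ := finProdFinEquiv.surjective x
  obtain ⟨⟨j, l⟩, rfl⟩ := finProdFinEquiv.surjective y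
  exact H i j k l

lemma blockRect_map (M : Matrix (Fin a) (Fin b) (Matrix (Fin c) (Fin d) R)) (g : R → S) :
    (blockRect M).map g = blockRect (M.map fun N => N.map g) := rfl

lemma blockRect_add [Add R] (M N : Matrix (Fin a) (Fin b) (Matrix (Fin c) (Fin d) R)) :
    blockRect (M + N) = blockRect M + blockRect N := rfl

lemma blockRect_mul_blockRect [NonUnitalNonAssocSemiring R]
    (M : Matrix (Fin a) (Fin b) (Matrix (Fin c) (Fin d) R))
    (N : Matrix (Fin b) (Fin e) (Matrix (Fin d) (Fin m) R)) :
    blockRect M * blockRect N = blockRect (Matrix.of fun i k => ∑ j, M i j * N j k) := by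
  refine matrix_ext_blocks fun i j k l => ?_
  simp [Matrix.mul_apply, Matrix.sum_apply, ← finProdFinEquiv.sum_comp, Fintype.sum_prod_type]

lemma blockRect_mul [NonUnitalNonAssocSemiring R]
    (M : Matrix (Fin a) (Fin b) (Matrix (Fin c) (Fin c) R))
    (N : Matrix (Fin b) (Fin e) (Matrix (Fin c) (Fin c) R)) :
    blockRect M * blockRect N = blockRect (M * N) :=
  blockRect_mul_blockRect M N

lemma blockRect_mulVec [NonUnitalNonAssocSemiring R]
    (M : Matrix (Fin a) (Fin b) (Matrix (Fin c) (Fin d) R)) (v : Fin b → Fin d → R) :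
    (blockRect M).mulVec (blockVec v) = blockVec fun i => ∑ j, (M i j).mulVec (v j) := by
  ext x
  obtain ⟨⟨i, k⟩, rfl⟩ := finProdFinEquiv.surjective x
  simp [blockVec, Matrix.mulVec, dotProduct, ← finProdFinEquiv.sum_comp, Fintype.sum_prod_type,
    Finset.sum_apply, -finProdFinEquiv_symm_apply]

/-- The matrix with `(i, j)` block `f (N i j) * M`: the shape of the composite of two morphisms with
matrices `N` and `M`, where `f` is the action of functions on the middle scheme. -/
def blockMul {A : Type*} [NonUnitalNonAssocSemiring R] (f : A → Matrix (Fin c) (Fin c) R)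
    (N : Matrix (Fin a) (Fin b) A) (M : Matrix (Fin c) (Fin d) R) :
    Matrix (Fin (a * c)) (Fin (b * d)) R :=
  blockRect (N.map fun x => f x * M)

@[simp]
lemma blockMul_apply {A : Type*} [NonUnitalNonAssocSemiring R] (f : A → Matrix (Fin c) (Fin c) R)
    (N : Matrix (Fin a) (Fin b) A) (M : Matrix (Fin c) (Fin d) R) (i : Fin a) (j : Fin b)
    (k : Fin c) (l : Fin d) :
    blockMul f N M (finProdFinEquiv (i, k)) (finProdFinEquiv (j, l)) = (f (N i j) * M) k l :=
  blockRect_apply _ i j k l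

lemma blockRect_map_eq_blockMul {A : Type*} [NonAssocSemiring R] (f : A → Matrix (Fin c) (Fin c) R)
    (N : Matrix (Fin a) (Fin b) A) : blockRect (N.map f) = blockMul f N 1 := by
  simp only [blockMul, Matrix.mul_one]

lemma blockMul_map {A B : Type*} [NonAssocSemiring R] [NonAssocSemiring S]
    {f : A → Matrix (Fin c) (Fin c) R} {g : B → Matrix (Fin c) (Fin c) S} {r : R →+* S} {s : A → B}
    (h : ∀ x, (f x).map r = g (s x)) (N : Matrix (Fin a) (Fin b) A) (M : Matrix (Fin c) (Fin d) R) :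
    (blockMul f N M).map r = blockMul g (N.map s) (M.map r) := by
  refine matrix_ext_blocks fun i j k l => ?_
  rw [Matrix.map_apply, blockMul_apply, blockMul_apply, Matrix.map_apply, ← h, ← Matrix.map_mul,
    Matrix.map_apply]

lemma blockMul_add_left {A : Type*} [NonUnitalNonAssocSemiring A] [NonUnitalNonAssocSemiring R]
    (f : A →ₙ+* Matrix (Fin c) (Fin c) R) (N N' : Matrix (Fin a) (Fin b) A)
    (M : Matrix (Fin c) (Fin d) R) :
    blockMul f (N + N') M = blockMul f N M + blockMul f N' M := by
  refine matrix_ext_blocks fun i j k l => ?_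
  simp only [blockMul_apply, Matrix.add_apply, map_add, Matrix.add_mul]

lemma blockMul_add_right {A : Type*} [NonUnitalNonAssocSemiring R]
    (f : A → Matrix (Fin c) (Fin c) R) (N : Matrix (Fin a) (Fin b) A)
    (M M' : Matrix (Fin c) (Fin d) R) :
    blockMul f N (M + M') = blockMul f N M + blockMul f N M' := by
  refine matrix_ext_blocks fun i j k l => ?_
  simp only [blockMul_apply, Matrix.add_apply, Matrix.mul_add]

lemma blockMul_mul_blockMul {A : Type*} [NonUnitalNonAssocSemiring A] [NonUnitalSemiring R]
    {f : A →ₙ+* Matrix (Fin c) (Fin c) R} {g : A → Matrix (Fin d) (Fin d) R}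
    {M : Matrix (Fin c) (Fin d) R} (h : ∀ x, M * g x = f x * M) (N : Matrix (Fin a) (Fin b) A)
    (N' : Matrix (Fin b) (Fin e) A) (M' : Matrix (Fin d) (Fin m) R) :
    blockMul f N M * blockMul g N' M' = blockMul f (N * N') (M * M') := by
  rw [blockMul, blockMul, blockMul, blockRect_mul_blockRect]
  congr 1
  ext1 i k
  calc ∑ j, (f (N i j) * M) * (g (N' j k) * M')
      = ∑ j, f (N i j * N' j k) * (M * M') := Finset.sum_congr rfl fun j _ => by
        rw [Matrix.mul_assoc, ← Matrix.mul_assoc M, h, map_mul, Matrix.mul_assoc, Matrix.mul_assoc]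
    _ = f ((N * N') i k) * (M * M') := by rw [Matrix.mul_apply, map_sum, Matrix.sum_mul]

lemma blockMul_mulVec {A : Type*} [NonUnitalNonAssocSemiring A] [NonUnitalSemiring R]
    {f : A →ₙ+* Matrix (Fin c) (Fin c) R} {g : A → Matrix (Fin d) (Fin d) R}
    {M : Matrix (Fin c) (Fin d) R} (h : ∀ x, M * g x = f x * M) (N : Matrix (Fin a) (Fin b) A)
    (x : Fin b → A) (y : Fin d → R) :
    (blockMul f N M).mulVec (blockVec fun j => (g (x j)).mulVec y) =
      blockVec fun i => (f (N.mulVec x i)).mulVec (M.mulVec y) := by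
  refine (blockRect_mulVec _ _).trans (congr_arg blockVec (funext fun i => ?_))
  calc ∑ j, (f (N i j) * M).mulVec ((g (x j)).mulVec y)
      = ∑ j, (f (N i j * x j)).mulVec (M.mulVec y) := Finset.sum_congr rfl fun j _ => by
        rw [Matrix.mulVec_mulVec, Matrix.mul_assoc, h, map_mul, Matrix.mulVec_mulVec,
          Matrix.mul_assoc]
    _ = (f (N.mulVec x i)).mulVec (M.mulVec y) := by
        rw [← Matrix.sum_mulVec, ← map_sum, Matrix.mulVec, dotProduct]

end Block

/-! ### Base change of matrix homomorphisms of rings -/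

section Tensor

open scoped TensorProduct

lemma liftBaseChange_mul {R A B S : Type*} [CommSemiring R] [CommSemiring A] [Algebra R A]
    [Semiring B] [Algebra R B] [NonUnitalSemiring S] [Module R S] [Module A S]
    [IsScalarTower R A S] [IsScalarTower A S S] [SMulCommClass A S S] {l : B →ₗ[R] S}
    (hl : ∀ b c, l (b * c) = l b * l c) (x y : A ⊗[R] B) :
    l.liftBaseChange A (x * y) = l.liftBaseChange A x * l.liftBaseChange A y := by
  induction x with
  | zero => simp
  | add x₁ x₂ h₁ h₂ => rw [add_mul, map_add, h₁, h₂, map_add, add_mul]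
  | tmul a b =>
    induction y with
    | zero => simp
    | add y₁ y₂ h₁ h₂ => rw [mul_add, map_add, h₁, h₂, map_add, mul_add]
    | tmul c d => simp [hl, smul_mul_smul_comm]

variable {R A B P : CommRingCat.{u}} {f : R ⟶ A} {g : R ⟶ B} {i : A ⟶ P} {j : B ⟶ P}

lemma exists_ringEquiv_tensorProduct (h : IsPushout f g i j) :
    letI := f.hom.toAlgebra
    letI := g.hom.toAlgebra
    ∃ e : A ⊗[R] B ≃+* P, ∀ a b, e (a ⊗ₜ b) = i a * j b := by
  algebraize [f.hom, g.hom, i.hom, j.hom, i.hom.comp f.hom]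
  have : IsScalarTower R B P := .of_algebraMap_eq fun r => ConcreteCategory.congr_hom h.w r
  have : Algebra.IsPushout R A B P := CommRingCat.isPushout_iff_isPushout.mp h
  exact ⟨(Algebra.IsPushout.equiv R A B P).toRingEquiv, Algebra.IsPushout.equiv_tmul R A B P⟩

lemma isPushout_induction (h : IsPushout f g i j) {C : P → Prop} (mul : ∀ a b, C (i a * j b))
    (add : ∀ x y, C x → C y → C (x + y)) (x : P) : C x := by
  algebraize [f.hom, g.hom]
  obtain ⟨e, he⟩ := exists_ringEquiv_tensorProduct h
  obtain ⟨t, rfl⟩ := e.surjective x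
  induction t with
  | zero => simpa using mul 0 0
  | tmul a b => rw [he]; exact mul a b
  | add x y hx hy => rw [map_add]; exact add _ _ hx hy

lemma exists_matrix_baseChange (h : IsPushout f g i j) {n : Type*} [Fintype n]
    (φ : B →ₙ+* Matrix n n R) (hφ : ∀ r b, φ (g r * b) = r • φ b) :
    ∃ ψ : P →ₙ+* Matrix n n A, ∀ a b, ψ (i a * j b) = a • (φ b).map f := by
  algebraize [f.hom, g.hom]
  obtain ⟨e, he⟩ := exists_ringEquiv_tensorProduct h
  let l : B →ₗ[R] Matrix n n A :=
    { toFun := fun b => (φ b).map f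
      map_add' := fun x y => by ext; simp
      map_smul' := fun r x => by
        ext a b
        change f (φ (g r * x) a b) = f r * f (φ x a b)
        rw [hφ, Matrix.smul_apply, smul_eq_mul, map_mul] }
  have hl (b c : B) : l (b * c) = l b * l c := by
    change (φ (b * c)).map f = (φ b).map f * (φ c).map f
    rw [map_mul]
    exact Matrix.map_mul (f := f.hom)
  let ψ : P →ₙ+* Matrix n n A :=
    { toFun := fun x => l.liftBaseChange A (e.symm x)
      map_mul' := fun x y => by rw [map_mul, liftBaseChange_mul hl]
      map_zero' := by simp
      map_add' := fun x y => by simp }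
  refine ⟨ψ, fun a b => ?_⟩
  change l.liftBaseChange A (e.symm (i a * j b)) = _
  rw [← he, e.symm_apply_apply, LinearMap.liftBaseChange_tmul]
  rfl

end Tensor

/-! ### Operations on matrix homomorphisms -/

namespace MatHom

variable {Z Y U : Scheme.{u}} {p : Z ⟶ U} {n m : ℕ}

lemma app_pull_mul (φ : MatHom p n) (W : U.Opens) (a : Γ(U, W)) (f : Γ(Z, p ⁻¹ᵁ W)) :
    φ.app W (pull p le_rfl a * f) = a • φ.app W f := by
  rw [← φ.map_smul, app_eq_pull]

lemma app_res (φ : MatHom p n) {W W' : U.Opens} (h : W' ≤ W) (f : Γ(Z, p ⁻¹ᵁ W)) :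
    φ.app W' (res (p.preimage_mono h) f) = (φ.app W f).map (res h) :=
  φ.naturality h f

lemma ext_app {φ ψ : MatHom p n} (h : ∀ W f, φ.app W f = ψ.app W f) : φ = ψ := by
  ext W f
  rw [h]

/-- The matrix homomorphism with given values on sections. -/
def ofFun (p : Z ⟶ U) (n : ℕ) (F : ∀ W : U.Opens, Γ(Z, p ⁻¹ᵁ W) → Matrix (Fin n) (Fin n) Γ(U, W))
    (add : ∀ W f g, F W (f + g) = F W f + F W g) (mul : ∀ W f g, F W (f * g) = F W f * F W g)
    (smul : ∀ W a f, F W (pull p le_rfl a * f) = a • F W f)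
    (nat : ∀ (W W' : U.Opens) (h : W' ≤ W) (f : Γ(Z, p ⁻¹ᵁ W)),
      F W' (res (p.preimage_mono h) f) = (F W f).map (res h)) : MatHom p n where
  app W :=
    { toFun := F W
      map_mul' := mul W
      map_zero' := by simpa using add W 0 0
      map_add' := add W }
  map_smul W a f := by
    change F W _ = _ • F W _
    rw [app_eq_pull, smul]
  naturality h f := nat _ _ h f

/-- The composite of a matrix homomorphism on `Y` with the pullback of functions along a
`U`-morphism `g : Y ⟶ Z`; it restricts along closed immersions and transports along
isomorphisms. -/
def comap {q : Y ⟶ U} (χ : MatHom q n) (g : Y ⟶ Z) (w : g ≫ p = q) : MatHom p n :=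
  ofFun p n (fun W f => χ.app W (pullSec g w W f)) (fun W f g => by rw [map_add, map_add])
    (fun W f g => by rw [map_mul, map_mul])
    (fun W a f => by
      rw [map_mul, ← app_pull_mul]
      congr 2
      change pull g _ (pull p _ a) = _
      rw [pull_pull, pull_congr w])
    (fun W W' h f => by
      rw [← app_res]
      congr 1
      change pull g _ (res _ f) = res _ (pull g _ f)
      rw [pull_res, res_pull])

lemma comap_app {q : Y ⟶ U} (χ : MatHom q n) (g : Y ⟶ Z) (w : g ≫ p = q) (W : U.Opens)
    (f : Γ(Z, p ⁻¹ᵁ W)) :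
    (χ.comap g w).app W f = χ.app W (pull g (by subst w; exact le_rfl) f) := rfl

lemma comap_id (χ : MatHom p n) : χ.comap (𝟙 Z) (Category.id_comp p) = χ := by
  refine ext_app fun W f => ?_
  rw [comap_app, pull_id, res_self]

lemma comap_comap {X : Scheme.{u}} {q : Y ⟶ U} {r : X ⟶ U} (χ : MatHom r n) (g : Y ⟶ Z)
    (w : g ≫ p = q) (g' : X ⟶ Y) (w' : g' ≫ q = r) :
    (χ.comap g' w').comap g w = χ.comap (g' ≫ g) (by rw [Category.assoc, w, w']) := by
  refine ext_app fun W f => ?_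
  simp only [comap_app, pull_pull]

section Star

variable {V : Scheme.{u}} {q : Y ⟶ Z} {p : Z ⟶ V} (ψ : MatHom q m) (φ : MatHom p n)

/-- The values of `star ψ φ`, for sections of `p_* q_* 𝒪_Y` rather than of `(p q)_* 𝒪_Y`, two
sheaves whose sections agree by definition but not syntactically. -/
def starFun (W : V.Opens) (f : Γ(Y, q ⁻¹ᵁ p ⁻¹ᵁ W)) : Matrix (Fin (m * n)) (Fin (m * n)) Γ(V, W) :=
  blockRect ((ψ.app (p ⁻¹ᵁ W) f).map (φ.app W))

lemma starFun_add (W : V.Opens) (f g : Γ(Y, q ⁻¹ᵁ p ⁻¹ᵁ W)) :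
    starFun ψ φ W (f + g) = starFun ψ φ W f + starFun ψ φ W g := by
  rw [starFun, starFun, starFun, map_add, ← blockRect_add]
  exact congr_arg blockRect (Matrix.map_add _ (map_add _) _ _)

lemma starFun_mul (W : V.Opens) (f g : Γ(Y, q ⁻¹ᵁ p ⁻¹ᵁ W)) :
    starFun ψ φ W (f * g) = starFun ψ φ W f * starFun ψ φ W g := by
  rw [starFun, starFun, starFun, map_mul, blockRect_mul, Matrix.map_mul]

lemma starFun_smul (W : V.Opens) (a : Γ(V, W)) (f : Γ(Y, q ⁻¹ᵁ p ⁻¹ᵁ W)) :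
    starFun ψ φ W (pull q le_rfl (pull p le_rfl a) * f) = a • starFun ψ φ W f := by
  ext i j
  simp [starFun, blockRect, app_pull_mul]

lemma starFun_res {W W' : V.Opens} (h : W' ≤ W) (f : Γ(Y, q ⁻¹ᵁ p ⁻¹ᵁ W)) :
    starFun ψ φ W' (res (q.preimage_mono (p.preimage_mono h)) f) =
      (starFun ψ φ W f).map (res h) := by
  rw [starFun, starFun, blockRect_map, app_res ψ (p.preimage_mono h)]
  refine congr_arg blockRect ?_
  ext i j k l
  exact congr_fun₂ (app_res φ h _) k l

/-- The composite `L ∘ M_m(φ) ∘ ψ : (p q)_* 𝒪_Y → M_m(p_* 𝒪_Z) → M_m(M_n(𝒪_V)) ≅ M_{mn}(𝒪_V)`.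
With `ψ` the base change of `φ₂`, this is the formula defining `φ₂ ∘ φ₁`. -/
def star : MatHom (q ≫ p) (m * n) :=
  ofFun _ _ (starFun ψ φ) (starFun_add ψ φ) (starFun_mul ψ φ)
    (fun W a f => by
      rw [show pull (q ≫ p) le_rfl a = pull q (W := p ⁻¹ᵁ W) le_rfl (pull p le_rfl a) from
        (pull_pull p q le_rfl le_rfl a).symm]
      exact starFun_smul ψ φ W a f)
    (fun W W' h f => starFun_res ψ φ h f)

lemma star_app (W : V.Opens) (f : Γ(Y, (q ≫ p) ⁻¹ᵁ W)) :
    (ψ.star φ).app W f = blockMatrix ((ψ.app (p ⁻¹ᵁ W) f).map (φ.app W)) := rfl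

end Star

/-- Transport of a matrix homomorphism along an equality of ranks. -/
def cast (φ : MatHom p n) (h : n = m) : MatHom p m := h ▸ φ

lemma cast_app (φ : MatHom p n) (h : n = m) (W : U.Opens) (f : Γ(Z, p ⁻¹ᵁ W)) (i j : Fin m) :
    (φ.cast h).app W f i j = φ.app W f (Fin.cast h.symm i) (Fin.cast h.symm j) := by
  subst h
  rfl

end MatHom

/-! ### Base change of matrix homomorphisms -/

section BaseChange

variable {Y T Z U : Scheme.{u}} {q : Y ⟶ T} {p : Z ⟶ U} {a : Y ⟶ Z} {g : T ⟶ U} {n : ℕ}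

lemma preimage_le_of_comm (w : q ≫ g = a ≫ p) {W : U.Opens} {T' : T.Opens} (h : T' ≤ g ⁻¹ᵁ W) :
    q ⁻¹ᵁ T' ≤ a ⁻¹ᵁ (p ⁻¹ᵁ W) := by
  rw [← Scheme.Hom.comp_preimage, ← w, Scheme.Hom.comp_preimage]
  exact Scheme.Hom.preimage_mono _ h

/-- Compatibility of `φ : p_* 𝒪_Z → M_n(𝒪_U)` and `ψ : q_* 𝒪_Y → M_n(𝒪_T)` with pullback of
functions along a commutative square. Over a cartesian square with `p` affine it says that `ψ` is
the base change of `φ`, without reference to affine opens. -/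
def Compat (w : q ≫ g = a ≫ p) (φ : MatHom p n) (ψ : MatHom q n) : Prop :=
  ∀ (W : U.Opens) (T' : T.Opens) (h : T' ≤ g ⁻¹ᵁ W) (b : Γ(Z, p ⁻¹ᵁ W)),
    ψ.app T' (pull a (preimage_le_of_comm w h) b) = (φ.app W b).map (pull g h)

lemma Compat.comp {Y' T' : Scheme.{u}} {q' : Y' ⟶ T'} {a' : Y' ⟶ Y} {g' : T' ⟶ T}
    {w : q ≫ g = a ≫ p} {w' : q' ≫ g' = a' ≫ q} {φ : MatHom p n} {ψ : MatHom q n}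
    {χ : MatHom q' n} (h : Compat w φ ψ) (h' : Compat w' ψ χ) :
    Compat (a := a' ≫ a) (g := g' ≫ g)
      (by rw [reassoc_of% w', w, Category.assoc] : q' ≫ g' ≫ g = (a' ≫ a) ≫ p) φ χ := by
  intro W S hS b
  have := h' (g ⁻¹ᵁ W) S hS (pull a (preimage_le_of_comm w le_rfl) b)
  rw [pull_pull] at this
  rw [this, h W _ le_rfl b]
  ext i j
  exact pull_pull g g' le_rfl hS _

lemma Compat.star {Y₂ Z₂ : Scheme.{u}} {q₂ : Y₂ ⟶ Y} {p₂ : Z₂ ⟶ Z} {a₂ : Y₂ ⟶ Z₂} {m : ℕ}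
    {w : q ≫ g = a ≫ p} {φ : MatHom p n} {ψ : MatHom q n} (h : Compat w φ ψ)
    {w₂ : q₂ ≫ a = a₂ ≫ p₂} {φ₂ : MatHom p₂ m} {ψ₂ : MatHom q₂ m} (h₂ : Compat w₂ φ₂ ψ₂) :
    Compat (by rw [Category.assoc, w, reassoc_of% w₂] : (q₂ ≫ q) ≫ g = a₂ ≫ p₂ ≫ p)
      (φ₂.star φ) (ψ₂.star ψ) := by
  intro W S hS x
  change MatHom.starFun ψ₂ ψ S (pull a₂ (preimage_le_of_comm w₂ (preimage_le_of_comm w hS)) x) =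
    (MatHom.starFun φ₂ φ W x).map _
  simp only [MatHom.starFun]
  rw [blockRect_map, h₂ (p ⁻¹ᵁ W) (q ⁻¹ᵁ S) (preimage_le_of_comm w hS) x]
  refine congr_arg blockRect ?_
  ext i j k l
  simp only [Matrix.map_apply, h W S hS]

/-- A pair of affine opens `S ⊆ T` and `W ⊆ U` with `g(S) ⊆ W`. The base change of a matrix
homomorphism along `g` is constructed over these and then glued. -/
structure AffineChart (g : T ⟶ U) where
  source : T.Opens
  target : U.Opens
  isAffineOpen_source : IsAffineOpen source
  isAffineOpen_target : IsAffineOpen target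
  le : source ≤ g ⁻¹ᵁ target

lemma exists_affineChart (g : T ⟶ U) {S : T.Opens} {W : U.Opens} {t : T} (ht : t ∈ S)
    (htW : g t ∈ W) : ∃ c : AffineChart g, c.source ≤ S ∧ c.target ≤ W ∧ t ∈ c.source := by
  obtain ⟨_, ⟨W', hW', rfl⟩, htW', hWle⟩ :=
    U.isBasis_affineOpens.exists_subset_of_mem_open htW W.isOpen
  obtain ⟨_, ⟨S', hS', rfl⟩, htS, hle⟩ :=
    T.isBasis_affineOpens.exists_subset_of_mem_open
      (show t ∈ ((S ⊓ g ⁻¹ᵁ W' : T.Opens) : Set T) from ⟨ht, htW'⟩) (S ⊓ g ⁻¹ᵁ W').isOpen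
  exact ⟨⟨S', W', hS', hW', fun z hz => (hle hz).2⟩, fun z hz => (hle hz).1, hWle, htS⟩

lemma matrix_eq_of_affineCharts {α β : Type*} {S : T.Opens} {W : U.Opens} (hS : S ≤ g ⁻¹ᵁ W)
    {M N : Matrix α β Γ(T, S)}
    (H : ∀ (c : AffineChart g) (h : c.source ≤ S), c.target ≤ W →
      M.map (res h) = N.map (res h)) : M = N :=
  matrix_eq_of_locally_eq fun _ ht =>
    have ⟨c, hcS, hcW, htc⟩ := exists_affineChart g ht (hS ht)
    ⟨c.source, hcS, htc, H c hcS hcW⟩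

/-- Pullback to `Y` of functions on the part of `Z` over the target of a chart. -/
def AffineChart.pullFst (c : AffineChart g) (w : q ≫ g = a ≫ p) :
    Γ(Z, p ⁻¹ᵁ c.target) →+* Γ(Y, q ⁻¹ᵁ c.source) :=
  pull a (preimage_le_of_comm w c.le)

lemma AffineChart.isPushout (H : IsPullback a q p g) [IsAffineHom p] (c : AffineChart g) :
    IsPushout (g.appLE c.target c.source c.le) (p.appLE c.target (p ⁻¹ᵁ c.target) le_rfl)
      (q.appLE c.source (q ⁻¹ᵁ c.source) le_rfl)
      (a.appLE (p ⁻¹ᵁ c.target) (q ⁻¹ᵁ c.source) (preimage_le_of_comm H.w.symm c.le)) := by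
  have hY : q ⁻¹ᵁ c.source = a ⁻¹ᵁ (p ⁻¹ᵁ c.target) ⊓ q ⁻¹ᵁ c.source :=
    (inf_eq_right.mpr (preimage_le_of_comm H.w.symm c.le)).symm
  have := isIso_pushoutSection_of_isAffineOpen H (US := c.target) (UT := c.source)
    (UX := p ⁻¹ᵁ c.target) c.le le_rfl hY c.isAffineOpen_target c.isAffineOpen_source
    (c.isAffineOpen_target.preimage p)
  exact ((isIso_pushoutSection_iff ..).mp this).flip

lemma AffineChart.induction (H : IsPullback a q p g) [IsAffineHom p] (c : AffineChart g)
    {C : Γ(Y, q ⁻¹ᵁ c.source) → Prop}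
    (mul : ∀ r b, C (pull q le_rfl r * c.pullFst H.w.symm b))
    (add : ∀ x y, C x → C y → C (x + y)) (x : Γ(Y, q ⁻¹ᵁ c.source)) : C x :=
  isPushout_induction (c.isPushout H) mul add x

lemma baseChange_ext {α β : Type*} (H : IsPullback a q p g) [IsAffineHom p]
    (E E' : ∀ S : T.Opens, Γ(Y, q ⁻¹ᵁ S) → Matrix α β Γ(T, S))
    (addE : ∀ S x y, E S (x + y) = E S x + E S y)
    (addE' : ∀ S x y, E' S (x + y) = E' S x + E' S y)
    (smulE : ∀ S c x, E S (pull q le_rfl c * x) = c • E S x)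
    (smulE' : ∀ S c x, E' S (pull q le_rfl c * x) = c • E' S x)
    (natE : ∀ (S S' : T.Opens) (h : S' ≤ S) (x : Γ(Y, q ⁻¹ᵁ S)),
      E S' (res (q.preimage_mono h) x) = (E S x).map (res h))
    (natE' : ∀ (S S' : T.Opens) (h : S' ≤ S) (x : Γ(Y, q ⁻¹ᵁ S)),
      E' S' (res (q.preimage_mono h) x) = (E' S x).map (res h))
    (agree : ∀ (c : AffineChart g) (b : Γ(Z, p ⁻¹ᵁ c.target)),
      E c.source (c.pullFst H.w.symm b) = E' c.source (c.pullFst H.w.symm b))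
    (S : T.Opens) (x : Γ(Y, q ⁻¹ᵁ S)) : E S x = E' S x := by
  refine matrix_eq_of_affineCharts (g := g) (W := ⊤) le_top fun c h _ => ?_
  rw [← natE, ← natE']
  refine c.induction H (C := fun y => E c.source y = E' c.source y) (fun r b => ?_)
    (fun y z hy hz => ?_) (res (q.preimage_mono h) x)
  · rw [smulE, smulE', agree]
  · rw [addE, addE', hy, hz]

section LocalBaseChange

variable (H : IsPullback a q p g) [IsAffineHom p] (φ : MatHom p n)

lemma exists_localBaseChange (c : AffineChart g) :
    ∃ l : Γ(Y, q ⁻¹ᵁ c.source) →ₙ+* Matrix (Fin n) (Fin n) Γ(T, c.source), ∀ r b,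
      l (pull q le_rfl r * c.pullFst H.w.symm b) = r • (φ.app c.target b).map (pull g c.le) :=
  exists_matrix_baseChange (c.isPushout H) (φ.app c.target) fun r b => φ.app_pull_mul c.target r b

/-- The base change `a ⊗ b ↦ a • g^*(φ(b))` of `φ` over a chart. -/
def localBaseChange (c : AffineChart g) :
    Γ(Y, q ⁻¹ᵁ c.source) →ₙ+* Matrix (Fin n) (Fin n) Γ(T, c.source) :=
  (exists_localBaseChange H φ c).choose

lemma localBaseChange_mul_pullFst (c : AffineChart g) (r : Γ(T, c.source))
    (b : Γ(Z, p ⁻¹ᵁ c.target)) :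
    localBaseChange H φ c (pull q le_rfl r * c.pullFst H.w.symm b) =
      r • (φ.app c.target b).map (pull g c.le) :=
  (exists_localBaseChange H φ c).choose_spec r b

lemma localBaseChange_pullFst (c : AffineChart g) (b : Γ(Z, p ⁻¹ᵁ c.target)) :
    localBaseChange H φ c (c.pullFst H.w.symm b) = (φ.app c.target b).map (pull g c.le) := by
  simpa using localBaseChange_mul_pullFst H φ c 1 b

lemma localBaseChange_smul (c : AffineChart g) (r : Γ(T, c.source)) (x : Γ(Y, q ⁻¹ᵁ c.source)) :
    localBaseChange H φ c (pull q le_rfl r * x) = r • localBaseChange H φ c x := by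
  refine c.induction H (C := fun x => localBaseChange H φ c (pull q le_rfl r * x) =
    r • localBaseChange H φ c x) (fun s b => ?_) (fun x y hx hy => ?_) x
  · rw [← mul_assoc, ← map_mul, localBaseChange_mul_pullFst, localBaseChange_mul_pullFst, mul_smul]
  · rw [mul_add, map_add, map_add, hx, hy, smul_add]

lemma localBaseChange_res {c d : AffineChart g} (ht : d.target ≤ c.target)
    (hs : d.source ≤ c.source) (x : Γ(Y, q ⁻¹ᵁ c.source)) :
    localBaseChange H φ d (res (q.preimage_mono hs) x) =
      (localBaseChange H φ c x).map (res hs) := by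
  refine c.induction H (C := fun x => localBaseChange H φ d (res (q.preimage_mono hs) x) =
    (localBaseChange H φ c x).map (res hs)) (fun r b => ?_) (fun x y hx hy => ?_) x
  · have res_pullFst : res (q.preimage_mono hs) (c.pullFst H.w.symm b) =
        d.pullFst H.w.symm (res (p.preimage_mono ht) b) := by
      rw [AffineChart.pullFst, AffineChart.pullFst, res_pull, pull_res]
    rw [localBaseChange_mul_pullFst, map_mul, res_pull, ← pull_res q le_rfl hs, res_pullFst,
      localBaseChange_mul_pullFst, φ.app_res ht]
    ext u v
    simp only [Matrix.smul_apply, Matrix.map_apply, smul_eq_mul, map_mul, pull_res, res_pull]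
  · rw [map_add, map_add, hx, hy, map_add, Matrix.map_add _ (map_add _)]

lemma localBaseChange_agree {S : T.Opens} (x : Γ(Y, q ⁻¹ᵁ S)) {c d : AffineChart g}
    (hc : c.source ≤ S) (hd : d.source ≤ S) :
    (localBaseChange H φ c (res (q.preimage_mono hc) x)).map
        (res (inf_le_left : c.source ⊓ d.source ≤ c.source)) =
      (localBaseChange H φ d (res (q.preimage_mono hd) x)).map
        (res (inf_le_right : c.source ⊓ d.source ≤ d.source)) := by
  refine matrix_eq_of_affineCharts (g := g) (W := c.target ⊓ d.target)
    (le_inf (inf_le_left.trans c.le) (inf_le_right.trans d.le)) fun e hS hW => ?_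
  have restrict_c := localBaseChange_res H φ (hW.trans inf_le_left) (hS.trans inf_le_left)
    (res (q.preimage_mono hc) x)
  have restrict_d := localBaseChange_res H φ (hW.trans inf_le_right) (hS.trans inf_le_right)
    (res (q.preimage_mono hd) x)
  rw [res_res] at restrict_c restrict_d
  ext u v
  simpa only [Matrix.map_apply, res_res] using congr_fun₂ (restrict_c.symm.trans restrict_d) u v

lemma exists_gluedBaseChange (S : T.Opens) (x : Γ(Y, q ⁻¹ᵁ S)) :
    ∃ M : Matrix (Fin n) (Fin n) Γ(T, S), ∀ (c : AffineChart g) (h : c.source ≤ S),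
      M.map (res h) = localBaseChange H φ c (res (q.preimage_mono h) x) := by
  have covers (t : T) (ht : t ∈ S) : ∃ c : {c : AffineChart g // c.source ≤ S}, t ∈ c.1.source :=
    have ⟨c, hcS, _, htc⟩ := exists_affineChart g (W := ⊤) ht trivial
    ⟨⟨c, hcS⟩, htc⟩
  obtain ⟨M, hM⟩ := exists_matrix_gluing (fun c => c.2) covers
    (fun c => localBaseChange H φ c.1 (res (q.preimage_mono c.2) x))
    (fun c d => localBaseChange_agree H φ x c.2 d.2)
  exact ⟨M, fun c h => hM ⟨c, h⟩⟩

/-- The values of `baseChange H φ`, glued from the base changes over the charts. -/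
def baseChangeFun (S : T.Opens) (x : Γ(Y, q ⁻¹ᵁ S)) : Matrix (Fin n) (Fin n) Γ(T, S) :=
  (exists_gluedBaseChange H φ S x).choose

lemma baseChangeFun_map_res {S : T.Opens} (x : Γ(Y, q ⁻¹ᵁ S)) {c : AffineChart g}
    (h : c.source ≤ S) :
    (baseChangeFun H φ S x).map (res h) = localBaseChange H φ c (res (q.preimage_mono h) x) :=
  (exists_gluedBaseChange H φ S x).choose_spec c h

/-- The base change of `φ` along `g`, as a homomorphism of sheaves. -/
def baseChange : MatHom q n :=
  .ofFun q n (baseChangeFun H φ)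
    (fun S x y => matrix_eq_of_affineCharts (g := g) (W := ⊤) le_top fun c h _ => by
      rw [Matrix.map_add _ (map_add _)]
      simp only [baseChangeFun_map_res, map_add])
    (fun S x y => matrix_eq_of_affineCharts (g := g) (W := ⊤) le_top fun c h _ => by
      rw [Matrix.map_mul]
      simp only [baseChangeFun_map_res, map_mul])
    (fun S r x => matrix_eq_of_affineCharts (g := g) (W := ⊤) le_top fun c h _ => by
      rw [baseChangeFun_map_res, map_mul, res_pull, ← pull_res q le_rfl h, localBaseChange_smul,
        ← baseChangeFun_map_res H φ x h]
      ext
      simp)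
    (fun S S' h x => matrix_eq_of_affineCharts (g := g) (W := ⊤) le_top fun c hc _ => by
      rw [baseChangeFun_map_res, res_res, ← baseChangeFun_map_res H φ x (hc.trans h)]
      ext
      simp [res_res])

theorem compat_baseChange : Compat H.w.symm φ (baseChange H φ) := by
  refine fun W S hS b => matrix_eq_of_affineCharts hS fun c h hW => ?_
  have res_pull_eq : res (q.preimage_mono h) (pull a (preimage_le_of_comm H.w.symm hS) b) =
      c.pullFst H.w.symm (res (p.preimage_mono hW) b) := by
    rw [AffineChart.pullFst, res_pull, pull_res]
  change (baseChangeFun H φ S _).map _ = _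
  rw [baseChangeFun_map_res, res_pull_eq, localBaseChange_pullFst, φ.app_res hW]
  ext
  simp only [Matrix.map_apply, res_pull, pull_res]

end LocalBaseChange

theorem eq_of_agree_affineCharts (H : IsPullback a q p g) [IsAffineHom p] {ψ ψ' : MatHom q n}
    (agree : ∀ (c : AffineChart g) (b : Γ(Z, p ⁻¹ᵁ c.target)),
      ψ.app c.source (c.pullFst H.w.symm b) = ψ'.app c.source (c.pullFst H.w.symm b)) : ψ = ψ' :=
  MatHom.ext_app (baseChange_ext H (fun S x => ψ.app S x) (fun S x => ψ'.app S x)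
    (fun _ => map_add _) (fun _ => map_add _) (fun S => ψ.app_pull_mul S)
    (fun S => ψ'.app_pull_mul S) (fun _ _ h => ψ.app_res h) (fun _ _ h => ψ'.app_res h) agree)

theorem Compat.of_affineCharts (H : IsPullback a q p g) [IsAffineHom p] {φ : MatHom p n}
    {ψ : MatHom q n}
    (h : ∀ (c : AffineChart g) (b : Γ(Z, p ⁻¹ᵁ c.target)),
      ψ.app c.source (c.pullFst H.w.symm b) = (φ.app c.target b).map (pull g c.le)) :
    Compat H.w.symm φ ψ := by
  have : ψ = baseChange H φ := eq_of_agree_affineCharts H fun c b =>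
    (h c b).trans (compat_baseChange H φ c.target c.source c.le b).symm
  exact this ▸ compat_baseChange H φ

end BaseChange

/-! ### Universally generalizing morphisms -/

section GoingDown

lemma hasGoingDown_of_surjective {A B T C : Type*} [CommRing A] [CommRing B] [CommRing T]
    [CommRing C] [Algebra A B] [Algebra T C] [Algebra.HasGoingDown A B] (f : A →+* T) (h : B →+* C)
    (hf : Function.Surjective f) (hh : Function.Surjective h)
    (comm : h.comp (algebraMap A B) = (algebraMap T C).comp f)
    (ker : RingHom.ker h ≤ (RingHom.ker f).map (algebraMap A B)) : Algebra.HasGoingDown T C := by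
  constructor
  intro p hp Q hQ hlt
  have e : (Q.comap h).under A = (Q.under T).comap f := by
    rw [Ideal.under, Ideal.under, Ideal.comap_comap, Ideal.comap_comap, comm]
  have : (Q.comap h).LiesOver ((Q.comap h).under A) := ⟨rfl⟩
  have hle : p.comap f ≤ (Q.comap h).under A := by
    rw [e]
    exact Ideal.comap_mono hlt.le
  obtain ⟨P, hPQ, hP, hPp⟩ := Ideal.exists_ideal_le_liesOver_of_le (Q.comap h) hle
  have hker : RingHom.ker h ≤ P := by
    refine ker.trans (Ideal.map_le_iff_le_comap.mpr ?_)
    have : P.comap (algebraMap A B) = p.comap f := hPp.over.symm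
    rw [this]
    exact Ideal.comap_mono bot_le
  have hcm : (P.map h).comap h = P := by
    rw [Ideal.comap_map_of_surjective _ hh, sup_eq_left]
    exact hker
  refine ⟨P.map h, ?_, Ideal.map_isPrime_of_surjective hh hker, ⟨?_⟩⟩
  · exact Ideal.map_le_iff_le_comap.mpr hPQ
  · apply Ideal.comap_injective_of_surjective f hf
    rw [Ideal.under, Ideal.comap_comap, ← comm, ← Ideal.comap_comap, hcm]
    exact hPp.over

/- `R → S` has going down after the base change to `R[T]`, which is integrally closed, hence after
the further base change to its quotient `T`. -/
lemma hasGoingDown_tensorProduct {R S T : Type u} [CommRing R] [CommRing S] [CommRing T]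
    [Algebra R S] [Algebra R T] [IsDomain R] [IsDomain S] [Algebra.IsIntegral R S]
    [FaithfulSMul R S] (hR : IsIntegrallyClosed (MvPolynomial T R)) :
    Algebra.HasGoingDown T (TensorProduct R T S) := by
  have e : TensorProduct R (MvPolynomial T R) S ≃+* MvPolynomial T S :=
    ((Algebra.TensorProduct.comm R (MvPolynomial T R) S).toRingEquiv).trans
      (MvPolynomial.algebraTensorAlgEquiv R S).toRingEquiv
  have : IsDomain (TensorProduct R (MvPolynomial T R) S) := e.toMulEquiv.isDomain _
  have : FaithfulSMul (MvPolynomial T R) (TensorProduct R (MvPolynomial T R) S) := by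
    refine (faithfulSMul_iff_algebraMap_injective (MvPolynomial T R)
      (TensorProduct R (MvPolynomial T R) S)).mpr ?_
    exact Algebra.TensorProduct.includeLeft_injective (S := R)
      (FaithfulSMul.algebraMap_injective R S)
  let f : MvPolynomial T R →ₐ[R] T := MvPolynomial.aeval id
  have hf : Function.Surjective f := fun t => ⟨MvPolynomial.X t, MvPolynomial.aeval_X _ _⟩
  let h : TensorProduct R (MvPolynomial T R) S →ₐ[R] TensorProduct R T S :=
    Algebra.TensorProduct.map f (AlgHom.id R S)
  have hh : Function.Surjective h := TensorProduct.map_surjective hf Function.surjective_id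
  refine hasGoingDown_of_surjective (A := MvPolynomial T R) f.toRingHom h.toRingHom hf hh ?_
    (Algebra.TensorProduct.rTensor_ker f hf).le
  ext x
  · exact Algebra.TensorProduct.map_tmul f (AlgHom.id R S) _ _
  · exact Algebra.TensorProduct.map_tmul f (AlgHom.id R S) _ _

/-- The morphisms all of whose base changes lift generalizations. Finite morphisms of this kind
have base changes whose irreducible components dominate irreducible components of the target. -/
abbrev UniversallyGeneralizing : MorphismProperty Scheme.{u} :=
  (topologically GeneralizingMap).universally

lemma UniversallyGeneralizing.of_flat {X Y : Scheme.{u}} (f : X ⟶ Y) [Flat f] :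
    UniversallyGeneralizing f :=
  MorphismProperty.universally_mk' _ _ fun _ _ => Flat.generalizingMap _

instance : (topologically GeneralizingMap).IsStableUnderComposition where
  comp_mem f g hf hg := GeneralizingMap.comp (f := f) (g := g) hf hg

instance : IsZariskiLocalAtTarget UniversallyGeneralizing.{u} :=
  universally_isZariskiLocalAtTarget _ fun _ _ U hU H =>
    (IsZariskiLocalAtTarget.iff_of_iSup_eq_top (P := topologically GeneralizingMap) U hU).mpr H

instance : IsZariskiLocalAtSource UniversallyGeneralizing.{u} :=
  universally_isZariskiLocalAtSource _

instance : UniversallyGeneralizing.{u}.IsMultiplicative where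
  id_mem _ := UniversallyGeneralizing.of_flat _

lemma UniversallyGeneralizing.coprod_desc {X Y Z : Scheme.{u}} {f : X ⟶ Z} {g : Y ⟶ Z}
    (hf : UniversallyGeneralizing f) (hg : UniversallyGeneralizing g) :
    UniversallyGeneralizing (coprod.desc f g) := by
  refine (IsZariskiLocalAtSource.iff_of_openCover (P := UniversallyGeneralizing)
    (coprodOpenCover.{u, u} X Y)).mpr ?_
  rintro (_ | _)
  · exact (congr_arg _ (coprod.inl_desc f g)).mpr hf
  · exact (congr_arg _ (coprod.inr_desc f g)).mpr hg

lemma UniversallyGeneralizing.of_comp_etale {X Y Z : Scheme.{u}} (f : X ⟶ Y) (g : Y ⟶ Z) [Etale g]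
    (h : UniversallyGeneralizing (f ≫ g)) : UniversallyGeneralizing f := by
  have : MorphismProperty.HasOfPostcompProperty UniversallyGeneralizing.{u} @Etale :=
    MorphismProperty.hasOfPostcompProperty_iff_le_diagonal.mpr fun _ _ g hg => by
      have : Etale g := hg
      exact UniversallyGeneralizing.of_flat (pullback.diagonal g)
  exact MorphismProperty.of_postcomp UniversallyGeneralizing f g ‹_› h

lemma UniversallyGeneralizing.SpecMap {R S : CommRingCat.{u}} (φ : R ⟶ S) [IsDomain R] [IsDomain S]
    (hφ : φ.hom.IsIntegral) (inj : Function.Injective φ)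
    (hR : ∀ T : Type u, IsIntegrallyClosed (MvPolynomial T R)) :
    UniversallyGeneralizing (Spec.map φ) := by
  have affine {T : CommRingCat.{u}} {Y : Scheme.{u}} {a : Y ⟶ Spec S} {b : Y ⟶ Spec T}
      {c : Spec T ⟶ Spec R} (H : IsPullback b a c (Spec.map φ)) :
      topologically GeneralizingMap b := by
    obtain ⟨ψ, rfl⟩ := Spec.map_surjective c
    algebraize [φ.hom, ψ.hom]
    have : FaithfulSMul R S := (faithfulSMul_iff_algebraMap_injective _ _).mpr inj
    have hd := hasGoingDown_tensorProduct (hR T) (S := S)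
    have H' := isPullback_SpecMap_of_isPushout _ _ _ _ (CommRingCat.isPushout_tensorProduct R T S)
    have e := IsPullback.isoIsPullback_hom_fst _ _ H H'
    rw [← e, MorphismProperty.cancel_left_of_respectsIso (topologically GeneralizingMap)]
    exact Algebra.HasGoingDown.iff_generalizingMap_primeSpectrumComap.mp hd
  refine MorphismProperty.universally_mk' _ _ fun {X'} g _ => ?_
  rw [IsZariskiLocalAtTarget.iff_of_openCover (P := topologically GeneralizingMap) X'.affineCover]
  intro i
  exact affine ((IsPullback.of_hasPullback (pullback.fst g (Spec.map φ))
    (X'.affineCover.f i)).flip.paste_vert (IsPullback.of_hasPullback g (Spec.map φ)))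

/- By Zariski's main theorem `h` factors as an open immersion followed by an integral morphism. -/
lemma UniversallyGeneralizing.of_locallyQuasiFinite {X : Scheme.{u}} {R : CommRingCat.{u}}
    (h : X ⟶ Spec R) [IsIntegral X] [LocallyQuasiFinite h] [LocallyOfFiniteType h] [IsAffineHom h]
    [IsDominant h] [IsDomain R]
    (hR : ∀ T : Type u, IsIntegrallyClosed (MvPolynomial T R)) : UniversallyGeneralizing h := by
  rw [← h.toNormalization_fromNormalization]
  refine MorphismProperty.comp_mem _ _ _ (UniversallyGeneralizing.of_flat _) ?_
  have : IsAffine h.normalization := isAffine_of_isAffineHom h.fromNormalization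
  have hd : IsDominant (h.toNormalization ≫ h.fromNormalization) := by
    rw [h.toNormalization_fromNormalization]; infer_instance
  have : IsDominant h.fromNormalization := .of_comp h.toNormalization _
  let e := h.normalization.isoSpec
  rw [← MorphismProperty.cancel_left_of_respectsIso UniversallyGeneralizing e.inv]
  have : IsDominant (e.inv ≫ h.fromNormalization) := inferInstance
  have : IsIntegralHom (e.inv ≫ h.fromNormalization) := inferInstance
  generalize e.inv ≫ h.fromNormalization = f at *
  obtain ⟨φ, rfl⟩ := Spec.map_surjective f
  refine UniversallyGeneralizing.SpecMap φ ?_ ?_ hR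
  · exact (IsIntegralHom.SpecMap_iff).mp ‹_›
  · have h₁ := (PrimeSpectrum.denseRange_comap_iff_ker_le_nilRadical φ.hom).mp
      (Spec.map φ).denseRange
    rw [nilradical_eq_zero, Ideal.zero_eq_bot, le_bot_iff] at h₁
    exact (RingHom.injective_iff_ker_eq_bot φ.hom).mpr h₁

lemma exists_isAffineOpen_etale_mvPolynomial {k : Type u} [Field k] {U : Scheme.{u}}
    (s : U ⟶ Spec (.of k)) [Smooth s] (x : U) :
    ∃ V : U.Opens, IsAffineOpen V ∧ x ∈ V ∧ ∃ (K : Type u) (_ : Field K) (n : ℕ)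
      (g : MvPolynomial (Fin n) K →+* Γ(U, V)), g.Etale := by
  obtain ⟨W, -, V, hV, hx, e, hs⟩ := Smooth.exists_isStandardSmooth s x
  obtain ⟨n, g, -, hg⟩ := hs.exists_etale_mvPolynomial
  have hW : W = ⊤ := by
    ext y
    simpa [Subsingleton.elim y (s x)] using e hx
  have isField : IsField Γ(Spec (.of k), W) := by
    rw [hW]
    exact isField_of_isIntegral_of_subsingleton _
  exact ⟨V, hV, hx, _, isField.toField, n, g, hg⟩

lemma isDominant_comp_of_flat {X Y Z : Scheme.{u}} (f : X ⟶ Y) (c : Y ⟶ Z) [IrreducibleSpace X]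
    [IrreducibleSpace Z] [Flat c]
    (hf : ∀ y, y ⤳ f (genericPoint X) → y = f (genericPoint X)) : IsDominant (f ≫ c) := by
  obtain ⟨y, hy, hcy⟩ := Flat.generalizingMap c
    (genericPoint_specializes (c (f (genericPoint X))))
  have eq_generic : (f ≫ c) (genericPoint X) = genericPoint Z := by
    rw [Scheme.Hom.comp_apply, ← hf y hy, hcy]
  refine ⟨dense_iff_closure_eq.mpr (Set.univ_subset_iff.mp ?_)⟩
  rw [← show closure {genericPoint Z} = Set.univ from genericPoint_spec Z]
  exact closure_mono (Set.singleton_subset_iff.mpr ⟨_, eq_generic⟩)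

lemma eq_morphismRestrict_genericPoint {X Y : Scheme.{u}} {f : X ⟶ Y} [IsIntegral X]
    (hf : ∀ y, y ⤳ f (genericPoint X) → y = f (genericPoint X)) (V : Y.Opens)
    [Nonempty (f ⁻¹ᵁ V).toScheme] (y : V.toScheme)
    (hy : y ⤳ (f ∣_ V) (genericPoint (f ⁻¹ᵁ V).toScheme)) :
    y = (f ∣_ V) (genericPoint (f ⁻¹ᵁ V).toScheme) := by
  have image_generic : V.ι ((f ∣_ V) (genericPoint (f ⁻¹ᵁ V).toScheme)) = f (genericPoint X) := by
    rw [← genericPoint_eq_of_isOpenImmersion (f ⁻¹ᵁ V).ι, ← Scheme.Hom.comp_apply,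
      morphismRestrict_ι, Scheme.Hom.comp_apply]
  apply V.ι.isOpenEmbedding.injective
  rw [image_generic]
  exact hf _ (image_generic ▸ hy.map V.ι.continuous)

lemma UniversallyGeneralizing.of_isFinite_of_etale {K : Type u} [Field K] {n : ℕ}
    {X Y : Scheme.{u}} (f : X ⟶ Y) [IsFinite f] [IsIntegral X]
    (c : Y ⟶ Spec (.of (MvPolynomial (Fin n) K))) [Etale c] [LocallyQuasiFinite c] [IsAffineHom c]
    (hf : ∀ y, y ⤳ f (genericPoint X) → y = f (genericPoint X)) : UniversallyGeneralizing f := by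
  have : IsDominant (f ≫ c) := isDominant_comp_of_flat f c hf
  exact .of_comp_etale f c (.of_locallyQuasiFinite (f ≫ c) fun T => inferInstance)

theorem UniversallyGeneralizing.of_isFinite {k : Type u} [Field k] {X U : Scheme.{u}}
    (s : U ⟶ Spec (.of k)) [Smooth s] (f : X ⟶ U) [IsFinite f] [IsIntegral X]
    (hf : ∀ y, y ⤳ f (genericPoint X) → y = f (genericPoint X)) : UniversallyGeneralizing f := by
  choose V hV hx K hK n g hg using exists_isAffineOpen_etale_mvPolynomial s
  rw [IsZariskiLocalAtTarget.iff_of_iSup_eq_top (P := UniversallyGeneralizing) V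
    (by ext x; simpa using ⟨x, hx x⟩)]
  intro x
  cases isEmpty_or_nonempty (f ⁻¹ᵁ V x).toScheme
  · exact UniversallyGeneralizing.of_flat _
  have : IsAffine (V x).toScheme := hV x
  have : IsIntegral (f ⁻¹ᵁ V x).toScheme := inferInstance
  have : Etale (Spec.map (CommRingCat.ofHom (g x))) :=
    (HasRingHomProperty.Spec_iff (P := @Etale)).mpr (hg x)
  have : LocallyQuasiFinite (Spec.map (CommRingCat.ofHom (g x))) := by
    refine (HasRingHomProperty.Spec_iff (P := @LocallyQuasiFinite)).mpr ?_
    have := hg x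
    algebraize [g x]
    exact inferInstanceAs (Algebra.QuasiFinite _ _)
  exact .of_isFinite_of_etale _ ((hV x).isoSpec.hom ≫ Spec.map (CommRingCat.ofHom (g x)))
    (eq_morphismRestrict_genericPoint hf (V x))

end GoingDown

/-! ### Smooth schemes over a field are reduced -/

section Reduced

lemma isReduced_of_etale {P S : Type u} [CommRing P] [CommRing S] [IsDomain P] [Algebra P S]
    [Algebra.Etale P S] : IsReduced S := by
  let K := FractionRing P
  have h : Function.Injective (Algebra.TensorProduct.includeRight : S →ₐ[P] TensorProduct P K S) :=
    Algebra.TensorProduct.includeRight_injective (IsFractionRing.injective P K)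
  have : IsReduced (TensorProduct P K S) := Algebra.FormallyUnramified.isReduced_of_field K _
  exact isReduced_of_injective _ h

theorem isReduced_of_smooth {k : Type u} [Field k] {U : Scheme.{u}} (s : U ⟶ Spec (.of k))
    [Smooth s] : AlgebraicGeometry.IsReduced U := by
  choose V hV hx K hK n g hg using exists_isAffineOpen_etale_mvPolynomial s
  have isReduced_V (x : U) : AlgebraicGeometry.IsReduced (V x).toScheme := by
    have := hg x
    algebraize [g x]
    have : _root_.IsReduced Γ(U, V x) := isReduced_of_etale (P := MvPolynomial (Fin (n x)) (K x))
    exact isReduced_of_isOpenImmersion (hV x).isoSpec.hom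
  let 𝒰 := U.openCoverOfIsOpenCover V (by rw [IsOpenCover]; ext x; simpa using ⟨x, hx x⟩)
  have : ∀ x, AlgebraicGeometry.IsReduced (𝒰.X x) := isReduced_V
  exact IsReduced.of_openCover U 𝒰

end Reduced

/-! ### Supports as images of finite universally generalizing morphisms -/

section Supports

lemma image_mem_irreducibleComponents {X Y : Type*} [TopologicalSpace X] [TopologicalSpace Y]
    [QuasiSober X] [QuasiSober Y] {f : X → Y} (hf : Continuous f) (isClosedMap : IsClosedMap f)
    (hgen : GeneralizingMap f) {D : Set X} (hD : D ∈ irreducibleComponents X) :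
    f '' D ∈ irreducibleComponents Y := by
  have isClosed_D := isClosed_of_mem_irreducibleComponents D hD
  obtain ⟨x, hx⟩ := QuasiSober.sober hD.1 isClosed_D
  refine ⟨hD.1.image f hf.continuousOn, fun T hT hDT => ?_⟩
  obtain ⟨t, ht⟩ := QuasiSober.sober hT.closure isClosed_closure
  obtain ⟨x', hx', rfl⟩ : ∃ x', x' ⤳ x ∧ f x' = t :=
    hgen (ht.specializes (subset_closure (hDT ⟨x, hx.mem, rfl⟩)))
  have hx'D : x' ∈ D :=
    hD.2 isIrreducible_singleton.closure (hx.def ▸ hx'.closure_subset) (subset_closure rfl)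
  refine subset_closure.trans ?_
  rw [← ht.def, (isClosedMap D isClosed_D).closure_subset_iff, Set.singleton_subset_iff]
  exact ⟨x', hx'D, rfl⟩

lemma range_coprod_desc {X Y S : Scheme.{u}} (f : X ⟶ S) (g : Y ⟶ S) :
    Set.range (coprod.desc f g) = Set.range f ∪ Set.range g := by
  rw [← (coprodMk X Y).surjective.range_comp, ← Set.Sum.elim_range]
  congr 1
  ext (x | x)
  · rw [Function.comp_apply, coprodMk_inl, ← Scheme.Hom.comp_apply, coprod.inl_desc, Sum.elim_inl]
  · rw [Function.comp_apply, coprodMk_inr, ← Scheme.Hom.comp_apply, coprod.inr_desc, Sum.elim_inr]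

lemma isFinite_of_comp_surjective {X Y Z : Scheme.{u}} (f : X ⟶ Y) (g : Y ⟶ Z) [Surjective f]
    [IsFinite (f ≫ g)] [IsSeparated g] [LocallyOfFiniteType g] : IsFinite g := by
  have : UniversallyClosed g := .of_comp_surjective f g
  have : IsProper g := { }
  have : LocallyQuasiFinite g := by
    refine LocallyQuasiFinite.of_finite_preimage_singleton _ fun z => ?_
    refine (((f ≫ g).finite_preimage_singleton z).image f).subset fun y hy => ?_
    obtain ⟨x, rfl⟩ := f.surjective y
    exact ⟨x, by simpa using hy, rfl⟩
  exact .of_isProper_of_locallyQuasiFinite _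

lemma isReduced_subscheme_vanishingIdeal {S : Scheme.{u}} (A : Closeds S) :
    AlgebraicGeometry.IsReduced (IdealSheafData.vanishingIdeal A).subscheme := by
  let I := IdealSheafData.vanishingIdeal A
  have radical_eq : I.radical = I := by
    rw [← IdealSheafData.vanishingIdeal_support]
    rfl
  have hr (W : S.affineOpens) : AlgebraicGeometry.IsReduced (Spec (.of (Γ(S, W) ⧸ I.ideal W))) := by
    have : (I.ideal W).IsRadical := by
      rw [← radical_eq]
      exact Ideal.radical_isRadical _
    have := (Ideal.isRadical_iff_quotient_reduced _).mp this
    infer_instance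
  have : ∀ W, AlgebraicGeometry.IsReduced (I.subschemeCover.openCover.X W) := hr
  exact IsReduced.of_openCover _ I.subschemeCover.openCover

lemma isIntegral_subscheme_vanishingIdeal {S : Scheme.{u}} {A : Closeds S}
    (h : IsIrreducible (A : Set S)) : IsIntegral (IdealSheafData.vanishingIdeal A).subscheme := by
  have := isReduced_subscheme_vanishingIdeal A
  have : IrreducibleSpace (IdealSheafData.vanishingIdeal A).subscheme :=
    isIrreducible_iff_irreducibleSpace.mp h
  exact isIntegral_of_irreducibleSpace_of_isReduced _

lemma range_subschemeι_vanishingIdeal {S : Scheme.{u}} (A : Closeds S) :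
    Set.range (IdealSheafData.vanishingIdeal A).subschemeι = A := by
  rw [IdealSheafData.range_subschemeι, IdealSheafData.coe_support_vanishingIdeal]

variable {k : Type u} [Field k] {U X : Sm k}

attribute [instance] Sm.smooth Sm.separated Sm.locallyOfFiniteType Sm.quasiCompact

instance (W : Sm k) : IsLocallyNoetherian W.scheme :=
  LocallyOfFiniteType.isLocallyNoetherian W.hom

instance (W : Sm k) : CompactSpace W.scheme :=
  QuasiCompact.compactSpace_of_compactSpace W.hom

instance (W W' : Sm k) : IsLocallyNoetherian (prodScheme W W') :=
  LocallyOfFiniteType.isLocallyNoetherian (prodFst W W')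

instance (W W' : Sm k) : CompactSpace (prodScheme W W') :=
  QuasiCompact.compactSpace_of_compactSpace (prodFst W W')

lemma isFinite_src_of_support_subset_range {I : IdealSheafData (prodScheme U X)} {Y : Scheme.{u}}
    (y : Y ⟶ prodScheme U X) [IsFinite (y ≫ prodFst U X)]
    (h : (I.support : Set (prodScheme U X)) ⊆ Set.range y) : IsFinite (src I) := by
  have : Surjective (pullback.snd y I.subschemeι) := by
    constructor
    rw [← Set.range_eq_univ, Scheme.Pullback.range_snd, Set.preimage_eq_univ_iff,
      I.range_subschemeι]
    exact h
  have : IsFinite (pullback.snd y I.subschemeι ≫ src I) := by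
    rw [src, ← pullback.condition_assoc]
    infer_instance
  exact isFinite_of_comp_surjective (pullback.snd y I.subschemeι) (src I)

lemma IsElementary.universallyGeneralizing {B : Closeds (prodScheme U X)} (h : IsElementary B) :
    UniversallyGeneralizing (src (IdealSheafData.vanishingIdeal B)) := by
  have := isIntegral_subscheme_vanishingIdeal h.irreducible
  have := h.finite
  refine UniversallyGeneralizing.of_isFinite U.hom _ fun y hy => ?_
  let f := src (IdealSheafData.vanishingIdeal B)
  let η := genericPoint (IdealSheafData.vanishingIdeal B).subscheme
  have isGenericPoint : closure {f η} = prodFst U X '' (B : Set (prodScheme U X)) := by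
    have hη := (genericPoint_spec (IdealSheafData.vanishingIdeal B).subscheme).image f.continuous
    rw [Set.image_univ, IsGenericPoint, Scheme.Hom.comp_base, TopCat.coe_comp, Set.range_comp,
      range_subschemeι_vanishingIdeal,
      (isClosed_of_mem_irreducibleComponents _ h.surjective).closure_eq] at hη
    exact hη
  have le : closure {y} ⊆ closure {f η} := by
    have hc := h.surjective
    rw [← isGenericPoint] at hc
    exact hc.2 isIrreducible_singleton.closure hy.closure_subset
  exact (Specializes.antisymm hy (specializes_iff_closure_subset.mpr le)).eq

lemma IsSupp.exists_range_eq {A : Closeds (prodScheme U X)} (hA : IsSupp A) :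
    ∃ (Y : Scheme.{u}) (y : Y ⟶ prodScheme U X), IsFinite (y ≫ prodFst U X) ∧
      UniversallyGeneralizing (y ≫ prodFst U X) ∧ Set.range y = A := by
  obtain ⟨S, hS, elementary, hAS⟩ := hA
  rw [hAS]
  clear hAS A
  induction S, hS using Set.Finite.induction_on with
  | empty =>
    refine ⟨⊥_ Scheme, initial.to _, inferInstance, .of_flat _, ?_⟩
    simp [Set.range_eq_empty]
  | @insert B S _ _ ih =>
    obtain ⟨Y, y, finite, hgen, range_eq⟩ :=
      ih fun C hC => elementary C (Set.mem_insert_of_mem _ hC)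
    have hB := elementary B (Set.mem_insert _ _)
    have := hB.finite
    refine ⟨_, coprod.desc (IdealSheafData.vanishingIdeal B).subschemeι y, ?_, ?_, ?_⟩
    · rw [coprod.desc_comp]
      infer_instance
    · rw [coprod.desc_comp]
      exact hB.universallyGeneralizing.coprod_desc hgen
    · rw [range_coprod_desc, Set.biUnion_insert, range_eq, range_subschemeι_vanishingIdeal]

theorem IsSupp.of_range_eq {A : Closeds (prodScheme U X)} {Y : Scheme.{u}}
    (y : Y ⟶ prodScheme U X) [IsFinite (y ≫ prodFst U X)]
    (hgen : UniversallyGeneralizing (y ≫ prodFst U X)) (range_eq : Set.range y = A) :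
    IsSupp A := by
  have : IsFinite y := .of_comp y (prodFst U X)
  have : IsLocallyNoetherian Y := LocallyOfFiniteType.isLocallyNoetherian y
  have : CompactSpace Y := QuasiCompact.compactSpace_of_compactSpace y
  have : IsNoetherian Y := { }
  have : Finite (irreducibleComponents Y) :=
    TopologicalSpace.NoetherianSpace.finite_irreducibleComponents.to_subtype
  let E (D : irreducibleComponents Y) : Closeds (prodScheme U X) :=
    ⟨y '' D, y.isClosedMap _ (isClosed_of_mem_irreducibleComponents _ D.2)⟩
  refine ⟨Set.range E, Set.finite_range E, ?_, ?_⟩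
  · rintro _ ⟨D, rfl⟩
    refine ⟨D.2.1.image _ y.continuous.continuousOn, ?_, ?_⟩
    · refine isFinite_src_of_support_subset_range y ?_
      rw [IdealSheafData.coe_support_vanishingIdeal]
      exact Set.image_subset_range _ _
    · have : prodFst U X '' (E D : Set (prodScheme U X)) = (y ≫ prodFst U X) '' D.1 := by
        rw [Scheme.Hom.comp_base, TopCat.coe_comp, Set.image_comp]
        rfl
      rw [this]
      exact image_mem_irreducibleComponents (y ≫ prodFst U X).continuous
        (y ≫ prodFst U X).isClosedMap (MorphismProperty.universally_le _ _ hgen) D.2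
  · rw [Set.biUnion_range, ← range_eq, ← Set.image_univ, ← sUnion_irreducibleComponents,
      Set.sUnion_eq_iUnion, Set.image_iUnion]
    rfl

lemma IsSubSch.isSupp {I : IdealSheafData (prodScheme U X)} (h : IsSubSch I) :
    IsSupp I.support := by
  obtain ⟨A, hA, m, rfl⟩ := h
  obtain rfl | hm := eq_or_ne m 0
  · exact ⟨∅, Set.finite_empty, by simp, by simp⟩
  · rw [IdealSheafData.support_pow _ _ hm]
    exact hA

lemma IsSubSch.isFinite {I : IdealSheafData (prodScheme U X)} (h : IsSubSch I) :
    IsFinite (src I) := by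
  obtain ⟨Y, y, _, -, range_eq⟩ := h.isSupp.exists_range_eq
  exact isFinite_src_of_support_subset_range y range_eq.ge

end Supports

/-! ### Composition of supports -/

section CompositionOfSupports

variable {k : Type u} [Field k] {V U X : Sm k} {Y₁ Y₂ : Scheme.{u}}

/-- The morphism `Y₁ ×_U Y₂ ⟶ V × X` induced by `Y₁ ⟶ V × U` and `Y₂ ⟶ U × X`. It realizes the
composition of supports: its image depends only on the images of `Y₁` and `Y₂`. -/
def compositeMap (y₁ : Y₁ ⟶ prodScheme V U) (y₂ : Y₂ ⟶ prodScheme U X) :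
    pullback (y₁ ≫ prodSnd V U) (y₂ ≫ prodFst U X) ⟶ prodScheme V X :=
  pullback.map (y₁ ≫ prodSnd V U) (y₂ ≫ prodFst U X) (prodSnd V U) (prodFst U X) y₁ y₂ (𝟙 _)
    (by simp) (by simp) ≫ p₁₃ V U X

@[simp]
lemma compositeMap_fst (y₁ : Y₁ ⟶ prodScheme V U) (y₂ : Y₂ ⟶ prodScheme U X) :
    compositeMap y₁ y₂ ≫ prodFst V X = pullback.fst _ _ ≫ y₁ ≫ prodFst V U := by
  rw [compositeMap, p₁₃, Category.assoc, pullback.lift_fst, pullback.map, pullback.lift_fst_assoc,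
    Category.assoc]

@[simp]
lemma compositeMap_snd (y₁ : Y₁ ⟶ prodScheme V U) (y₂ : Y₂ ⟶ prodScheme U X) :
    compositeMap y₁ y₂ ≫ prodSnd V X = pullback.snd _ _ ≫ y₂ ≫ prodSnd U X := by
  rw [compositeMap, p₁₃, Category.assoc, pullback.lift_snd, pullback.map, pullback.lift_snd_assoc,
    Category.assoc]

lemma range_compositeMap (y₁ : Y₁ ⟶ prodScheme V U) (y₂ : Y₂ ⟶ prodScheme U X)
    {A : Closeds (prodScheme V U)} {B : Closeds (prodScheme U X)} (h₁ : Set.range y₁ = A)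
    (h₂ : Set.range y₂ = B) : Set.range (compositeMap y₁ y₂) = circ B A := by
  rw [compositeMap, Scheme.Hom.comp_base, TopCat.coe_comp, Set.range_comp,
    Scheme.Pullback.range_map, h₁, h₂, Set.inter_comm]
  rfl

lemma isFinite_compositeMap (y₁ : Y₁ ⟶ prodScheme V U) (y₂ : Y₂ ⟶ prodScheme U X)
    [IsFinite (y₁ ≫ prodFst V U)] [IsFinite (y₂ ≫ prodFst U X)] :
    IsFinite (compositeMap y₁ y₂) := by
  have : IsFinite (compositeMap y₁ y₂ ≫ prodFst V X) := by
    rw [compositeMap_fst]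
    infer_instance
  exact IsFinite.of_comp _ (prodFst V X)

theorem IsSupp.exists_circ {B : Closeds (prodScheme U X)} {A : Closeds (prodScheme V U)}
    (hB : IsSupp B) (hA : IsSupp A) :
    ∃ C : Closeds (prodScheme V X), IsSupp C ∧ (C : Set (prodScheme V X)) = circ B A := by
  obtain ⟨Y₁, y₁, _, hgen₁, range₁⟩ := hA.exists_range_eq
  obtain ⟨Y₂, y₂, _, hgen₂, range₂⟩ := hB.exists_range_eq
  have := isFinite_compositeMap y₁ y₂
  have range_eq := range_compositeMap y₁ y₂ range₁ range₂
  refine ⟨⟨circ B A, range_eq ▸ (compositeMap y₁ y₂).isClosedMap.isClosed_range⟩, ?_, rfl⟩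
  have : IsFinite (compositeMap y₁ y₂ ≫ prodFst V X) := by
    rw [compositeMap_fst]
    infer_instance
  refine IsSupp.of_range_eq (compositeMap y₁ y₂) ?_ range_eq
  rw [compositeMap_fst]
  exact MorphismProperty.comp_mem _ _ _
    (MorphismProperty.pullback_fst _ _ hgen₂) hgen₁

lemma exists_pow_le_ker {Y S : Scheme.{u}} [IsLocallyNoetherian S] [CompactSpace S] (c : Y ⟶ S)
    [QuasiCompact c] (C : Closeds S) (h : Set.range c ⊆ C) :
    ∃ m : ℕ, IdealSheafData.vanishingIdeal C ^ m ≤ c.ker := by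
  have hle : IdealSheafData.vanishingIdeal C ≤ c.ker.radical := by
    rw [← IdealSheafData.vanishingIdeal_support]
    refine IdealSheafData.vanishingIdeal_antimono ?_
    rw [← SetLike.coe_subset_coe, Scheme.Hom.support_ker]
    exact closure_minimal h C.isClosed
  have loc : ∀ W : S.affineOpens, ∃ m : ℕ,
      (IdealSheafData.vanishingIdeal C).ideal W ^ m ≤ c.ker.ideal W := by
    intro W
    have : IsNoetherianRing Γ(S, W) := IsLocallyNoetherian.component_noetherian W
    exact Ideal.exists_pow_le_of_le_radical_of_fg (hle W) (IsNoetherian.noetherian _)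
  choose m hm using loc
  obtain ⟨s, hs, hU⟩ := (isCompact_iff_finite_and_eq_biUnion_affineOpens (U := (⊤ : S.Opens))).mp
    isCompact_univ
  refine ⟨hs.toFinset.sup m, IdealSheafData.le_of_iSup_eq_top (fun i : s => i.1) ?_ ?_⟩
  · rw [hU, iSup_subtype']
  · intro W
    exact (Ideal.pow_le_pow_right (Finset.le_sup (hs.mem_toFinset.mpr W.2))).trans (hm W.1)

theorem exists_composite_support {I₁ : IdealSheafData (prodScheme V U)}
    {I₂ : IdealSheafData (prodScheme U X)} (h₁ : IsSubSch I₁) (h₂ : IsSubSch I₂) :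
    ∃ (C : Closeds (prodScheme V X)) (m : ℕ) (π : fib I₁ I₂ ⟶
      (IdealSheafData.vanishingIdeal C ^ m).subscheme), IsSupp C ∧
      (C : Set (prodScheme V X)) = circ I₂.support I₁.support ∧
      π ≫ IdealSheafData.subschemeι _ = compositeMap I₁.subschemeι I₂.subschemeι := by
  obtain ⟨C, hC, e⟩ := h₂.isSupp.exists_circ h₁.isSupp
  have := h₁.isFinite
  have := h₂.isFinite
  have := isFinite_compositeMap I₁.subschemeι I₂.subschemeι
  obtain ⟨m, hm⟩ := exists_pow_le_ker (compositeMap I₁.subschemeι I₂.subschemeι) C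
    (by rw [range_compositeMap _ _ I₁.range_subschemeι I₂.range_subschemeι, e])
  rw [← IdealSheafData.ker_subschemeι (IdealSheafData.vanishingIdeal C ^ m)] at hm
  exact ⟨C, m, IsClosedImmersion.lift _ _ hm, hC, e, IsClosedImmersion.lift_fac _ _ hm⟩

end CompositionOfSupports

/-! ### The diagonal -/

section Diagonal

variable {k : Type u} [Field k] (X : Sm k)

lemma radical_ker {Y S : Scheme.{u}} [AlgebraicGeometry.IsReduced Y] (c : Y ⟶ S) [QuasiCompact c] :
    c.ker.radical = c.ker := by
  refine le_antisymm (fun W x hx => ?_) (IdealSheafData.le_radical _)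
  obtain ⟨n, hn⟩ := hx
  rw [Scheme.Hom.ker_apply, RingHom.mem_ker] at hn ⊢
  rw [map_pow] at hn
  exact IsNilpotent.eq_zero ⟨n, hn⟩

instance : AlgebraicGeometry.IsReduced X.scheme := isReduced_of_smooth X.hom

/-- The diagonal `X ⟶ X × X`. -/
abbrev diag : X.scheme ⟶ prodScheme X X := pullback.diagonal X.hom

lemma isSubSch_ker_diag : IsSubSch (diag X).ker := by
  have range_eq : Set.range (diag X) = ((diag X).ker.support : Set (prodScheme X X)) := by
    rw [Scheme.Hom.support_ker, (diag X).isClosedEmbedding.isClosed_range.closure_eq]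
  have comp_fst : diag X ≫ prodFst X X = 𝟙 _ := pullback.diagonal_fst X.hom
  have : IsFinite (diag X ≫ prodFst X X) := by
    rw [comp_fst]
    infer_instance
  refine ⟨(diag X).ker.support, IsSupp.of_range_eq (diag X) ?_ range_eq, 1, ?_⟩
  · rw [comp_fst]
    exact .of_flat _
  · rw [pow_one, IdealSheafData.vanishingIdeal_support, radical_ker]

end Diagonal

/-! ### Composites of triples -/

section Descend

variable {Y T Z U : Scheme.{u}} {q : Y ⟶ T} {p : Z ⟶ U} {a : Y ⟶ Z} {g : T ⟶ U} {n : ℕ}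

lemma Compat.descend_affineChart (H : IsPullback a q p g) [IsAffineHom p] {φ : MatHom p n}
    {ψ : MatHom q n} (h : Compat H.w.symm φ ψ) {Y' T' : Scheme.{u}} {q' : Y' ⟶ T'} {c : Y' ⟶ Y}
    {d : T' ⟶ T} {χ : MatHom q' n} (w' : q' ≫ d = c ≫ q) {w : q' ≫ d ≫ g = (c ≫ a) ≫ p}
    (h' : Compat w φ χ) (e : AffineChart g) {S : T'.Opens} (hS : S ≤ d ⁻¹ᵁ e.source)
    (y : Γ(Y, q ⁻¹ᵁ e.source)) :
    χ.app S (pull c (preimage_le_of_comm w' hS) y) = (ψ.app e.source y).map (pull d hS) := by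
  refine e.induction H (C := fun y => χ.app S (pull c (preimage_le_of_comm w' hS) y) =
    (ψ.app e.source y).map (pull d hS)) (fun r b => ?_) (fun y z hy hz => ?_) y
  · have pull_r : pull c (preimage_le_of_comm w' hS) (pull q le_rfl r) =
        pull q' (W := S) le_rfl (pull d hS r) := by
      rw [pull_pull, pull_pull, pull_congr w'.symm]
    have χ_b := h' e.target S (hS.trans (d.preimage_mono e.le)) b
    have ψ_b := h e.target e.source e.le b
    rw [← pull_pull a c (preimage_le_of_comm H.w.symm e.le) (preimage_le_of_comm w' hS)] at χ_b
    rw [ψ.app_pull_mul, map_mul, pull_r, χ.app_pull_mul]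
    refine (congr_arg (pull d hS r • ·) χ_b).trans ?_
    rw [AffineChart.pullFst, ψ_b]
    ext i j
    simp only [Matrix.map_apply, Matrix.smul_apply, smul_eq_mul, map_mul, pull_pull]
  · rw [map_add, map_add, map_add, hy, hz, Matrix.map_add _ (map_add _)]

lemma Compat.descend (H : IsPullback a q p g) [IsAffineHom p] {φ : MatHom p n} {ψ : MatHom q n}
    (h : Compat H.w.symm φ ψ) {Y' T' : Scheme.{u}} {q' : Y' ⟶ T'} {c : Y' ⟶ Y} {d : T' ⟶ T}
    {χ : MatHom q' n} (w' : q' ≫ d = c ≫ q) {w : q' ≫ d ≫ g = (c ≫ a) ≫ p}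
    (h' : Compat w φ χ) : Compat w' ψ χ := by
  refine fun S S' hS x => matrix_eq_of_locally_eq fun t ht => ?_
  obtain ⟨e, heS, -, hte⟩ := exists_affineChart g (W := ⊤) (hS ht) trivial
  have hS' : S' ⊓ d ⁻¹ᵁ e.source ≤ d ⁻¹ᵁ e.source := inf_le_right
  refine ⟨S' ⊓ d ⁻¹ᵁ e.source, inf_le_left, ⟨ht, hte⟩, ?_⟩
  rw [← χ.app_res, res_pull, ← pull_res c (preimage_le_of_comm w' hS') (q.preimage_mono heS),
    h.descend_affineChart H w' h' e hS', ψ.app_res heS]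
  ext i j
  simp only [Matrix.map_apply, res_pull, pull_res]

lemma Compat.comap_left {w : q ≫ g = a ≫ p} {φ : MatHom p n} {ψ : MatHom q n} (h : Compat w φ ψ)
    {X : Scheme.{u}} {r : X ⟶ U} (c : Z ⟶ X) (hc : c ≫ r = p) :
    Compat (by rw [Category.assoc, hc, w] : q ≫ g = (a ≫ c) ≫ r) (φ.comap c hc) ψ := by
  intro W S hS x
  rw [MatHom.comap_app, ← h W S hS, pull_pull]

lemma MatHom.star_comap {T' V Y' : Scheme.{u}} {q' : Y' ⟶ T'} {c : Y' ⟶ Y} {d : T' ⟶ T}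
    {w : q' ≫ d = c ≫ q} {ψ : MatHom q n} {χ : MatHom q' n} (h : Compat w ψ χ) {m : ℕ}
    {p : T ⟶ V} {p' : T' ⟶ V} (φ : MatHom p' m) (hp : d ≫ p = p') :
    ψ.star (φ.comap d hp) = (χ.star φ).comap c (by rw [← hp, reassoc_of% w]) := by
  refine ext_app fun W f => ?_
  subst hp
  have e := h (p ⁻¹ᵁ W) (d ⁻¹ᵁ p ⁻¹ᵁ W) le_rfl f
  change blockRect ((ψ.app (p ⁻¹ᵁ W) f).map fun x => φ.app W (pull d le_rfl x)) =
    blockRect ((χ.app (d ⁻¹ᵁ p ⁻¹ᵁ W) (pull c (preimage_le_of_comm w le_rfl) f)).map (φ.app W))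
  rw [e]
  rfl

end Descend

section Composites

variable {k : Type u} [Field k] {W V U X : Sm k}

lemma inclusion_src {I J : IdealSheafData (prodScheme U X)} (h : J ≤ I) :
    IdealSheafData.inclusion h ≫ src J = src I := by
  simp [src]

lemma inclusion_tgt {I J : IdealSheafData (prodScheme U X)} (h : J ≤ I) :
    IdealSheafData.inclusion h ≫ tgt J = tgt I := by
  simp [tgt]

lemma Triple.mk_eq_mk {Y : Scheme.{u}} {n : ℕ} {p : Y ⟶ U.scheme} (χ : MatHom p n)
    {t t' : Triple U X n} (g : Y ⟶ t.ideal.subscheme) (g' : Y ⟶ t'.ideal.subscheme)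
    (w : g ≫ src t.ideal = p) (w' : g' ≫ src t'.ideal = p)
    (e : g ≫ tgt t.ideal = g' ≫ tgt t'.ideal) (h : t.hom = χ.comap g w)
    (h' : t'.hom = χ.comap g' w') :
    (Quotient.mk _ t : Quotient (Triple.setoid U X n)) = Quotient.mk _ t' := by
  obtain ⟨J, hJ, hJt, hJt'⟩ := t.isSubSch.exists_le t'.isSubSch
  refine Quotient.sound ⟨J, hJ, hJt, hJt', fun O f => ?_⟩
  have hg : g ≫ IdealSheafData.inclusion hJt = g' ≫ IdealSheafData.inclusion hJt' := by
    rw [← cancel_mono J.subschemeι, Category.assoc, Category.assoc,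
      IdealSheafData.inclusion_subschemeι, IdealSheafData.inclusion_subschemeι]
    refine pullback.hom_ext ?_ ?_
    · simpa using w.trans w'.symm
    · simpa using e
  rw [h, h', MatHom.comap_app, MatHom.comap_app]
  congr 1
  change pull g _ (pull _ _ f) = pull g' _ (pull _ _ f)
  rw [pull_pull, pull_pull, pull_congr hg]

/-- The object `Φ` is the class of the composite of `𝒪_Z → p_* 𝒪_Y` with `χ`, for some `Z` through
which `(p, q) : Y ⟶ U × X` factors. As `Y` need not be a closed subscheme of `U × X`, composites can
be computed on fibre products. -/
def IsRepresentedBy (Φ : Corr U X) {Y : Scheme.{u}} {n : ℕ} (p : Y ⟶ U.scheme) (q : Y ⟶ X.scheme)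
    (χ : MatHom p n) : Prop :=
  ∃ (t : Triple U X n) (g : Y ⟶ t.ideal.subscheme) (w : g ≫ src t.ideal = p),
    g ≫ tgt t.ideal = q ∧ t.hom = χ.comap g w ∧ Φ = t.toCorr

lemma IsRepresentedBy.unique {Φ Ψ : Corr U X} {Y : Scheme.{u}} {n : ℕ} {p : Y ⟶ U.scheme}
    {q : Y ⟶ X.scheme} {χ : MatHom p n} (h : IsRepresentedBy Φ p q χ)
    (h' : IsRepresentedBy Ψ p q χ) : Φ = Ψ := by
  obtain ⟨t, g, w, e, ht, rfl⟩ := h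
  obtain ⟨t', g', w', e', ht', rfl⟩ := h'
  exact congr_arg (Corr.mk n) (Triple.mk_eq_mk χ g g' w w' (e.trans e'.symm) ht ht')

lemma Triple.isRepresentedBy {n : ℕ} (t : Triple U X n) :
    IsRepresentedBy t.toCorr (src t.ideal) (tgt t.ideal) t.hom :=
  ⟨t, 𝟙 _, Category.id_comp _, Category.id_comp _, t.hom.comap_id.symm, rfl⟩

lemma IsRepresentedBy.of_comap {Φ : Corr U X} {Y Z : Scheme.{u}} {n : ℕ} {p : Y ⟶ U.scheme}
    {q : Y ⟶ X.scheme} {p' : Z ⟶ U.scheme} {q' : Z ⟶ X.scheme} {χ : MatHom p n} (c : Y ⟶ Z)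
    (w : c ≫ p' = p) (e : c ≫ q' = q) (h : IsRepresentedBy Φ p' q' (χ.comap c w)) :
    IsRepresentedBy Φ p q χ := by
  obtain ⟨t, g, w', e', ht, rfl⟩ := h
  refine ⟨t, c ≫ g, by rw [Category.assoc, w', w], by rw [Category.assoc, e', e], ?_, rfl⟩
  rw [ht, MatHom.comap_comap]

lemma isBaseChange_iff {I₁ : IdealSheafData (prodScheme V U)} {n₂ : ℕ} {t₂ : Triple U X n₂}
    {ψ : MatHom (fibFst I₁ t₂.ideal) n₂} :
    IsBaseChange I₁ t₂ ψ ↔ Compat pullback.condition t₂.hom ψ := by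
  have := t₂.isSubSch.isFinite
  constructor
  · refine fun h => Compat.of_affineCharts
      (IsPullback.of_hasPullback (tgt I₁) (src t₂.ideal)).flip fun c b => ?_
    have := h c.target c.source c.isAffineOpen_target c.isAffineOpen_source c.le 1 b
    rwa [map_one, one_mul, one_smul] at this
  · intro h U' Z' _ _ hle a b
    rw [app_eq_pull]
    exact (ψ.app_pull_mul Z' a _).trans (congr_arg (a • ·) (h U' Z' hle b))

lemma IsComposite.exists_compat {n₁ n₂ : ℕ} {t₁ : Triple V U n₁} {t₂ : Triple U X n₂}
    {t₃ : Triple V X (n₂ * n₁)} (h : IsComposite t₁ t₂ t₃) :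
    ∃ ψ : MatHom (fibFst t₁.ideal t₂.ideal) n₂, Compat pullback.condition t₂.hom ψ ∧
      ∃ (π : fib t₁.ideal t₂.ideal ⟶ t₃.ideal.subscheme)
        (w : π ≫ src t₃.ideal = fibFst t₁.ideal t₂.ideal ≫ src t₁.ideal),
        π ≫ tgt t₃.ideal = fibSnd t₁.ideal t₂.ideal ≫ tgt t₂.ideal ∧
        t₃.hom = (ψ.star t₁.hom).comap π w := by
  obtain ⟨-, π, w, e, ψ, hψ, H⟩ := h
  exact ⟨ψ, isBaseChange_iff.mp hψ, π, w, e, MatHom.ext_app H⟩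

theorem exists_isComposite {n₁ n₂ : ℕ} (t₁ : Triple V U n₁) (t₂ : Triple U X n₂) :
    ∃ t₃ : Triple V X (n₂ * n₁), IsComposite t₁ t₂ t₃ := by
  have := t₂.isSubSch.isFinite
  obtain ⟨C, m, π, hC, e, hπ⟩ := exists_composite_support t₁.isSubSch t₂.isSubSch
  let H := (IsPullback.of_hasPullback (tgt t₁.ideal) (src t₂.ideal)).flip
  have w : π ≫ src (IdealSheafData.vanishingIdeal C ^ m) =
      fibFst t₁.ideal t₂.ideal ≫ src t₁.ideal := by
    rw [← compositeMap_fst, ← hπ, Category.assoc]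
  have w' : π ≫ tgt (IdealSheafData.vanishingIdeal C ^ m) =
      fibSnd t₁.ideal t₂.ideal ≫ tgt t₂.ideal := by
    rw [← compositeMap_snd, ← hπ, Category.assoc]
  exact ⟨⟨_, ⟨C, hC, m, rfl⟩, ((baseChange H t₂.hom).star t₁.hom).comap π w⟩, ⟨C, m, e, rfl⟩,
    π, w, w', _, isBaseChange_iff.mpr (compat_baseChange H t₂.hom),
    fun _ _ => rfl⟩

theorem IsComposite.isRepresentedBy {n₁ n₂ : ℕ} {t₁ : Triple V U n₁} {t₂ : Triple U X n₂}
    {t₃ : Triple V X (n₂ * n₁)} (h : IsComposite t₁ t₂ t₃) {Y Y₁ Y₂ : Scheme.{u}}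
    {p₁ : Y₁ ⟶ V.scheme} {r₁ : Y₁ ⟶ U.scheme} {χ₁ : MatHom p₁ n₁} (g₁ : Y₁ ⟶ t₁.ideal.subscheme)
    (w₁ : g₁ ≫ src t₁.ideal = p₁) (e₁ : g₁ ≫ tgt t₁.ideal = r₁) (h₁ : t₁.hom = χ₁.comap g₁ w₁)
    {p₂ : Y₂ ⟶ U.scheme} {r₂ : Y₂ ⟶ X.scheme} {χ₂ : MatHom p₂ n₂} (g₂ : Y₂ ⟶ t₂.ideal.subscheme)
    (w₂ : g₂ ≫ src t₂.ideal = p₂) (e₂ : g₂ ≫ tgt t₂.ideal = r₂) (h₂ : t₂.hom = χ₂.comap g₂ w₂)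
    {q : Y ⟶ Y₁} {a : Y ⟶ Y₂} {w : q ≫ r₁ = a ≫ p₂} {ψ : MatHom q n₂} (hψ : Compat w χ₂ ψ) :
    IsRepresentedBy t₃.toCorr (q ≫ p₁) (a ≫ r₂) (ψ.star χ₁) := by
  have := t₂.isSubSch.isFinite
  obtain ⟨ψ₀, hψ₀, π, wπ, eπ, h₃⟩ := h.exists_compat
  let c : Y ⟶ fib t₁.ideal t₂.ideal := pullback.lift (q ≫ g₁) (a ≫ g₂)
    (by rw [Category.assoc, Category.assoc, e₁, w₂, w])
  have hc₁ : q ≫ g₁ = c ≫ fibFst t₁.ideal t₂.ideal := (pullback.lift_fst _ _ _).symm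
  have hc₂ : c ≫ fibSnd t₁.ideal t₂.ideal = a ≫ g₂ := pullback.lift_snd _ _ _
  have ψ_of_ψ₀ : Compat hc₁ ψ₀ ψ := by
    refine hψ₀.descend (IsPullback.of_hasPullback (tgt t₁.ideal) (src t₂.ideal)).flip hc₁
      (w := by rw [hc₂, e₁, Category.assoc, w₂, w]) ?_
    have := hψ.comap_left g₂ w₂
    rw [← h₂] at this
    subst e₁
    convert this
  have e := MatHom.star_comap ψ_of_ψ₀ χ₁ w₁
  rw [← h₁] at e
  refine ⟨t₃, c ≫ π, ?_, ?_, ?_, rfl⟩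
  · rw [Category.assoc, wπ, ← reassoc_of% hc₁, w₁]
  · rw [Category.assoc, eπ, reassoc_of% hc₂, e₂]
  · rw [h₃, e, MatHom.comap_comap]

lemma IsComposite.isRepresentedBy_self {n₁ n₂ : ℕ} {t₁ : Triple V U n₁} {t₂ : Triple U X n₂}
    {t₃ : Triple V X (n₂ * n₁)} (h : IsComposite t₁ t₂ t₃)
    {ψ : MatHom (fibFst t₁.ideal t₂.ideal) n₂} (hψ : Compat pullback.condition t₂.hom ψ) :
    IsRepresentedBy t₃.toCorr (fibFst t₁.ideal t₂.ideal ≫ src t₁.ideal)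
      (fibSnd t₁.ideal t₂.ideal ≫ tgt t₂.ideal) (ψ.star t₁.hom) :=
  h.isRepresentedBy (𝟙 _) (Category.id_comp _) (Category.id_comp _) t₁.hom.comap_id.symm (𝟙 _)
    (Category.id_comp _) (Category.id_comp _) t₂.hom.comap_id.symm hψ

theorem IsComposite.toCorr_eq {n₁ n₂ : ℕ} {t₁ s₁ : Triple V U n₁} {t₂ s₂ : Triple U X n₂}
    {t₃ s₃ : Triple V X (n₂ * n₁)} (h : IsComposite t₁ t₂ t₃) (h' : IsComposite s₁ s₂ s₃)
    (h₁ : t₁ ≈ s₁) (h₂ : t₂ ≈ s₂) : t₃.toCorr = s₃.toCorr := by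
  obtain ⟨J₁, hJ₁, i₁, j₁, e₁⟩ := h₁
  obtain ⟨J₂, hJ₂, i₂, j₂, e₂⟩ := h₂
  have E₁ : t₁.hom.comap _ (inclusion_src i₁) = s₁.hom.comap _ (inclusion_src j₁) :=
    MatHom.ext_app e₁
  have E₂ : t₂.hom.comap _ (inclusion_src i₂) = s₂.hom.comap _ (inclusion_src j₂) :=
    MatHom.ext_app e₂
  obtain ⟨u, hu⟩ := exists_isComposite ⟨J₁, hJ₁, t₁.hom.comap _ (inclusion_src i₁)⟩
    ⟨J₂, hJ₂, t₂.hom.comap _ (inclusion_src i₂)⟩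
  obtain ⟨ψ, hψ, -⟩ := h.exists_compat
  obtain ⟨ψ', hψ', -⟩ := h'.exists_compat
  have t_class := hu.isRepresentedBy (χ₁ := t₁.hom) _ (inclusion_src i₁) (inclusion_tgt i₁) rfl
    (χ₂ := t₂.hom) _ (inclusion_src i₂) (inclusion_tgt i₂) rfl hψ
  have s_class := hu.isRepresentedBy (χ₁ := s₁.hom) _ (inclusion_src j₁) (inclusion_tgt j₁) E₁
    (χ₂ := s₂.hom) _ (inclusion_src j₂) (inclusion_tgt j₂) E₂ hψ'
  exact ((h.isRepresentedBy_self hψ).unique t_class).trans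
    ((h'.isRepresentedBy_self hψ').unique s_class).symm

end Composites

/-! ### Morphisms as matrices -/

/-- The restriction of a matrix of global functions. -/
abbrev resMatrix {U : Scheme.{u}} {α β : Type*} (M : Matrix α β Γ(U, ⊤)) (W : U.Opens) :
    Matrix α β Γ(U, W) :=
  M.map (res le_top)

lemma resMatrix_top {U : Scheme.{u}} {α β : Type*} (M : Matrix α β Γ(U, ⊤)) :
    resMatrix M ⊤ = M := by
  ext i j
  exact res_self _ _

lemma resMatrix_map_res {U : Scheme.{u}} {α β : Type*} (M : Matrix α β Γ(U, ⊤)) {W W' : U.Opens}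
    (h : W' ≤ W) : (resMatrix M W).map (res h) = resMatrix M W' := by
  ext i j
  exact res_res _ h _

namespace Corr

variable {k : Type u} [Field k] {U X : Sm k}

@[simp]
lemma coe_proj (Φ : Corr U X) (W : U.scheme.Opens) (v : Fin Φ.n → Γ(U.scheme, W)) :
    (Φ.proj W v : Fin Φ.n → Γ(U.scheme, W)) = (Φ.idem W).mulVec v := rfl

lemma idem_eq {Φ : Corr U X} {t : Triple U X Φ.n} (h : Quotient.mk _ t = Φ.cls)
    (W : U.scheme.Opens) : Φ.idem W = t.hom.app W 1 := by
  rw [idem, ← h]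
  rfl

lemma idem_res (Φ : Corr U X) {W W' : U.scheme.Opens} (h : W' ≤ W) :
    (Φ.idem W).map (res h) = Φ.idem W' := by
  obtain ⟨t, ht⟩ := Quotient.exists_rep Φ.cls
  rw [idem_eq ht, idem_eq ht, ← t.hom.app_res, map_one]

lemma idem_mul_idem (Φ : Corr U X) (W : U.scheme.Opens) : Φ.idem W * Φ.idem W = Φ.idem W := by
  obtain ⟨t, ht⟩ := Quotient.exists_rep Φ.cls
  rw [idem_eq ht, ← map_mul, one_mul]

lemma mem_P {Φ : Corr U X} {W : U.scheme.Opens} {x : Fin Φ.n → Γ(U.scheme, W)} :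
    x ∈ Φ.P W ↔ (Φ.idem W).mulVec x = x := by
  constructor
  · rintro ⟨y, rfl⟩
    rw [Matrix.mulVecLin_apply, Matrix.mulVec_mulVec, idem_mul_idem]
  · exact fun h => ⟨x, h⟩

/-- The action `φ ∘ p_X^*` of the global functions on `X`, through which the matrix of a morphism of
`𝒜(U, X)` is composed with matrices of functions on `X`. -/
def act (Φ : Corr U X) : Γ(X.scheme, ⊤) →ₙ+* Matrix (Fin Φ.n) (Fin Φ.n) Γ(U.scheme, ⊤) :=
  Quotient.lift (fun t : Triple U X Φ.n =>
      (t.hom.app ⊤).comp (rPull t.ideal ⊤ : _ →ₙ+* Γ(t.ideal.subscheme, src t.ideal ⁻¹ᵁ ⊤)))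
    (by
      rintro t t' ⟨J, _, h, h', e⟩
      have can_rPull {I : IdealSheafData (prodScheme U X)} (h : J ≤ I) (c : Γ(X.scheme, ⊤)) :
          can h ⊤ (rPull J ⊤ c) = rPull I ⊤ c :=
        (pull_pull (tgt J) (IdealSheafData.inclusion h) _ _ c).trans
          (pull_congr (inclusion_tgt h) _ c)
      ext1 c
      have e_c := e ⊤ (rPull J ⊤ c)
      rwa [can_rPull, can_rPull] at e_c) Φ.cls

lemma act_eq {Φ : Corr U X} {t : Triple U X Φ.n} (h : Quotient.mk _ t = Φ.cls)
    (c : Γ(X.scheme, ⊤)) : Φ.act c = t.hom.app ⊤ (rPull t.ideal ⊤ c) := by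
  rw [act, ← h]
  rfl

lemma act_one (Φ : Corr U X) : Φ.act 1 = Φ.idem ⊤ := by
  obtain ⟨t, ht⟩ := Quotient.exists_rep Φ.cls
  rw [act_eq ht, idem_eq ht, map_one]

lemma act_mul_idem (Φ : Corr U X) (c : Γ(X.scheme, ⊤)) : Φ.act c * Φ.idem ⊤ = Φ.act c := by
  rw [← act_one, ← map_mul, mul_one]

lemma eq_sum_smul_proj {Φ : Corr U X} {W : U.scheme.Opens} (x : Φ.P W) :
    x = ∑ j, (x : Fin Φ.n → Γ(U.scheme, W)) j • Φ.proj W (Pi.single j 1) := by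
  ext i
  conv_lhs => rw [← mem_P.mp x.2]
  simp [Matrix.mulVec, dotProduct, mul_comm, Finset.sum_apply]

lemma Hom.app_proj_single {Φ Ψ : Corr U X} (α : Φ ⟶ Ψ) (W : U.scheme.Opens) (j : Fin Φ.n) :
    (Hom.app α W (Φ.proj W (Pi.single j 1)) : Fin Ψ.n → Γ(U.scheme, W)) =
      fun i => res le_top (Hom.matrix α i j) := by
  refine α.2.1 ⊤ W le_top (Φ.proj ⊤ (Pi.single j 1)) (Φ.proj W (Pi.single j 1)) ?_
  ext i
  simp only [coe_proj, Matrix.mulVec_single_one]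
  rw [← idem_res Φ le_top]
  rfl

lemma Hom.app_eq {Φ Ψ : Corr U X} (α : Φ ⟶ Ψ) (W : U.scheme.Opens) (x : Φ.P W) :
    (Hom.app α W x : Fin Ψ.n → Γ(U.scheme, W)) = (resMatrix (Hom.matrix α) W).mulVec x := by
  conv_lhs => rw [eq_sum_smul_proj x, map_sum]
  ext i
  simp only [map_smul, Submodule.coe_sum, Submodule.coe_smul, Finset.sum_apply, Pi.smul_apply,
    app_proj_single, smul_eq_mul, Matrix.mulVec, dotProduct, Matrix.map_apply, mul_comm]

lemma Hom.ext_app {Φ Ψ : Corr U X} {α β : Φ ⟶ Ψ}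
    (h : ∀ W x, Hom.app α W x = Hom.app β W x) : α = β :=
  Subtype.ext (funext fun W => LinearMap.ext (h W))

lemma Hom.matrix_injective {Φ Ψ : Corr U X} {α β : Φ ⟶ Ψ} (h : Hom.matrix α = Hom.matrix β) :
    α = β := by
  refine Hom.ext_app fun W x => Subtype.ext ?_
  rw [app_eq, app_eq, h]

lemma Hom.idem_mul_matrix {Φ Ψ : Corr U X} (α : Φ ⟶ Ψ) :
    Ψ.idem ⊤ * Hom.matrix α = Hom.matrix α := by
  ext i j
  exact congr_fun (mem_P.mp (Hom.app α ⊤ (Φ.proj ⊤ (Pi.single j 1))).2) i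

lemma Hom.matrix_eq_mul_idem {Φ Ψ : Corr U X} {α : Φ ⟶ Ψ}
    {M : Matrix (Fin Ψ.n) (Fin Φ.n) Γ(U.scheme, ⊤)}
    (h : ∀ x : Φ.P ⊤, (Hom.app α ⊤ x : Fin Ψ.n → Γ(U.scheme, ⊤)) = M.mulVec x) :
    Hom.matrix α = M * Φ.idem ⊤ := by
  ext i j
  change (Hom.app α ⊤ (Φ.proj ⊤ (Pi.single j 1)) : Fin Ψ.n → Γ(U.scheme, ⊤)) i = _
  rw [h]
  simp only [coe_proj, Matrix.mulVec_single_one]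
  rfl

lemma Hom.matrix_mul_idem {Φ Ψ : Corr U X} (α : Φ ⟶ Ψ) :
    Hom.matrix α * Φ.idem ⊤ = Hom.matrix α :=
  (matrix_eq_mul_idem fun x => by rw [app_eq, resMatrix_top]).symm

lemma Hom.matrix_id (Φ : Corr U X) : Hom.matrix (𝟙 Φ) = Φ.idem ⊤ := by
  rw [matrix_eq_mul_idem (α := 𝟙 Φ) (M := 1), one_mul]
  intro x
  rw [Matrix.one_mulVec]
  rfl

lemma Hom.matrix_comp {Φ Ψ Θ : Corr U X} (α : Φ ⟶ Ψ) (β : Ψ ⟶ Θ) :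
    Hom.matrix (α ≫ β) = Hom.matrix β * Hom.matrix α := by
  rw [matrix_eq_mul_idem (α := α ≫ β) (M := Hom.matrix β * Hom.matrix α), Matrix.mul_assoc,
    matrix_mul_idem]
  intro x
  change (Hom.app β ⊤ (Hom.app α ⊤ x) : Fin Θ.n → Γ(U.scheme, ⊤)) = _
  rw [app_eq, app_eq, resMatrix_top, resMatrix_top, Matrix.mulVec_mulVec]

lemma Hom.matrix_add {Φ Ψ : Corr U X} (α β : Φ ⟶ Ψ) :
    Hom.matrix (α + β) = Hom.matrix α + Hom.matrix β := rfl

lemma Hom.matrix_zero (Φ Ψ : Corr U X) : Hom.matrix (0 : Φ ⟶ Ψ) = 0 := rfl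

end Corr

section Intertwines

variable {Y Z U : Scheme.{u}} {p : Y ⟶ U} {q : Z ⟶ U} {n n' : ℕ} {χ : MatHom p n}
  {χ' : MatHom p n'} {M : Matrix (Fin n') (Fin n) Γ(U, ⊤)}

/-- Multiplication by `M` is linear over the functions on `Y`, which act on vectors by `χ` and
`χ'`. -/
def Intertwines (χ : MatHom p n) (χ' : MatHom p n') (M : Matrix (Fin n') (Fin n) Γ(U, ⊤)) : Prop :=
  ∀ (W : U.Opens) (f : Γ(Y, p ⁻¹ᵁ W)), resMatrix M W * χ.app W f = χ'.app W f * resMatrix M W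

lemma Intertwines.comap (h : Intertwines χ χ' M) (g : Y ⟶ Z) (w : g ≫ q = p) :
    Intertwines (χ.comap g w) (χ'.comap g w) M :=
  fun W _ => h W _

lemma pull_surjective_of_isClosedImmersion (g : Y ⟶ Z) [IsClosedImmersion g] {V : Z.Opens}
    (hV : IsAffineOpen V) {V' : Y.Opens} (h : V' = g ⁻¹ᵁ V) :
    Function.Surjective (pull g h.le) := by
  subst h
  intro f
  obtain ⟨f', hf'⟩ := g.app_surjective V hV f
  exact ⟨f', (app_eq_pull _ _ f').symm.trans hf'⟩

lemma Intertwines.of_comap_isClosedImmersion {g : Y ⟶ Z} [IsClosedImmersion g] [IsAffineHom q]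
    {w : g ≫ q = p} (h : Intertwines (χ.comap g w) (χ'.comap g w) M) : Intertwines χ χ' M := by
  refine fun W f => matrix_eq_of_locally_eq fun x hx => ?_
  obtain ⟨_, ⟨W', hW, rfl⟩, hxW, hle⟩ :=
    U.isBasis_affineOpens.exists_subset_of_mem_open hx W.isOpen
  replace hle : W' ≤ W := hle
  obtain ⟨f', hf'⟩ := pull_surjective_of_isClosedImmersion g (hW.preimage q)
    (by rw [← Scheme.Hom.comp_preimage, w]) (res (p.preimage_mono hle) f)
  refine ⟨W', hle, hxW, ?_⟩
  rw [Matrix.map_mul, Matrix.map_mul, ← χ.app_res hle, ← χ'.app_res hle, resMatrix_map_res, ← hf']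
  exact h W' f'

end Intertwines

section Hom

variable {k : Type u} [Field k] {U X : Sm k}

instance isClosedImmersion_inclusion {Y : Scheme.{u}} {I J : IdealSheafData Y} (h : J ≤ I) :
    IsClosedImmersion (IdealSheafData.inclusion h) :=
  have : IsClosedImmersion (IdealSheafData.inclusion h ≫ J.subschemeι) := by
    rw [IdealSheafData.inclusion_subschemeι]
    infer_instance
  .of_comp _ J.subschemeι

lemma Triple.mk_comap_inclusion {n : ℕ} (t : Triple U X n) {J : IdealSheafData (prodScheme U X)}
    (hJ : IsSubSch J) (h : J ≤ t.ideal) :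
    (Quotient.mk _ ⟨J, hJ, t.hom.comap _ (inclusion_src h)⟩ : Quotient (Triple.setoid U X n)) =
      Quotient.mk _ t :=
  Triple.mk_eq_mk t.hom (IdealSheafData.inclusion h) (𝟙 _) (inclusion_src h) (Category.id_comp _)
    (by rw [Category.id_comp, inclusion_tgt]) rfl t.hom.comap_id.symm

namespace Corr

variable {Φ Ψ : Corr U X}

variable (Φ Ψ) in
lemma exists_common_support : ∃ (J : IdealSheafData (prodScheme U X)) (hJ : IsSubSch J)
    (χ : MatHom (src J) Φ.n) (χ' : MatHom (src J) Ψ.n),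
    Quotient.mk _ ⟨J, hJ, χ⟩ = Φ.cls ∧ Quotient.mk _ ⟨J, hJ, χ'⟩ = Ψ.cls := by
  obtain ⟨t, ht⟩ := Quotient.exists_rep Φ.cls
  obtain ⟨t', ht'⟩ := Quotient.exists_rep Ψ.cls
  obtain ⟨J, hJ, h, h'⟩ := t.isSubSch.exists_le t'.isSubSch
  exact ⟨J, hJ, _, _, (t.mk_comap_inclusion hJ h).trans ht, (t'.mk_comap_inclusion hJ h').trans ht'⟩

lemma Hom.resMatrix_mul_idem (α : Φ ⟶ Ψ) (W : U.scheme.Opens) :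
    resMatrix (Hom.matrix α) W * Φ.idem W = resMatrix (Hom.matrix α) W := by
  rw [← idem_res Φ le_top, ← Matrix.map_mul, matrix_mul_idem]

theorem Hom.intertwines (α : Φ ⟶ Ψ) {J : IdealSheafData (prodScheme U X)} {hJ : IsSubSch J}
    {χ : MatHom (src J) Φ.n} {χ' : MatHom (src J) Ψ.n}
    (h : Quotient.mk _ ⟨J, hJ, χ⟩ = Φ.cls) (h' : Quotient.mk _ ⟨J, hJ, χ'⟩ = Ψ.cls) :
    Intertwines χ χ' (Hom.matrix α) := by
  obtain ⟨-, t, t', J', j, j', ht, ht', hJ', H⟩ := α.2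
  obtain ⟨L, l, _, hL, G⟩ := H.change hJ' (ht.trans h.symm) (ht'.trans h'.symm)
  have := hL.isFinite
  refine .of_comap_isClosedImmersion (w := inclusion_src l) fun W f => ?_
  change resMatrix _ W * χ.app W (can l W f) = χ'.app W (can l W f) * resMatrix _ W
  refine Matrix.mulVec_injective (funext fun v => ?_)
  have mem : (χ.app W (can l W f)).mulVec v ∈ Φ.P W := by
    rw [mem_P, idem_eq h, Matrix.mulVec_mulVec, ← map_mul, one_mul]
  have mulVec_proj : (χ.app W (can l W f)).mulVec v =
      (χ.app W (can l W f)).mulVec (Φ.proj W v : Fin Φ.n → Γ(U.scheme, W)) := by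
    rw [coe_proj, idem_eq h, Matrix.mulVec_mulVec, ← map_mul, mul_one]
  have linear := G W f (Φ.proj W v) ⟨_, mem⟩ mulVec_proj
  change (Hom.app α W ⟨_, mem⟩ : Fin Ψ.n → Γ(U.scheme, W)) =
    (χ'.app W (can l W f)).mulVec (Hom.app α W (Φ.proj W v)) at linear
  rw [app_eq, app_eq, coe_proj, Matrix.mulVec_mulVec, Matrix.mulVec_mulVec, Matrix.mulVec_mulVec,
    Matrix.mul_assoc, resMatrix_mul_idem] at linear
  exact linear

variable (Φ Ψ) in
/-- Multiplication by `M` is linear over the functions on some common support of `Φ` and `Ψ`. -/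
def IsLinear (M : Matrix (Fin Ψ.n) (Fin Φ.n) Γ(U.scheme, ⊤)) : Prop :=
  ∃ (J : IdealSheafData (prodScheme U X)) (hJ : IsSubSch J) (χ : MatHom (src J) Φ.n)
    (χ' : MatHom (src J) Ψ.n), Quotient.mk _ ⟨J, hJ, χ⟩ = Φ.cls ∧
    Quotient.mk _ ⟨J, hJ, χ'⟩ = Ψ.cls ∧ Intertwines χ χ' M

/-- Multiplication by `M`, as a family of maps `P(φ)(W) → P(φ')(W)`. -/
def mulFamily (M : Matrix (Fin Ψ.n) (Fin Φ.n) Γ(U.scheme, ⊤)) (h : Ψ.idem ⊤ * M = M) :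
    Family Φ Ψ :=
  fun W => ((resMatrix M W).mulVecLin.comp (Φ.P W).subtype).codRestrict (Ψ.P W) fun x => by
    rw [mem_P, LinearMap.comp_apply, Matrix.mulVecLin_apply, Matrix.mulVec_mulVec,
      ← idem_res Ψ le_top, ← Matrix.map_mul, h]

lemma coe_mulFamily {M : Matrix (Fin Ψ.n) (Fin Φ.n) Γ(U.scheme, ⊤)} (h : Ψ.idem ⊤ * M = M)
    (W : U.scheme.Opens) (x : Φ.P W) :
    (mulFamily M h W x : Fin Ψ.n → Γ(U.scheme, W)) = (resMatrix M W).mulVec x := rfl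

lemma mulFamily_mem_homs {M : Matrix (Fin Ψ.n) (Fin Φ.n) Γ(U.scheme, ⊤)} (h : Ψ.idem ⊤ * M = M)
    (hM : IsLinear Φ Ψ M) : mulFamily M h ∈ homs Φ Ψ := by
  obtain ⟨J, hJ, χ, χ', hχ, hχ', hM⟩ := hM
  refine ⟨fun W W' hW x y e => ?_, ⟨J, hJ, χ⟩, ⟨J, hJ, χ'⟩, J, le_rfl, le_rfl, hχ, hχ', hJ,
    fun W f x y e => ?_⟩
  · rw [coe_mulFamily, coe_mulFamily, e, ← resMatrix_map_res M hW]
    exact funext fun i => (RingHom.map_mulVec (res hW) (resMatrix M W) x i).symm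
  · rw [coe_mulFamily, coe_mulFamily, e, Matrix.mulVec_mulVec, Matrix.mulVec_mulVec, hM]

/-- The morphism given by multiplication by `M`. -/
def homOf (M : Matrix (Fin Ψ.n) (Fin Φ.n) Γ(U.scheme, ⊤)) (h : Ψ.idem ⊤ * M = M)
    (hM : IsLinear Φ Ψ M) : Φ ⟶ Ψ :=
  ⟨mulFamily M h, mulFamily_mem_homs h hM⟩

lemma matrix_homOf {M : Matrix (Fin Ψ.n) (Fin Φ.n) Γ(U.scheme, ⊤)} (h : Ψ.idem ⊤ * M = M)
    (h' : M * Φ.idem ⊤ = M) (hM : IsLinear Φ Ψ M) : Hom.matrix (homOf M h hM) = M := by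
  rw [Hom.matrix_eq_mul_idem (M := M), h']
  exact fun x => congr_arg (Matrix.mulVec · _) (resMatrix_top M)

lemma Hom.matrix_mul_act (α : Φ ⟶ Ψ) (c : Γ(X.scheme, ⊤)) :
    Hom.matrix α * Φ.act c = Ψ.act c * Hom.matrix α := by
  obtain ⟨J, hJ, χ, χ', h, h'⟩ := exists_common_support Φ Ψ
  have intertwines_c := Hom.intertwines α h h' ⊤ (rPull J ⊤ c)
  rwa [resMatrix_top, ← act_eq h, ← act_eq h'] at intertwines_c

end Corr

end Hom

/-! ### The composition functors -/

section Intertwines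

variable {Y Z Z₂ U V : Scheme.{u}} {n n' m m' : ℕ}

lemma Intertwines.baseChange {q : Y ⟶ Z} {p : Z₂ ⟶ U} {a : Y ⟶ Z₂} {g : Z ⟶ U}
    (H : IsPullback a q p g) [IsAffineHom p] {w : q ≫ g = a ≫ p} {φ : MatHom p n} {φ' : MatHom p n'}
    {ψ : MatHom q n} {ψ' : MatHom q n'} (h : Compat w φ ψ) (h' : Compat w φ' ψ')
    {M : Matrix (Fin n') (Fin n) Γ(U, ⊤)} (hM : Intertwines φ φ' M) :
    Intertwines ψ ψ' (M.map (pull g (W' := ⊤) le_top)) := by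
  let N := M.map (pull g (W' := ⊤) le_top)
  refine baseChange_ext H (fun S x => resMatrix N S * ψ.app S x)
    (fun S x => ψ'.app S x * resMatrix N S) (fun S x y => ?_) (fun S x y => ?_)
    (fun S c x => ?_) (fun S c x => ?_) (fun S S' hS x => ?_) (fun S S' hS x => ?_) (fun c b => ?_)
  · rw [map_add, Matrix.mul_add]
  · rw [map_add, Matrix.add_mul]
  · rw [ψ.app_pull_mul, Matrix.mul_smul]
  · rw [ψ'.app_pull_mul, Matrix.smul_mul]
  · rw [ψ.app_res hS, ← resMatrix_map_res N hS, Matrix.map_mul]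
  · rw [ψ'.app_res hS, ← resMatrix_map_res N hS, Matrix.map_mul]
  · have resMatrix_pull : resMatrix N c.source = (resMatrix M c.target).map (pull g c.le) := by
      ext i j
      exact (res_pull g (W := ⊤) (W' := ⊤) le_top le_top (M i j)).trans
        (pull_res g c.le le_top (M i j)).symm
    have app_pullFst : ψ.app c.source (c.pullFst w b) = _ := h c.target c.source c.le b
    have app_pullFst' : ψ'.app c.source (c.pullFst w b) = _ := h' c.target c.source c.le b
    rw [app_pullFst, app_pullFst', resMatrix_pull, ← Matrix.map_mul, ← Matrix.map_mul, hM]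

lemma Intertwines.star {q : Y ⟶ Z} {p : Z ⟶ V} {ψ : MatHom q m} {ψ' : MatHom q m'}
    {χ : MatHom p n} {χ' : MatHom p n'} {N : Matrix (Fin m') (Fin m) Γ(Z, ⊤)}
    {M : Matrix (Fin n') (Fin n) Γ(V, ⊤)} (hN : Intertwines ψ ψ' N) (hM : Intertwines χ χ' M) :
    Intertwines (ψ.star χ) (ψ'.star χ') (blockMul (χ'.app ⊤) N M) := by
  intro W f
  have res_blockMul : resMatrix (blockMul (χ'.app ⊤) N M) W =
      blockMul (χ'.app W) (resMatrix N (p ⁻¹ᵁ W)) (resMatrix M W) :=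
    blockMul_map (fun x => (χ'.app_res le_top x).symm) N M
  change _ * blockRect ((ψ.app (p ⁻¹ᵁ W) f).map (χ.app W)) =
    blockRect ((ψ'.app (p ⁻¹ᵁ W) f).map (χ'.app W)) * _
  rw [res_blockMul, blockRect_map_eq_blockMul, blockRect_map_eq_blockMul,
    blockMul_mul_blockMul (hM W),
    blockMul_mul_blockMul fun x => by rw [Matrix.one_mul, Matrix.mul_one], Matrix.one_mul,
    Matrix.mul_one]
  exact congr_arg (blockMul _ · _) (hN (p ⁻¹ᵁ W) f)

end Intertwines

section Composition

open Corr

variable {k : Type u} [Field k] {V U X : Sm k}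

/-- The composite `Φ₂ ∘ Φ₁` of two objects, computed from arbitrarily chosen representatives. -/
def compObj (Φ₁ : Corr V U) (Φ₂ : Corr U X) : Corr V X :=
  (exists_isComposite (Quotient.out Φ₁.cls) (Quotient.out Φ₂.cls)).choose.toCorr

lemma Corr.exists_toCorr_eq (Φ : Corr U X) : ∃ t : Triple U X Φ.n, t.toCorr = Φ :=
  ⟨Quotient.out Φ.cls, congr_arg (Corr.mk Φ.n) (Quotient.out_eq Φ.cls)⟩

theorem IsComposite.toCorr_eq_compObj {Φ₁ : Corr V U} {Φ₂ : Corr U X} {t₁ : Triple V U Φ₁.n}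
    {t₂ : Triple U X Φ₂.n} {t₃ : Triple V X (Φ₂.n * Φ₁.n)} (h : IsComposite t₁ t₂ t₃)
    (h₁ : Quotient.mk _ t₁ = Φ₁.cls) (h₂ : Quotient.mk _ t₂ = Φ₂.cls) :
    t₃.toCorr = compObj Φ₁ Φ₂ :=
  h.toCorr_eq (exists_isComposite (Quotient.out Φ₁.cls) (Quotient.out Φ₂.cls)).choose_spec
    (Quotient.exact (h₁.trans (Quotient.out_eq _).symm))
    (Quotient.exact (h₂.trans (Quotient.out_eq _).symm))

lemma IsComposite.compObj_toCorr {n₁ n₂ : ℕ} {t₁ : Triple V U n₁} {t₂ : Triple U X n₂}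
    {t₃ : Triple V X (n₂ * n₁)} (h : IsComposite t₁ t₂ t₃) :
    compObj t₁.toCorr t₂.toCorr = t₃.toCorr :=
  (h.toCorr_eq_compObj (Φ₁ := t₁.toCorr) (Φ₂ := t₂.toCorr) rfl rfl).symm

lemma IsComposite.act_eq {Φ₁ : Corr V U} {Φ₂ : Corr U X} {t₁ : Triple V U Φ₁.n}
    {t₂ : Triple U X Φ₂.n} {t₃ : Triple V X (Φ₂.n * Φ₁.n)} (h : IsComposite t₁ t₂ t₃)
    (h₁ : Quotient.mk _ t₁ = Φ₁.cls) (h₂ : Quotient.mk _ t₂ = Φ₂.cls) (c : Γ(X.scheme, ⊤)) :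
    t₃.toCorr.act c = blockRect ((Φ₂.act c).map Φ₁.act) := by
  obtain ⟨ψ, hψ, π, w, w', hom_eq⟩ := h.exists_compat
  have pull_tgt : pullSec π w ⊤ (rPull t₃.ideal ⊤ c) =
      pull (W' := (fibFst t₁.ideal t₂.ideal ≫ src t₁.ideal) ⁻¹ᵁ ⊤) (fibSnd t₁.ideal t₂.ideal)
        (preimage_le_of_comm (T' := src t₁.ideal ⁻¹ᵁ ⊤) pullback.condition le_top)
        (rPull t₂.ideal ⊤ c) :=
    (pull_pull (tgt t₃.ideal) π _ _ c).trans ((pull_congr w' _ c).trans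
      (pull_pull (tgt t₂.ideal) (fibSnd t₁.ideal t₂.ideal) _ _ c).symm)
  have act₁ : Φ₁.act = fun x => t₁.hom.app ⊤ (rPull t₁.ideal ⊤ x) := funext (Corr.act_eq h₁)
  rw [act₁, Corr.act_eq h₂]
  change t₃.hom.app ⊤ (rPull t₃.ideal ⊤ c) = _
  rw [hom_eq]
  change blockRect ((ψ.app (src t₁.ideal ⁻¹ᵁ ⊤) (pullSec π w ⊤ (rPull t₃.ideal ⊤ c))).map
    (t₁.hom.app ⊤)) = _
  rw [pull_tgt]
  exact congr_arg (fun N => blockRect (N.map (t₁.hom.app ⊤)))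
    (hψ ⊤ (src t₁.ideal ⁻¹ᵁ ⊤) le_top (rPull t₂.ideal ⊤ c))

lemma act_compObj (Φ₁ : Corr V U) (Φ₂ : Corr U X) (c : Γ(X.scheme, ⊤)) :
    (compObj Φ₁ Φ₂).act c = blockMul Φ₁.act (Φ₂.act c) (Φ₁.idem ⊤) :=
  ((exists_isComposite (Quotient.out Φ₁.cls) (Quotient.out Φ₂.cls)).choose_spec.act_eq
    (Quotient.out_eq _) (Quotient.out_eq _) c).trans
    (congr_arg (fun f => blockRect ((Φ₂.act c).map f)) (funext fun x => (Φ₁.act_mul_idem x).symm))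

variable {Φ₁ Φ₁' Φ₁'' : Corr V U} {Φ₂ Φ₂' Φ₂'' : Corr U X}

/-- The matrix of the composite `α₂ ⊙ α₁` of two morphisms. -/
def compMatrix (α₁ : Φ₁ ⟶ Φ₁') (α₂ : Φ₂ ⟶ Φ₂') :
    Matrix (Fin (compObj Φ₁' Φ₂').n) (Fin (compObj Φ₁ Φ₂).n) Γ(V.scheme, ⊤) :=
  blockMul Φ₁'.act (Hom.matrix α₂) (Hom.matrix α₁)

lemma compMatrix_mul (α₁ : Φ₁ ⟶ Φ₁') (β₁ : Φ₁' ⟶ Φ₁'') (α₂ : Φ₂ ⟶ Φ₂') (β₂ : Φ₂' ⟶ Φ₂'') :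
    compMatrix β₁ β₂ * compMatrix α₁ α₂ = compMatrix (α₁ ≫ β₁) (α₂ ≫ β₂) := by
  rw [compMatrix, compMatrix, compMatrix, Hom.matrix_comp, Hom.matrix_comp]
  exact blockMul_mul_blockMul (Hom.matrix_mul_act β₁) _ _ _

lemma idem_compObj (Φ₁ : Corr V U) (Φ₂ : Corr U X) :
    (compObj Φ₁ Φ₂).idem ⊤ = compMatrix (𝟙 Φ₁) (𝟙 Φ₂) := by
  rw [← act_one, act_compObj, act_one, compMatrix, Hom.matrix_id, Hom.matrix_id]

lemma idem_mul_compMatrix (α₁ : Φ₁ ⟶ Φ₁') (α₂ : Φ₂ ⟶ Φ₂') :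
    (compObj Φ₁' Φ₂').idem ⊤ * compMatrix α₁ α₂ = compMatrix α₁ α₂ := by
  rw [idem_compObj, compMatrix_mul, Category.comp_id, Category.comp_id]

lemma compMatrix_mul_idem (α₁ : Φ₁ ⟶ Φ₁') (α₂ : Φ₂ ⟶ Φ₂') :
    compMatrix α₁ α₂ * (compObj Φ₁ Φ₂).idem ⊤ = compMatrix α₁ α₂ := by
  rw [idem_compObj, compMatrix_mul, Category.id_comp, Category.id_comp]

lemma isLinear_compMatrix (α₁ : Φ₁ ⟶ Φ₁') (α₂ : Φ₂ ⟶ Φ₂') :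
    IsLinear (compObj Φ₁ Φ₂) (compObj Φ₁' Φ₂') (compMatrix α₁ α₂) := by
  obtain ⟨J₁, hJ₁, χ₁, χ₁', h₁, h₁'⟩ := exists_common_support Φ₁ Φ₁'
  obtain ⟨J₂, hJ₂, χ₂, χ₂', h₂, h₂'⟩ := exists_common_support Φ₂ Φ₂'
  have := hJ₂.isFinite
  have H := (IsPullback.of_hasPullback (tgt J₁) (src J₂)).flip
  obtain ⟨C, m, π, hC, isImage, hπ⟩ := exists_composite_support hJ₁ hJ₂
  have w : π ≫ src (IdealSheafData.vanishingIdeal C ^ m) = fibFst J₁ J₂ ≫ src J₁ := by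
    rw [← compositeMap_fst, ← hπ, Category.assoc]
  have w' : π ≫ tgt (IdealSheafData.vanishingIdeal C ^ m) = fibSnd J₁ J₂ ≫ tgt J₂ := by
    rw [← compositeMap_snd, ← hπ, Category.assoc]
  let composite {a b : ℕ} (ω₁ : MatHom (src J₁) a) (ω₂ : MatHom (src J₂) b) : Triple V X (b * a) :=
    ⟨_, ⟨C, hC, m, rfl⟩, ((baseChange H ω₂).star ω₁).comap π w⟩
  have isComposite {a b : ℕ} (ω₁ : MatHom (src J₁) a) (ω₂ : MatHom (src J₂) b) :
      IsComposite ⟨J₁, hJ₁, ω₁⟩ ⟨J₂, hJ₂, ω₂⟩ (composite ω₁ ω₂) :=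
    ⟨⟨C, m, isImage, rfl⟩, π, w, w', _, isBaseChange_iff.mpr (compat_baseChange H ω₂),
      fun _ _ => rfl⟩
  have intertwines := ((Hom.intertwines α₂ h₂ h₂').baseChange H (compat_baseChange H χ₂)
    (compat_baseChange H χ₂')).star (Hom.intertwines α₁ h₁ h₁')
  have act_eq_app : (fun x => χ₁'.app ⊤ (rPull J₁ ⊤ x)) = Φ₁'.act :=
    funext fun x => (act_eq h₁' x).symm
  refine ⟨_, ⟨C, hC, m, rfl⟩, (composite χ₁ χ₂).hom, (composite χ₁' χ₂').hom, ?_, ?_, ?_⟩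
  · exact congr_arg_heq Corr.cls ((isComposite χ₁ χ₂).toCorr_eq_compObj h₁ h₂) |>.eq
  · exact congr_arg_heq Corr.cls ((isComposite χ₁' χ₂').toCorr_eq_compObj h₁' h₂') |>.eq
  · rw [compMatrix, ← act_eq_app]
    exact intertwines.comap π w

/-- The composite `α₂ ⊙ α₁` of two morphisms. -/
def compHom (α₁ : Φ₁ ⟶ Φ₁') (α₂ : Φ₂ ⟶ Φ₂') : compObj Φ₁ Φ₂ ⟶ compObj Φ₁' Φ₂' :=
  homOf (compMatrix α₁ α₂) (idem_mul_compMatrix α₁ α₂) (isLinear_compMatrix α₁ α₂)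

lemma matrix_compHom (α₁ : Φ₁ ⟶ Φ₁') (α₂ : Φ₂ ⟶ Φ₂') :
    Hom.matrix (compHom α₁ α₂) = compMatrix α₁ α₂ :=
  matrix_homOf _ (compMatrix_mul_idem α₁ α₂) _

variable (V U X) in
/-- The composition functor `𝒜(V, U) × 𝒜(U, X) ⥤ 𝒜(V, X)`. -/
def compFunctor : Corr V U × Corr U X ⥤ Corr V X where
  obj Φ := compObj Φ.1 Φ.2
  map α := compHom α.1 α.2
  map_id Φ := Hom.matrix_injective <| by
    rw [matrix_compHom, Hom.matrix_id, idem_compObj]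
    rfl
  map_comp α β := Hom.matrix_injective <| by
    rw [matrix_compHom, Hom.matrix_comp, matrix_compHom, matrix_compHom, compMatrix_mul]
    rfl

end Composition

/-! ### The pairing property -/

section Pairing

variable {k : Type u} [Field k] {V U X : Sm k}

open Corr

lemma resMatrix_act {Φ : Corr V U} {J : IdealSheafData (prodScheme V U)} {hJ : IsSubSch J}
    {χ : MatHom (src J) Φ.n} (h : Quotient.mk _ ⟨J, hJ, χ⟩ = Φ.cls) (c : Γ(U.scheme, ⊤))
    (W : V.scheme.Opens) : resMatrix (Φ.act c) W = χ.app W (rPull J W c) := by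
  rw [act_eq h]
  refine (χ.app_res (W := ⊤) le_top (rPull J ⊤ c)).symm.trans ?_
  exact congr_arg (χ.app W) (res_pull (tgt J) _ _ c)

/-- The vector `(φ₁(m₂_j) m₁)_j` in the definition of `σ₁₂`. -/
def sigmaVec {n₁ n₂ : ℕ} (t₁ : Triple V U n₁) (W : V.scheme.Opens)
    (m₂ : Fin n₂ → Γ(t₁.ideal.subscheme, src t₁.ideal ⁻¹ᵁ W)) (m₁ : Fin n₁ → Γ(V.scheme, W)) :
    Fin (n₂ * n₁) → Γ(V.scheme, W) :=
  blockVec fun j => (t₁.hom.app W (m₂ j)).mulVec m₁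

section

variable {Φ₁ Φ₁' : Corr V U} {Φ₂ Φ₂' : Corr U X} {J : IdealSheafData (prodScheme V U)}
  {hJ : IsSubSch J} {φ₁ : MatHom (src J) Φ₁.n} {φ₁' : MatHom (src J) Φ₁'.n}

lemma coe_sigma (t₁ : Triple V U Φ₁.n) (W : V.scheme.Opens)
    (m₂ : Fin Φ₂.n → Γ(t₁.ideal.subscheme, src t₁.ideal ⁻¹ᵁ W)) (m₁ : Φ₁.P W) :
    (sigma (compObj Φ₁ Φ₂) rfl t₁ W m₂ m₁ : Fin (compObj Φ₁ Φ₂).n → Γ(V.scheme, W)) =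
      ((compObj Φ₁ Φ₂).idem W).mulVec (sigmaVec t₁ W m₂ m₁) := rfl

lemma compMatrix_mulVec_sigmaVec (α₁ : Φ₁ ⟶ Φ₁') (α₂ : Φ₂ ⟶ Φ₂')
    (h : Quotient.mk _ ⟨J, hJ, φ₁⟩ = Φ₁.cls) (h' : Quotient.mk _ ⟨J, hJ, φ₁'⟩ = Φ₁'.cls)
    (W : V.scheme.Opens) (m₂ : Fin Φ₂.n → Γ(J.subscheme, src J ⁻¹ᵁ W)) (m₁ : Φ₁.P W) :
    (resMatrix (compMatrix α₁ α₂) W).mulVec (sigmaVec ⟨J, hJ, φ₁⟩ W m₂ m₁) =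
      sigmaVec ⟨J, hJ, φ₁'⟩ W (pulledHom J α₂ W m₂) (Hom.app α₁ W m₁) := by
  have resMatrix_compMatrix : resMatrix (compMatrix α₁ α₂) W =
      blockMul (φ₁'.app W) ((Hom.matrix α₂).map (rPull J W)) (resMatrix (Hom.matrix α₁) W) :=
    blockMul_map (fun c => resMatrix_act h' c W) _ _
  rw [resMatrix_compMatrix, Hom.app_eq]
  exact blockMul_mulVec (Hom.intertwines α₁ h h' W) _ m₂ m₁

lemma compHom_sigma (α₁ : Φ₁ ⟶ Φ₁') (α₂ : Φ₂ ⟶ Φ₂') (h : Quotient.mk _ ⟨J, hJ, φ₁⟩ = Φ₁.cls)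
    (h' : Quotient.mk _ ⟨J, hJ, φ₁'⟩ = Φ₁'.cls) (W : V.scheme.Opens)
    (m₂ : Fin Φ₂.n → Γ(J.subscheme, src J ⁻¹ᵁ W)) (m₁ : Φ₁.P W) :
    Hom.app (compHom α₁ α₂) W (sigma (compObj Φ₁ Φ₂) rfl ⟨J, hJ, φ₁⟩ W m₂ m₁) =
      sigma (compObj Φ₁' Φ₂') rfl ⟨J, hJ, φ₁'⟩ W (pulledHom J α₂ W m₂) (Hom.app α₁ W m₁) := by
  have matrix_mul_idem : resMatrix (compMatrix α₁ α₂) W * (compObj Φ₁ Φ₂).idem W =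
      (compObj Φ₁' Φ₂').idem W * resMatrix (compMatrix α₁ α₂) W := by
    rw [← idem_res (compObj Φ₁ Φ₂) (le_top : W ≤ ⊤), ← idem_res (compObj Φ₁' Φ₂') (le_top : W ≤ ⊤),
      ← Matrix.map_mul, ← Matrix.map_mul, compMatrix_mul_idem, idem_mul_compMatrix]
  apply Subtype.ext
  rw [Hom.app_eq, matrix_compHom, coe_sigma, coe_sigma, ← compMatrix_mulVec_sigmaVec α₁ α₂ h h']
  refine (Matrix.mulVec_mulVec _ _ _).trans ?_
  rw [matrix_mul_idem]
  exact (Matrix.mulVec_mulVec _ _ _).symm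

lemma proj_single_eq_sigma (h : Quotient.mk _ ⟨J, hJ, φ₁⟩ = Φ₁.cls) (l : Fin (compObj Φ₁ Φ₂).n) :
    ∃ m₂ ∈ pulledP J Φ₂ ⊤, ∃ m₁ : Φ₁.P ⊤,
      (compObj Φ₁ Φ₂).proj ⊤ (Pi.single l 1) = sigma (compObj Φ₁ Φ₂) rfl ⟨J, hJ, φ₁⟩ ⊤ m₂ m₁ := by
  obtain ⟨⟨j, i⟩, rfl⟩ := (finProdFinEquiv (m := Φ₂.n) (n := Φ₁.n)).surjective l
  refine ⟨((Φ₂.idem ⊤).map (rPull J ⊤)).mulVec (Pi.single j 1), ⟨_, rfl⟩,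
    Φ₁.proj ⊤ (Pi.single i 1), Subtype.ext ?_⟩
  have sigmaVec_eq : sigmaVec ⟨J, hJ, φ₁⟩ ⊤ (((Φ₂.idem ⊤).map (rPull J ⊤)).mulVec (Pi.single j 1))
        (Φ₁.proj ⊤ (Pi.single i 1)) =
      ((compObj Φ₁ Φ₂).idem ⊤).mulVec (Pi.single (finProdFinEquiv (j, i)) 1) := by
    have app_rPull (c) : φ₁.app ⊤ (rPull J ⊤ c) = Φ₁.act c := (act_eq h c).symm
    rw [idem_compObj, compMatrix, Hom.matrix_id, Hom.matrix_id]
    refine Eq.trans ?_ (Matrix.mulVec_single_one (blockMul Φ₁.act _ _) _).symm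
    ext l
    obtain ⟨⟨j', i'⟩, rfl⟩ := (finProdFinEquiv (m := Φ₂.n) (n := Φ₁.n)).surjective l
    simp only [Matrix.mulVec_single_one, coe_proj, Matrix.col_apply, sigmaVec, blockVec,
      Equiv.symm_apply_apply, Matrix.map_apply, app_rPull, blockMul_apply]
    rfl
  rw [coe_sigma, sigmaVec_eq, coe_proj, Matrix.mulVec_mulVec, idem_mul_idem]

end

theorem isPairing_compFunctor : IsPairing (compFunctor V U X) where
  exists_composite := exists_isComposite
  obj_eq _ _ _ h := h.compObj_toCorr
  n_eq _ _ := rfl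
  map_sigma α₁ α₂ _ _ _ _ h h' W m₂ _ m₁ := compHom_sigma α₁ α₂ h h' W m₂ m₁

lemma IsPairing.obj_eq_compObj {F : Corr V U × Corr U X ⥤ Corr V X} (hF : IsPairing F)
    (Φ : Corr V U × Corr U X) : F.obj Φ = compObj Φ.1 Φ.2 := by
  obtain ⟨Φ₁, Φ₂⟩ := Φ
  obtain ⟨t₁, h₁⟩ := Φ₁.exists_toCorr_eq
  obtain ⟨t₂, h₂⟩ := Φ₂.exists_toCorr_eq
  obtain ⟨t₃, h⟩ := exists_isComposite t₁ t₂
  rw [← h₁, ← h₂, hF.obj_eq _ _ _ h, h.compObj_toCorr]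

lemma Corr.Hom.ext_proj {Φ Ψ : Corr U X} {α β : Φ ⟶ Ψ}
    (h : ∀ l, Hom.app α ⊤ (Φ.proj ⊤ (Pi.single l 1)) = Hom.app β ⊤ (Φ.proj ⊤ (Pi.single l 1))) :
    α = β :=
  Hom.matrix_injective (Matrix.ext fun i l => congr_fun (congr_arg Subtype.val (h l)) i)

theorem IsPairing.eq_compFunctor {F : Corr V U × Corr U X ⥤ Corr V X} (hF : IsPairing F) :
    F = compFunctor V U X := by
  have obj_eq : F.obj = fun Φ => compObj Φ.1 Φ.2 := funext hF.obj_eq_compObj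
  obtain ⟨obj, map, map_id, map_comp⟩ := F
  change obj = _ at obj_eq
  subst obj_eq
  have map_eq : @map = fun _ _ α => compHom α.1 α.2 := by
    funext ⟨Φ₁, Φ₂⟩ ⟨Φ₁', Φ₂'⟩ ⟨α₁, α₂⟩
    refine Hom.ext_proj fun l => ?_
    obtain ⟨J, hJ, χ, χ', h, h'⟩ := exists_common_support Φ₁ Φ₁'
    obtain ⟨m₂, hm₂, m₁, proj_eq⟩ := proj_single_eq_sigma (Φ₂ := Φ₂) h l
    change Hom.app (map (X := (Φ₁, Φ₂)) (Y := (Φ₁', Φ₂')) (α₁ ×ₘ α₂)) ⊤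
      ((compObj Φ₁ Φ₂).proj ⊤ (Pi.single l 1)) =
      Hom.app (compHom α₁ α₂) ⊤ ((compObj Φ₁ Φ₂).proj ⊤ (Pi.single l 1))
    rw [proj_eq]
    exact (hF.map_sigma α₁ α₂ J hJ χ χ' h h' ⊤ m₂ hm₂ m₁).trans
      (compHom_sigma α₁ α₂ h h' ⊤ m₂ m₁).symm
  subst map_eq
  rfl

end Pairing

/-! ### Associativity and units on objects -/

section Objects

variable {k : Type u} [Field k] {W V U X : Sm k}

open Corr

lemma IsRepresentedBy.of_cast {Φ : Corr U X} {Y : Scheme.{u}} {n m : ℕ} {p : Y ⟶ U.scheme}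
    {q : Y ⟶ X.scheme} {χ : MatHom p n} (e : n = m) (h : IsRepresentedBy Φ p q (χ.cast e)) :
    IsRepresentedBy Φ p q χ := by
  subst e
  exact h

lemma cast_finProdFinEquiv {a b c : ℕ} (i : Fin c) (j : Fin b) (l : Fin a) :
    Fin.cast (mul_assoc c b a).symm (finProdFinEquiv (i, finProdFinEquiv (j, l))) =
      finProdFinEquiv (finProdFinEquiv (i, j), l) := by
  ext
  simp only [Fin.val_cast, finProdFinEquiv_apply_val]
  ring

namespace MatHom

variable {Y Z V : Scheme.{u}}

lemma star_apply {q : Y ⟶ Z} {p : Z ⟶ V} {m n : ℕ} (ψ : MatHom q m) (φ : MatHom p n) (W : V.Opens)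
    (f : Γ(Y, (q ≫ p) ⁻¹ᵁ W)) (i j : Fin m) (k l : Fin n) :
    (ψ.star φ).app W f (finProdFinEquiv (i, k)) (finProdFinEquiv (j, l)) =
      φ.app W (ψ.app (p ⁻¹ᵁ W) f i j) k l := by
  rw [star_app, blockMatrix_eq_blockRect, blockRect_apply, Matrix.map_apply]

lemma star_assoc {Y₁ : Scheme.{u}} {q' : Y ⟶ Y₁} {q : Y₁ ⟶ Z} {p : Z ⟶ V} {a b c : ℕ}
    (ψ' : MatHom q' c) (ψ : MatHom q b) (χ : MatHom p a) :
    ψ'.star (ψ.star χ) =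
      (((ψ'.star ψ).star χ).comap (𝟙 Y) (by simp)).cast (mul_assoc c b a) := by
  refine ext_app fun W f => matrix_ext_blocks fun i₃ j₃ i j => ?_
  obtain ⟨⟨i₂, i₁⟩, rfl⟩ := finProdFinEquiv.surjective i
  obtain ⟨⟨j₂, j₁⟩, rfl⟩ := finProdFinEquiv.surjective j
  rw [cast_app, cast_finProdFinEquiv, cast_finProdFinEquiv, comap_app, pull_id, star_apply,
    star_apply, star_apply]
  refine Eq.trans ?_ (congr_arg (χ.app W · i₁ j₁) (star_apply ψ' ψ _ _ i₃ j₃ i₂ j₂)).symm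
  exact congr_arg (fun x => χ.app W (ψ.app (p ⁻¹ᵁ W) (ψ'.app (q ⁻¹ᵁ p ⁻¹ᵁ W) x i₃ j₃) i₂ j₂) i₁ j₁)
    (res_self (W := ((q' ≫ q) ≫ p) ⁻¹ᵁ W) le_rfl f).symm

/-- The isomorphism `𝒪_S → M_1(𝒪_S)`, the matrix homomorphism of an identity object. -/
def scalar (S : Scheme.{u}) : MatHom (𝟙 S) 1 :=
  ofFun _ _ (fun W f => Matrix.of fun _ _ => res (show W ≤ (𝟙 S) ⁻¹ᵁ W from le_rfl) f)
    (fun W f g => by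
      ext
      exact map_add (res _) f g)
    (fun W f g => by
      ext
      simp only [Matrix.mul_apply, Finset.univ_unique, Finset.sum_singleton]
      exact map_mul (res _) f g)
    (fun W a f => by
      ext
      simp only [Matrix.of_apply, Matrix.smul_apply, map_mul, smul_eq_mul, pull_id, res_res,
        res_self])
    (fun _ _ _ _ => by
      ext
      simp only [Matrix.of_apply, Matrix.map_apply, res_res])

lemma scalar_app (S : Scheme.{u}) (W : S.Opens) (f : Γ(S, (𝟙 S) ⁻¹ᵁ W)) (i j : Fin 1) :
    (scalar S).app W f i j = res (show W ≤ (𝟙 S) ⁻¹ᵁ W from le_rfl) f := rfl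

lemma star_scalar {p : Y ⟶ Z} {n : ℕ} (ψ : MatHom p n) :
    ψ.star (scalar Z) = (ψ.comap (𝟙 Y) (by simp)).cast (mul_one n).symm := by
  have cast_eq (i : Fin n) (k : Fin 1) : Fin.cast (mul_one n) (finProdFinEquiv (i, k)) = i := by
    ext
    simp
  refine ext_app fun W f => matrix_ext_blocks fun i j k l => ?_
  rw [star_apply, scalar_app, cast_app, cast_eq, cast_eq, comap_app, pull_id]
  refine (res_self (W := W) le_rfl _).trans ?_
  exact congr_arg (fun x => ψ.app W x i j) (res_self (W := p ⁻¹ᵁ W) le_rfl f).symm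

lemma scalar_star {p : Y ⟶ Z} {n : ℕ} (χ : MatHom p n) :
    (scalar Y).star χ = (χ.comap (𝟙 Y) (by simp)).cast (one_mul n).symm := by
  have cast_eq (i : Fin 1) (k : Fin n) : Fin.cast (one_mul n) (finProdFinEquiv (i, k)) = k := by
    ext
    simp
  refine ext_app fun W f => matrix_ext_blocks fun i j k l => ?_
  rw [star_apply, cast_app, cast_eq, cast_eq, comap_app, pull_id]
  rfl

end MatHom

theorem compObj_assoc (Φ₁ : Corr W V) (Φ₂ : Corr V U) (Φ₃ : Corr U X) :
    compObj (compObj Φ₁ Φ₂) Φ₃ = compObj Φ₁ (compObj Φ₂ Φ₃) := by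
  obtain ⟨t₁, eq₁⟩ := Φ₁.exists_toCorr_eq
  obtain ⟨t₂, eq₂⟩ := Φ₂.exists_toCorr_eq
  obtain ⟨t₃, eq₃⟩ := Φ₃.exists_toCorr_eq
  obtain ⟨t₁₂, h₁₂⟩ := exists_isComposite t₁ t₂
  obtain ⟨t₂₃, h₂₃⟩ := exists_isComposite t₂ t₃
  obtain ⟨u, hu⟩ := exists_isComposite t₁₂ t₃
  obtain ⟨v, hv⟩ := exists_isComposite t₁ t₂₃
  rw [← eq₁, ← eq₂, ← eq₃, h₁₂.compObj_toCorr, h₂₃.compObj_toCorr, hu.compObj_toCorr,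
    hv.compObj_toCorr]
  obtain ⟨ψ₂, hψ₂, π₁₂, w₁₂, e₁₂, hom₁₂⟩ := h₁₂.exists_compat
  obtain ⟨ψ₃, hψ₃, π₂₃, w₂₃, e₂₃, hom₂₃⟩ := h₂₃.exists_compat
  have := t₃.isSubSch.isFinite
  -- Both composites are represented on `Z₁ ×_U Z₂ ×_V Z₃`, where `ψ` is the base change of `φ₃`.
  have H := (IsPullback.of_hasPullback (fibSnd t₁.ideal t₂.ideal) (fibFst t₂.ideal t₃.ideal)).flip
  have hψ := compat_baseChange H ψ₃
  have left := hu.isRepresentedBy π₁₂ w₁₂ e₁₂ hom₁₂ (𝟙 _) (Category.id_comp _)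
    (Category.id_comp _) t₃.hom.comap_id.symm (hψ₃.comp hψ)
  have right := hv.isRepresentedBy (𝟙 _) (Category.id_comp _) (Category.id_comp _)
    t₁.hom.comap_id.symm π₂₃ w₂₃ e₂₃ hom₂₃ (hψ₂.star hψ)
  rw [MatHom.star_assoc] at left
  exact (left.of_cast.of_comap _ _ (by simp)).unique right

/-- The isomorphism of `X` onto the diagonal of `X × X`, as a closed subscheme. -/
abbrev diagIso (X : Sm k) : X.scheme ⟶ (diag X).ker.subscheme := (diag X).toImage

lemma diagIso_src (X : Sm k) : diagIso X ≫ src (diag X).ker = 𝟙 X.scheme :=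
  (Category.assoc _ _ _).symm.trans
    ((congr_arg (· ≫ prodFst X X) (diag X).toImage_imageι).trans (pullback.diagonal_fst _))

lemma diagIso_tgt (X : Sm k) : diagIso X ≫ tgt (diag X).ker = 𝟙 X.scheme :=
  (Category.assoc _ _ _).symm.trans
    ((congr_arg (· ≫ prodSnd X X) (diag X).toImage_imageι).trans (pullback.diagonal_snd _))

/-- The triple `(1, Δ_X, id)` representing `id_X`. -/
def idTriple (X : Sm k) : Triple X X 1 where
  ideal := (diag X).ker
  isSubSch := isSubSch_ker_diag X
  hom := (MatHom.scalar X.scheme).comap (diagIso X) (diagIso_src X)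

/-- The object `id_X` of `𝒜(X, X)`. -/
def idCorr (X : Sm k) : Corr X X := (idTriple X).toCorr

theorem isIdentity_idCorr (X : Sm k) : IsIdentity (idCorr X) := by
  refine ⟨idTriple X, diagIso X, diagIso_src X, ?_, diagIso_tgt X, fun W f => ?_, rfl⟩
  · change IsIso (diag X).toImage
    infer_instance
  · ext
    exact res_self (W := W) le_rfl _

theorem idCorr_compObj (Φ : Corr U X) : compObj (idCorr U) Φ = Φ := by
  obtain ⟨t, eq⟩ := Φ.exists_toCorr_eq
  obtain ⟨u, hu⟩ := exists_isComposite (idTriple U) t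
  have compat : Compat (show src t.ideal ≫ 𝟙 U.scheme = 𝟙 _ ≫ src t.ideal by simp) t.hom t.hom := by
    intro O S hS b
    rw [pull_id]
    refine (t.hom.app_res (show S ≤ O from hS) b).trans ?_
    ext i j
    exact (pull_id hS _).symm
  have comp := hu.isRepresentedBy (χ₁ := MatHom.scalar U.scheme) (diagIso U) (diagIso_src U)
    (diagIso_tgt U) rfl (𝟙 _) (Category.id_comp _) (Category.id_comp _) t.hom.comap_id.symm compat
  rw [MatHom.star_scalar] at comp
  rw [← eq, idCorr, hu.compObj_toCorr]
  exact (comp.of_cast.of_comap _ _ (by simp)).unique t.isRepresentedBy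

theorem compObj_idCorr (Φ : Corr U X) : compObj Φ (idCorr X) = Φ := by
  obtain ⟨t, eq⟩ := Φ.exists_toCorr_eq
  obtain ⟨u, hu⟩ := exists_isComposite t (idTriple X)
  have compat : Compat (show 𝟙 _ ≫ tgt t.ideal = tgt t.ideal ≫ 𝟙 X.scheme by simp)
      (MatHom.scalar X.scheme) (MatHom.scalar t.ideal.subscheme) := by
    intro O S hS b
    ext i j
    rw [Matrix.map_apply, MatHom.scalar_app, MatHom.scalar_app, pull_res]
    exact res_pull _ _ _ _
  have comp := hu.isRepresentedBy (𝟙 _) (Category.id_comp _) (Category.id_comp _)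
    t.hom.comap_id.symm (χ₂ := MatHom.scalar X.scheme) (diagIso X) (diagIso_src X) (diagIso_tgt X)
    rfl compat
  rw [MatHom.scalar_star] at comp
  rw [← eq, idCorr, hu.compObj_toCorr]
  exact (comp.of_cast.of_comap _ _ (by simp)).unique t.isRepresentedBy

end Objects

/-! ### Associativity and units -/

section Functors

variable {k : Type u} [Field k] {W V U X : Sm k}

open Corr

/-- Equal objects have ranks which agree only propositionally, so the entries of the two matrices
are compared at indices with equal values. -/
lemma Corr.functor_ext {C : Type*} [Category* C] {F G : C ⥤ Corr U X}
    (hobj : ∀ c, F.obj c = G.obj c)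
    (hmap : ∀ {c d : C} (f : c ⟶ d) (i : Fin (F.obj d).n) (j : Fin (F.obj c).n)
      (i' : Fin (G.obj d).n) (j' : Fin (G.obj c).n), (i : ℕ) = i' → (j : ℕ) = j' →
      Hom.matrix (F.map f) i j = Hom.matrix (G.map f) i' j') : F = G := by
  obtain ⟨obj, map, map_id, map_comp⟩ := F
  obtain ⟨obj', map', map_id', map_comp'⟩ := G
  obtain rfl : obj = obj' := funext hobj
  obtain rfl : @map = @map' := by
    funext c d f
    exact Hom.matrix_injective (Matrix.ext fun i j => hmap f i j i j rfl rfl)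
  rfl

section Matrices

variable {Φ₁ Φ₁' : Corr W V} {Φ₂ Φ₂' : Corr V U} {Φ₃ Φ₃' : Corr U X}

lemma compMatrix_apply (α₁ : Φ₁ ⟶ Φ₁') (α₂ : Φ₂ ⟶ Φ₂') (i₂ : Fin Φ₂'.n) (i₁ : Fin Φ₁'.n)
    (j₂ : Fin Φ₂.n) (j₁ : Fin Φ₁.n) :
    compMatrix α₁ α₂ (finProdFinEquiv (i₂, i₁)) (finProdFinEquiv (j₂, j₁)) =
      (Φ₁'.act (Hom.matrix α₂ i₂ j₂) * Hom.matrix α₁) i₁ j₁ :=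
  blockMul_apply _ _ _ _ _ _ _

lemma act_mul_compMatrix (α₁ : Φ₁ ⟶ Φ₁') (α₂ : Φ₂ ⟶ Φ₂') (c : Γ(U.scheme, ⊤)) :
    (compObj Φ₁' Φ₂').act c * compMatrix α₁ α₂ =
      blockMul Φ₁'.act (Φ₂'.act c * Hom.matrix α₂) (Hom.matrix α₁) := by
  have idem_mul_act (x) : Φ₁'.idem ⊤ * Φ₁'.act x = Φ₁'.act x * Φ₁'.idem ⊤ := by
    rw [← act_one, ← map_mul, ← map_mul, mul_comm]
  rw [act_compObj, ← Hom.idem_mul_matrix α₁]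
  refine (blockMul_mul_blockMul idem_mul_act _ _ _).trans ?_
  rw [Hom.idem_mul_matrix]

lemma compMatrix_assoc (α₁ : Φ₁ ⟶ Φ₁') (α₂ : Φ₂ ⟶ Φ₂') (α₃ : Φ₃ ⟶ Φ₃')
    (i : Fin (compObj (compObj Φ₁' Φ₂') Φ₃').n) (j : Fin (compObj (compObj Φ₁ Φ₂) Φ₃).n)
    (i' : Fin (compObj Φ₁' (compObj Φ₂' Φ₃')).n) (j' : Fin (compObj Φ₁ (compObj Φ₂ Φ₃)).n)
    (hi : (i : ℕ) = i') (hj : (j : ℕ) = j') :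
    compMatrix (compHom α₁ α₂) α₃ i j = compMatrix α₁ (compHom α₂ α₃) i' j' := by
  obtain ⟨⟨i₃, i⟩, rfl⟩ := (finProdFinEquiv (m := Φ₃'.n) (n := Φ₂'.n * Φ₁'.n)).surjective i
  obtain ⟨⟨i₂, i₁⟩, rfl⟩ := finProdFinEquiv.surjective i
  obtain ⟨⟨j₃, j⟩, rfl⟩ := (finProdFinEquiv (m := Φ₃.n) (n := Φ₂.n * Φ₁.n)).surjective j
  obtain ⟨⟨j₂, j₁⟩, rfl⟩ := finProdFinEquiv.surjective j
  obtain rfl : i' = finProdFinEquiv (m := Φ₃'.n * Φ₂'.n) (finProdFinEquiv (i₃, i₂), i₁) := by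
    rw [← cast_finProdFinEquiv]
    exact Fin.ext hi.symm
  obtain rfl : j' = finProdFinEquiv (m := Φ₃.n * Φ₂.n) (finProdFinEquiv (j₃, j₂), j₁) := by
    rw [← cast_finProdFinEquiv]
    exact Fin.ext hj.symm
  calc compMatrix (compHom α₁ α₂) α₃ (finProdFinEquiv (i₃, finProdFinEquiv (i₂, i₁)))
        (finProdFinEquiv (j₃, finProdFinEquiv (j₂, j₁)))
      = ((compObj Φ₁' Φ₂').act (Hom.matrix α₃ i₃ j₃) * Hom.matrix (compHom α₁ α₂))
          (finProdFinEquiv (i₂, i₁)) (finProdFinEquiv (j₂, j₁)) :=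
        compMatrix_apply (compHom α₁ α₂) α₃ _ _ _ _
    _ = (Φ₁'.act ((Φ₂'.act (Hom.matrix α₃ i₃ j₃) * Hom.matrix α₂) i₂ j₂) *
          Hom.matrix α₁) i₁ j₁ := by
        rw [matrix_compHom, act_mul_compMatrix]
        exact blockMul_apply _ _ _ _ _ _ _
    _ = (Φ₁'.act (compMatrix α₂ α₃ (finProdFinEquiv (i₃, i₂)) (finProdFinEquiv (j₃, j₂))) *
          Hom.matrix α₁) i₁ j₁ := by
        rw [← compMatrix_apply]
    _ = compMatrix α₁ (compHom α₂ α₃) (finProdFinEquiv (finProdFinEquiv (i₃, i₂), i₁))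
          (finProdFinEquiv (finProdFinEquiv (j₃, j₂), j₁)) := by
        rw [← matrix_compHom]
        exact (compMatrix_apply α₁ (compHom α₂ α₃) _ _ _ _).symm

end Matrices

theorem compFunctor_assoc :
    prod.inverseAssociator (Corr W V) (Corr V U) (Corr U X) ⋙
      (compFunctor W V U).prod (𝟭 (Corr U X)) ⋙ compFunctor W U X =
      (𝟭 (Corr W V)).prod (compFunctor V U X) ⋙ compFunctor W V X := by
  refine Corr.functor_ext (fun Φ => compObj_assoc Φ.1 Φ.2.1 Φ.2.2) fun α i j i' j' hi hj => ?_
  change Hom.matrix (compHom (compHom α.1 α.2.1) α.2.2) i j =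
    Hom.matrix (compHom α.1 (compHom α.2.1 α.2.2)) i' j'
  rw [matrix_compHom, matrix_compHom]
  exact compMatrix_assoc α.1 α.2.1 α.2.2 i j i' j' hi hj

lemma idCorr_act (c : Γ(U.scheme, ⊤)) : (idCorr U).act c = Matrix.of fun _ _ => c := by
  change (idTriple U).hom.app ⊤ (rPull (idTriple U).ideal ⊤ c) = _
  ext
  refine (res_self (W := ⊤) le_rfl _).trans ?_
  refine (pull_pull (tgt (diag U).ker) (diagIso U) _ _ c).trans ?_
  refine (pull_congr (diagIso_tgt U) _ c).trans ?_
  rw [pull_id]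
  exact res_self (W := ⊤) _ _

theorem idCorr_compFunctor :
    Prod.sectR (idCorr U) (Corr U X) ⋙ compFunctor U U X = 𝟭 (Corr U X) := by
  refine Corr.functor_ext idCorr_compObj fun {Φ Ψ} α i j i' j' hi hj => ?_
  change Hom.matrix (compHom (𝟙 (idCorr U)) α) i j = Hom.matrix α i' j'
  obtain ⟨⟨i, i₀⟩, rfl⟩ := (finProdFinEquiv (m := Ψ.n) (n := 1)).surjective i
  obtain ⟨⟨j, j₀⟩, rfl⟩ := (finProdFinEquiv (m := Φ.n) (n := 1)).surjective j
  obtain rfl : i' = i := Fin.ext (hi.symm.trans (by simp))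
  obtain rfl : j' = j := Fin.ext (hj.symm.trans (by simp))
  rw [matrix_compHom]
  refine (compMatrix_apply (𝟙 (idCorr U)) α i' i₀ j' j₀).trans ?_
  rw [Hom.matrix_id, act_mul_idem, idCorr_act]
  rfl

theorem compFunctor_idCorr :
    Prod.sectL (Corr U X) (idCorr X) ⋙ compFunctor U X X = 𝟭 (Corr U X) := by
  refine Corr.functor_ext compObj_idCorr fun {Φ Ψ} α i j i' j' hi hj => ?_
  change Hom.matrix (compHom α (𝟙 (idCorr X))) i j = Hom.matrix α i' j'
  obtain ⟨⟨i₀, i⟩, rfl⟩ := (finProdFinEquiv (m := 1) (n := Ψ.n)).surjective i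
  obtain ⟨⟨j₀, j⟩, rfl⟩ := (finProdFinEquiv (m := 1) (n := Φ.n)).surjective j
  obtain rfl : i' = i := Fin.ext (hi.symm.trans (by simp))
  obtain rfl : j' = j := Fin.ext (hj.symm.trans (by simp))
  rw [matrix_compHom]
  refine (compMatrix_apply α (𝟙 (idCorr X)) i₀ i' j₀ j').trans ?_
  rw [Hom.matrix_id, ← act_one, idCorr_act]
  change (Ψ.act 1 * Hom.matrix α) i' j' = _
  rw [act_one, Hom.idem_mul_matrix]

theorem additive_sectR (Φ : Corr V U) :
    (Prod.sectR Φ (Corr U X) ⋙ compFunctor V U X).Additive where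
  map_add {_ _ α β} := by
    apply Hom.matrix_injective
    change Hom.matrix (compHom (𝟙 Φ) (α + β)) =
      Hom.matrix (compHom (𝟙 Φ) α) + Hom.matrix (compHom (𝟙 Φ) β)
    rw [matrix_compHom, matrix_compHom, matrix_compHom]
    exact blockMul_add_left _ _ _ _

theorem additive_sectL (Φ : Corr U X) :
    (Prod.sectL (Corr V U) Φ ⋙ compFunctor V U X).Additive where
  map_add {_ _ α β} := by
    apply Hom.matrix_injective
    change Hom.matrix (compHom (α + β) (𝟙 Φ)) =
      Hom.matrix (compHom α (𝟙 Φ)) + Hom.matrix (compHom β (𝟙 Φ))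
    rw [matrix_compHom, matrix_compHom, matrix_compHom]
    exact blockMul_add_right _ _ _ _

end Functors

/-! ### Biproducts -/

section FinBlocks

variable {R S γ δ : Type*} {a b c d : ℕ}

/-- Vertical concatenation of matrices, with rows indexed by `Fin (a + b)`. -/
def vcat (A : Matrix (Fin a) γ R) (B : Matrix (Fin b) γ R) : Matrix (Fin (a + b)) γ R :=
  (Matrix.fromRows A B).submatrix finSumFinEquiv.symm id

/-- Horizontal concatenation of matrices, with columns indexed by `Fin (a + b)`. -/
def hcat (A : Matrix γ (Fin a) R) (B : Matrix γ (Fin b) R) : Matrix γ (Fin (a + b)) R :=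
  (Matrix.fromCols A B).submatrix id finSumFinEquiv.symm

lemma vcat_map (A : Matrix (Fin a) γ R) (B : Matrix (Fin b) γ R) (f : R → S) :
    (vcat A B).map f = vcat (A.map f) (B.map f) := by
  rw [vcat, vcat, ← Matrix.fromRows_map]
  rfl

lemma hcat_map (A : Matrix γ (Fin a) R) (B : Matrix γ (Fin b) R) (f : R → S) :
    (hcat A B).map f = hcat (A.map f) (B.map f) := by
  rw [hcat, hcat, ← Matrix.fromCols_map]
  rfl

lemma vcat_add [Add R] (A A' : Matrix (Fin a) γ R) (B B' : Matrix (Fin b) γ R) :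
    vcat A B + vcat A' B' = vcat (A + A') (B + B') := by
  ext i j
  obtain ⟨i | i, rfl⟩ := finSumFinEquiv.surjective i <;> simp [vcat]

lemma hcat_add [Add R] (A A' : Matrix γ (Fin a) R) (B B' : Matrix γ (Fin b) R) :
    hcat A B + hcat A' B' = hcat (A + A') (B + B') := by
  ext j i
  obtain ⟨i | i, rfl⟩ := finSumFinEquiv.surjective i <;> simp [hcat]

variable [Semiring R]

lemma vcat_mul [Fintype γ] (A : Matrix (Fin a) γ R) (B : Matrix (Fin b) γ R) (C : Matrix γ δ R) :
    vcat A B * C = vcat (A * C) (B * C) := by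
  rw [vcat, vcat, ← Matrix.fromRows_mul]
  rfl

lemma mul_hcat [Fintype γ] (C : Matrix δ γ R) (A : Matrix γ (Fin a) R) (B : Matrix γ (Fin b) R) :
    C * hcat A B = hcat (C * A) (C * B) := by
  rw [hcat, hcat, ← Matrix.mul_fromCols]
  rfl

lemma hcat_mul_vcat (A : Matrix γ (Fin a) R) (B : Matrix γ (Fin b) R) (C : Matrix (Fin a) δ R)
    (D : Matrix (Fin b) δ R) : hcat A B * vcat C D = A * C + B * D := by
  rw [hcat, vcat, Matrix.submatrix_mul_equiv, Matrix.fromCols_mul_fromRows]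
  rfl

/-- The block diagonal matrix with blocks `A` and `B`, indexed by `Fin (a + c)` and
`Fin (b + d)`. -/
def bdiag (A : Matrix (Fin a) (Fin b) R) (B : Matrix (Fin c) (Fin d) R) :
    Matrix (Fin (a + c)) (Fin (b + d)) R :=
  vcat (hcat A 0) (hcat 0 B)

lemma bdiag_add (A A' : Matrix (Fin a) (Fin b) R) (B B' : Matrix (Fin c) (Fin d) R) :
    bdiag (A + A') (B + B') = bdiag A B + bdiag A' B' := by
  simp only [bdiag, vcat_add, hcat_add, add_zero]

lemma bdiag_mul_vcat (A : Matrix (Fin a) (Fin b) R) (B : Matrix (Fin c) (Fin d) R)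
    (C : Matrix (Fin b) γ R) (D : Matrix (Fin d) γ R) :
    bdiag A B * vcat C D = vcat (A * C) (B * D) := by
  simp only [bdiag, vcat_mul, hcat_mul_vcat, Matrix.zero_mul, add_zero, zero_add]

lemma hcat_mul_bdiag (A : Matrix (Fin a) (Fin b) R) (B : Matrix (Fin c) (Fin d) R)
    (C : Matrix γ (Fin a) R) (D : Matrix γ (Fin c) R) :
    hcat C D * bdiag A B = hcat (C * A) (D * B) := by
  simp only [bdiag, hcat_mul_vcat, mul_hcat, hcat_add, Matrix.mul_zero, add_zero, zero_add]

lemma bdiag_mul {e f : ℕ} (A : Matrix (Fin a) (Fin b) R) (B : Matrix (Fin c) (Fin d) R)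
    (C : Matrix (Fin b) (Fin e) R) (D : Matrix (Fin d) (Fin f) R) :
    bdiag A B * bdiag C D = bdiag (A * C) (B * D) := by
  conv_lhs => rw [bdiag, vcat_mul, hcat_mul_bdiag, hcat_mul_bdiag]
  rw [bdiag, Matrix.zero_mul, Matrix.zero_mul]

lemma bdiag_smul (r : R) (A : Matrix (Fin a) (Fin b) R) (B : Matrix (Fin c) (Fin d) R) :
    bdiag (r • A) (r • B) = r • bdiag A B := by
  ext i j
  obtain ⟨i | i, rfl⟩ := finSumFinEquiv.surjective i <;>
  obtain ⟨j | j, rfl⟩ := finSumFinEquiv.surjective j <;> simp [bdiag, vcat, hcat]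

lemma bdiag_map [Semiring S] (A : Matrix (Fin a) (Fin b) R) (B : Matrix (Fin c) (Fin d) R)
    (f : R →+* S) : (bdiag A B).map f = bdiag (A.map f) (B.map f) := by
  simp only [bdiag, vcat_map, hcat_map, Matrix.map_zero f (map_zero f)]

lemma vcat_mul_hcat_add [Fintype γ] [Fintype δ] (A : Matrix (Fin a) γ R) (B : Matrix γ (Fin b) R)
    (C : Matrix (Fin c) δ R) (D : Matrix δ (Fin d) R) :
    vcat A 0 * hcat B 0 + vcat 0 C * hcat 0 D = bdiag (A * B) (C * D) := by
  rw [vcat_mul, vcat_mul, vcat_add, Matrix.zero_mul, Matrix.zero_mul, add_zero, zero_add, mul_hcat,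
    mul_hcat, Matrix.mul_zero, Matrix.mul_zero, bdiag]

end FinBlocks

namespace MatHom

variable {Z U : Scheme.{u}} {p : Z ⟶ U} {n m : ℕ} (χ : MatHom p n) (ω : MatHom p m)

/-- The direct sum of matrix homomorphisms, with values the block diagonal matrices. -/
def dsum : MatHom p (n + m) :=
  ofFun p (n + m) (fun W f => bdiag (χ.app W f) (ω.app W f))
    (fun W f g => by rw [map_add, map_add, bdiag_add])
    (fun W f g => by rw [map_mul, map_mul, bdiag_mul])
    (fun W a f => by rw [χ.app_pull_mul, ω.app_pull_mul, bdiag_smul])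
    (fun _ _ _ _ => by rw [χ.app_res, ω.app_res, bdiag_map])

lemma dsum_app (W : U.Opens) (f : Γ(Z, p ⁻¹ᵁ W)) :
    (χ.dsum ω).app W f = bdiag (χ.app W f) (ω.app W f) := rfl

lemma app_one_mul_app_one (W : U.Opens) : χ.app W 1 * χ.app W 1 = χ.app W 1 := by
  rw [← map_mul, one_mul]

lemma resMatrix_app_one (W : U.Opens) : resMatrix (χ.app ⊤ 1) W = χ.app W 1 := by
  rw [resMatrix, ← χ.app_res, map_one]

lemma resMatrix_app_one_mul (W : U.Opens) (f : Γ(Z, p ⁻¹ᵁ W)) :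
    resMatrix (χ.app ⊤ 1) W * χ.app W f = χ.app W f := by
  rw [resMatrix_app_one, ← map_mul, one_mul]

lemma mul_resMatrix_app_one (W : U.Opens) (f : Γ(Z, p ⁻¹ᵁ W)) :
    χ.app W f * resMatrix (χ.app ⊤ 1) W = χ.app W f := by
  rw [resMatrix_app_one, ← map_mul, mul_one]

lemma intertwines_inl : Intertwines χ (χ.dsum ω) (vcat (χ.app ⊤ 1) 0) := fun W f => by
  rw [resMatrix, vcat_map, dsum_app, vcat_mul, bdiag_mul_vcat, χ.resMatrix_app_one_mul,
    χ.mul_resMatrix_app_one, Matrix.map_zero _ (map_zero _), Matrix.zero_mul, Matrix.mul_zero]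

lemma intertwines_inr : Intertwines ω (χ.dsum ω) (vcat 0 (ω.app ⊤ 1)) := fun W f => by
  rw [resMatrix, vcat_map, dsum_app, vcat_mul, bdiag_mul_vcat, ω.resMatrix_app_one_mul,
    ω.mul_resMatrix_app_one, Matrix.map_zero _ (map_zero _), Matrix.zero_mul, Matrix.mul_zero]

lemma intertwines_fst : Intertwines (χ.dsum ω) χ (hcat (χ.app ⊤ 1) 0) := fun W f => by
  rw [resMatrix, hcat_map, dsum_app, mul_hcat, hcat_mul_bdiag, χ.resMatrix_app_one_mul,
    χ.mul_resMatrix_app_one, Matrix.map_zero _ (map_zero _), Matrix.zero_mul, Matrix.mul_zero]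

lemma intertwines_snd : Intertwines (χ.dsum ω) ω (hcat 0 (ω.app ⊤ 1)) := fun W f => by
  rw [resMatrix, hcat_map, dsum_app, mul_hcat, hcat_mul_bdiag, ω.resMatrix_app_one_mul,
    ω.mul_resMatrix_app_one, Matrix.map_zero _ (map_zero _), Matrix.zero_mul, Matrix.mul_zero]

end MatHom

section Biproducts

variable {k : Type u} [Field k] {U X : Sm k}

open Corr

lemma isSubSch_top : IsSubSch (⊤ : IdealSheafData (prodScheme U X)) :=
  ⟨⊥, ⟨∅, Set.finite_empty, by simp, by simp⟩, 0, (pow_zero _).symm⟩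

/-- The zero object of `𝒜(U, X)`. -/
def zeroCorr (U X : Sm k) : Corr U X :=
  Triple.toCorr (n := 0) ⟨⊤, isSubSch_top, ⟨fun _ => 0, fun _ _ _ => Subsingleton.elim _ _,
    fun _ _ => Subsingleton.elim _ _⟩⟩

instance : HasZeroObject (Corr U X) :=
  ⟨zeroCorr U X, (Limits.IsZero.iff_id_eq_zero _).mpr
    (Hom.matrix_injective (Matrix.ext fun i _ => Fin.elim0 i))⟩

namespace Corr

variable {Φ Ψ Θ : Corr U X}

lemma exists_matrix_eq {M : Matrix (Fin Ψ.n) (Fin Φ.n) Γ(U.scheme, ⊤)} (hM : IsLinear Φ Ψ M)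
    (h : Ψ.idem ⊤ * M = M) (h' : M * Φ.idem ⊤ = M) : ∃ α : Φ ⟶ Ψ, Hom.matrix α = M :=
  ⟨_, matrix_homOf h h' hM⟩

lemma hasBinaryBiproduct_of_matrix {A : Matrix (Fin Θ.n) (Fin Φ.n) Γ(U.scheme, ⊤)}
    {B : Matrix (Fin Θ.n) (Fin Ψ.n) Γ(U.scheme, ⊤)}
    {C : Matrix (Fin Φ.n) (Fin Θ.n) Γ(U.scheme, ⊤)}
    {D : Matrix (Fin Ψ.n) (Fin Θ.n) Γ(U.scheme, ⊤)} (hA : IsLinear Φ Θ A) (hB : IsLinear Ψ Θ B)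
    (hC : IsLinear Θ Φ C) (hD : IsLinear Θ Ψ D) (A_idem : A * Φ.idem ⊤ = A)
    (B_idem : B * Ψ.idem ⊤ = B) (idem_C : Φ.idem ⊤ * C = C) (idem_D : Ψ.idem ⊤ * D = D)
    (CA : C * A = Φ.idem ⊤) (CB : C * B = 0) (DA : D * A = 0) (DB : D * B = Ψ.idem ⊤)
    (total : A * C + B * D = Θ.idem ⊤) : HasBinaryBiproduct Φ Ψ := by
  have idem_A : Θ.idem ⊤ * A = A := by
    rw [← total, Matrix.add_mul, Matrix.mul_assoc, Matrix.mul_assoc, CA, DA, Matrix.mul_zero,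
      add_zero, A_idem]
  have idem_B : Θ.idem ⊤ * B = B := by
    rw [← total, Matrix.add_mul, Matrix.mul_assoc, Matrix.mul_assoc, CB, DB, Matrix.mul_zero,
      zero_add, B_idem]
  have C_idem : C * Θ.idem ⊤ = C := by
    rw [← total, Matrix.mul_add, ← Matrix.mul_assoc, ← Matrix.mul_assoc, CA, CB, Matrix.zero_mul,
      add_zero, idem_C]
  have D_idem : D * Θ.idem ⊤ = D := by
    rw [← total, Matrix.mul_add, ← Matrix.mul_assoc, ← Matrix.mul_assoc, DA, DB, Matrix.zero_mul,
      zero_add, idem_D]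
  obtain ⟨a, rfl⟩ := exists_matrix_eq hA idem_A A_idem
  obtain ⟨b, rfl⟩ := exists_matrix_eq hB idem_B B_idem
  obtain ⟨c, rfl⟩ := exists_matrix_eq hC idem_C C_idem
  obtain ⟨d, rfl⟩ := exists_matrix_eq hD idem_D D_idem
  refine hasBinaryBiproduct_of_total
    { pt := Θ, fst := c, snd := d, inl := a, inr := b
      inl_fst := Hom.matrix_injective ?_, inl_snd := Hom.matrix_injective ?_
      inr_fst := Hom.matrix_injective ?_, inr_snd := Hom.matrix_injective ?_ }
    (Hom.matrix_injective ?_)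
  · rw [Hom.matrix_comp, Hom.matrix_id, CA]
  · rw [Hom.matrix_comp, Hom.matrix_zero, DA]
  · rw [Hom.matrix_comp, Hom.matrix_zero, CB]
  · rw [Hom.matrix_comp, Hom.matrix_id, DB]
  · change Hom.matrix (c ≫ a + d ≫ b) = Hom.matrix (𝟙 Θ)
    rw [Hom.matrix_add, Hom.matrix_comp, Hom.matrix_comp, Hom.matrix_id, total]

theorem hasBinaryBiproduct (Φ Ψ : Corr U X) : HasBinaryBiproduct Φ Ψ := by
  obtain ⟨J, hJ, χ, ω, h, h'⟩ := exists_common_support Φ Ψ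
  have eχ := χ.app_one_mul_app_one ⊤
  have eω := ω.app_one_mul_app_one ⊤
  refine hasBinaryBiproduct_of_matrix (Θ := Triple.toCorr ⟨J, hJ, χ.dsum ω⟩)
    ⟨J, hJ, χ, _, h, rfl, χ.intertwines_inl ω⟩ ⟨J, hJ, ω, _, h', rfl, χ.intertwines_inr ω⟩
    ⟨J, hJ, _, χ, rfl, h, χ.intertwines_fst ω⟩ ⟨J, hJ, _, ω, rfl, h', χ.intertwines_snd ω⟩
    ?_ ?_ ?_ ?_
    ((hcat_mul_vcat _ _ _ _).trans ?_) ((hcat_mul_vcat _ _ _ _).trans ?_)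
    ((hcat_mul_vcat _ _ _ _).trans ?_) ((hcat_mul_vcat _ _ _ _).trans ?_)
    ((vcat_mul_hcat_add _ _ _ _).trans (congr_arg₂ bdiag eχ eω))
  · refine (vcat_mul _ _ _).trans (congr_arg₂ vcat ?_ (Matrix.zero_mul _))
    rw [idem_eq h, eχ]
  · refine (vcat_mul _ _ _).trans (congr_arg₂ vcat (Matrix.zero_mul _) ?_)
    rw [idem_eq h', eω]
  · refine (mul_hcat _ _ _).trans (congr_arg₂ hcat ?_ (Matrix.mul_zero _))
    rw [idem_eq h, eχ]
  · refine (mul_hcat _ _ _).trans (congr_arg₂ hcat (Matrix.mul_zero _) ?_)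
    rw [idem_eq h', eω]
  · rw [eχ, Matrix.zero_mul, add_zero, idem_eq h]
  · rw [Matrix.zero_mul, Matrix.mul_zero, add_zero]
  · rw [Matrix.zero_mul, Matrix.mul_zero, add_zero]
  · rw [eω, Matrix.zero_mul, zero_add, idem_eq h']

theorem hasFiniteBiproducts (U X : Sm k) : HasFiniteBiproducts (Corr U X) := by
  have : HasBinaryBiproducts (Corr U X) := ⟨hasBinaryBiproduct⟩
  have : HasFiniteProducts (Corr U X) := hasFiniteProducts_of_has_binary_and_terminal
  exact HasFiniteBiproducts.of_hasFiniteProducts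

end Corr

end Biproducts

end KMotive

end

theorem mainTheorem8 (k : Type u) [Field k] :
    (∀ V U X : KMotive.Sm k,
      ∃! F : KMotive.Corr V U × KMotive.Corr U X ⥤ KMotive.Corr V X, KMotive.IsPairing F) ∧
    ∃ E : KMotive.AdditiveEnrichment (KMotive.Sm k) (fun U X => KMotive.Corr U X),
      (∀ V U X : KMotive.Sm k, KMotive.IsPairing (E.comp V U X)) ∧
      (∀ X : KMotive.Sm k, KMotive.IsIdentity (E.id X)) :=
  ⟨fun V U X =>
      ⟨KMotive.compFunctor V U X, KMotive.isPairing_compFunctor, fun _ hF => hF.eq_compFunctor⟩,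
    { comp := fun V U X => KMotive.compFunctor V U X
      id := KMotive.idCorr
      hasFiniteBiproducts := KMotive.Corr.hasFiniteBiproducts
      additive_left := fun _ _ _ Φ => KMotive.additive_sectL Φ
      additive_right := fun _ _ _ Φ => KMotive.additive_sectR Φ
      assoc := fun _ _ _ _ => KMotive.compFunctor_assoc
      id_comp := fun _ _ => KMotive.idCorr_compFunctor
      comp_id := fun _ _ => KMotive.compFunctor_idCorr },
    fun _ _ _ => KMotive.isPairing_compFunctor, KMotive.isIdentity_idCorr⟩
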